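/- Let $\mathbb{F}_q$ be a finite field with $q$ elements, let $n\ge 1$, $d\ge 2$, and let $X=X^n\subset\mathbb{P}^{n+1}$ be the hypersurface $F=0$, where $F\in\mathbb{F}_q[X_0,\dots,X_{n+1}]$ is a nonzero homogeneous polynomial of degree $d$. Let $N_q(Y)$ denote the number of $\mathbb{F}_q$-points of $Y$, and let $k=k_X$ be the largest $h$ such that some $\mathbb{F}_q$-linear subspace $\mathbb{P}^h\subset\mathbb{P}^{n+1}$ is contained in $X$ (as an algebraic variety, i.e. over $\overline{\mathbb{F}}_q$). Assume $0<k\le n$. Then $$N_q(X)\le (d-1)q^{k}N_q(\mathbb{P}^{n-k})+N_q(\mathbb{P}^{k}),$$ and equality holds if and only if one of the following occurs. Here $X_H^m\subset\mathbb{P}^{m+1}$ (for $q$ a square) denotes the nonsingular Hermitian hypersurface $X_0^{\sqrt q+1}+\dots+X_{m+1}^{\sqrt q+1}=0$, $\mathbb{P}^l*Y$ denotes the cone over $Y$ whose vertex is an $\mathbb{F}_q$-linear subspace $\mathbb{P}^l$ disjoint from the linear space in which $Y$ lies, with $\mathbb{P}^{-1}=\emptyset$ and $\mathbb{P}^{-1}*Y=Y$,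 and projective equivalence is over $\mathbb{F}_q$. (I) $k=n$ and $X$ is a union of $d$ distinct hyperplanes over $\mathbb{F}_q$ that contain a common $\mathbb{F}_q$-linear subspace of codimension $2$ in $\mathbb{P}^{n+1}$. (II) $0<k\le n-1$ and one of the following holds: (1) $d=q+1$ and $X$ is given by $(X_0,\dots,X_{n+1})\,A\,{}^t(X_0^q,\dots,X_{n+1}^q)=0$, where $A$ is an $(n+2)\times(n+2)$ matrix over $\mathbb{F}_q$ with ${}^tA=-A$ and zero diagonal. (2) $q$ is a square, $d=\sqrt q+1$, and either (a) $n=2h$ with $h\ge 1$, $1\le k\le 2h-1$, and either (i) $X$ has no singular $\mathbb{F}_q$-point, $k=h$ and $X$ is projectively equivalent to $X_H^{2h}$; or (ii) $X$ has a singular $\mathbb{F}_q$-point, $h\ge 2$, and for some $1\le j\le h-1$ one has $k=h+j$ and $X$ is projectively equivalent to $\mathbb{P}^{2j-1}*X_H^{2h-2j}$; or (b) $n=2h+1$ with $h\ge 1$, $1\le k\le 2h$, and for some $0\le j\le h-1$ one has $k=h+1+j$ and $X$ is projectively equivalent to $\mathbb{P}^{2j}*X_H^{2h-2j}$. (3)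 $d=2$, and for some integer $h$ with $-1\le h\le n-1$ one has $k=\frac{n+h+1}{2}$ (in particular $n+h+1$ is even) and $X$ is projectively equivalent to the cone $\mathbb{P}^h*Q^{n-h-1}$ over the hyperbolic quadric $Q^{n-h-1}\subset\mathbb{P}^{n-h}$ given by $X_0X_1+X_2X_3+\dots+X_{n-h-1}X_{n-h}=0$. Moreover, if $X$ is given by a matrix $A$ as in (1), then $X$ is space-filling, i.e. $X(\mathbb{F}_q)=\mathbb{P}^{n+1}(\mathbb{F}_q)$, and $X$ is nonsingular (over $\overline{\mathbb{F}}_q$) if and only if $\det A\ne 0$; in particular, if $n$ is odd, then $X$ is singular. -/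

import Mathlib

open MvPolynomial

noncomputable section

namespace FqHypersurface

variable {K : Type*} [Field K]

/-- The extension of scalars to the algebraic closure of a linear subspace of `K ^ N`: the set of
geometric points (in homogeneous coordinates) of the corresponding projective linear subspace. -/
def geometricSpan {N : ℕ} (W : Submodule K (Fin N → K)) :
    Submodule (AlgebraicClosure K) (Fin N → AlgebraicClosure K) :=
  Submodule.span (AlgebraicClosure K)
    ((fun (w : Fin N → K) (i : Fin N) => algebraMap K (AlgebraicClosure K) (w i)) '' (W : Set _))

/-- The `K`-rational points of the hypersurface `F = 0` in projective space
(`F` is meant to be homogeneous, so that the choice of a representative is immaterial). -/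
def rationalPoints {N : ℕ} (F : MvPolynomial (Fin N) K) :
    Set (Projectivization K (Fin N → K)) :=
  {P | eval P.rep F = 0}

/-- The number of `K`-rational points of the hypersurface `F = 0`. -/
def numPoints {N : ℕ} (F : MvPolynomial (Fin N) K) : ℕ :=
  (rationalPoints F).ncard

variable (K) in
/-- The number of `K`-rational points of the `m`-dimensional projective space. -/
def numPointsProj (m : ℕ) : ℕ :=
  Nat.card (Projectivization K (Fin (m + 1) → K))

/-- The projective linear subspace attached to `W` is contained in the hypersurface `F = 0`
as an algebraic variety, i.e. `F` vanishes at all its points over the algebraic closure. -/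
def ContainsSubspace {N : ℕ} (F : MvPolynomial (Fin N) K) (W : Submodule K (Fin N → K)) : Prop :=
  ∀ x ∈ geometricSpan W, aeval x F = 0

/-- The set of all `h` such that the hypersurface `F = 0` contains a projective linear subspace
of dimension `h` defined over `K`. -/
def linearDims {N : ℕ} (F : MvPolynomial (Fin N) K) : Set ℕ :=
  {h | ∃ W : Submodule K (Fin N → K), Module.finrank K W = h + 1 ∧ ContainsSubspace F W}

/-- The `K`-rational singular points of the hypersurface `F = 0`. -/
def rationalSing {N : ℕ} (F : MvPolynomial (Fin N) K) :
    Set (Projectivization K (Fin N → K)) :=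
  {P | eval P.rep F = 0 ∧ ∀ i, eval P.rep (pderiv i F) = 0}

/-- The hypersurface `F = 0` has no singular point over the algebraic closure. -/
def Nonsingular {N : ℕ} (F : MvPolynomial (Fin N) K) : Prop :=
  ∀ x : Fin N → AlgebraicClosure K, x ≠ 0 → aeval x F = 0 → ∃ i, aeval x (pderiv i F) ≠ 0

/-- The linear substitution `X_i ↦ ∑ j, g i j X_j`. -/
def linearSubst {N : ℕ} (g : Matrix (Fin N) (Fin N) K) (F : MvPolynomial (Fin N) K) :
    MvPolynomial (Fin N) K :=
  bind₁ (fun i => ∑ j, C (g i j) * X j) F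

/-- Projective equivalence over `K` of the hypersurfaces `F = 0` and `G = 0`. -/
def ProjEquiv {N : ℕ} (F G : MvPolynomial (Fin N) K) : Prop :=
  ∃ (g : GL (Fin N) K) (c : K), c ≠ 0 ∧ linearSubst (g : Matrix (Fin N) (Fin N) K) F = C c * G

/-- The hypersurface `F = 0` in `N` variables is projectively equivalent to the cone `ℙ^l * Y`,
where `Y` is the hypersurface `G = 0` in `M` variables. In suitable coordinates the vertex is
the subspace where the first `M` coordinates vanish, there are `l + 1` remaining coordinates, and
the cone is given by the same equation `G = 0` in the first `M` coordinates.
For `l = -1` the vertex is empty and the cone is `Y` itself. -/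
def ProjEquivCone {N M : ℕ} (F : MvPolynomial (Fin N) K) (l : ℤ) (G : MvPolynomial (Fin M) K) :
    Prop :=
  ∃ r : ℕ, (r : ℤ) = l + 1 ∧ ∃ h : M + r = N,
    ProjEquiv F (rename (fun i : Fin M => Fin.cast h (Fin.castAdd r i)) G)

/-- The hypersurface `F = 0` of degree `d` is the union of `d` distinct hyperplanes over `K` which
contain a common `K`-linear subspace of codimension two. -/
def IsUnionOfHyperplanesThroughCodimTwo {N : ℕ} (F : MvPolynomial (Fin N) K) (d : ℕ) : Prop :=
  ∃ (W : Submodule K (Fin N → K)) (H : Fin d → Submodule K (Fin N → K)),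
    Module.finrank K W + 2 = N ∧ Function.Injective H ∧
    (∀ i, Module.finrank K (H i) + 1 = N ∧ W ≤ H i) ∧
    ∀ x : Fin N → AlgebraicClosure K, aeval x F = 0 ↔ ∃ i, x ∈ geometricSpan (H i)

/-- The form `(X_0, …, X_{N-1}) A (X_0^q, …, X_{N-1}^q)ᵗ`, with `q` the cardinality of `K`. -/
def frobeniusForm {N : ℕ} (A : Matrix (Fin N) (Fin N) K) : MvPolynomial (Fin N) K :=
  ∑ i, ∑ j, C (A i j) * X i * X j ^ Nat.card K

variable (K) in
/-- The equation `X_0^{s+1} + ⋯ + X_{m+1}^{s+1}` of the nonsingular Hermitian hypersurface of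
dimension `m` over the field `K` with `s ^ 2` elements. -/
def hermitianForm (m s : ℕ) : MvPolynomial (Fin (m + 2)) K :=
  ∑ i, X i ^ (s + 1)

variable (K) in
/-- The equation `X_0 X_1 + X_2 X_3 + ⋯ + X_{2t} X_{2t+1}` of the hyperbolic quadric of
dimension `2 t`. -/
def hyperbolicForm (t : ℕ) : MvPolynomial (Fin (2 * t + 2)) K :=
  ∑ i : Fin (t + 1), X ⟨2 * (i : ℕ), by omega⟩ * X ⟨2 * (i : ℕ) + 1, by omega⟩

/-- Space-filling case: degree `q + 1`, given by a skew-symmetric matrix with zero diagonal. -/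
def SpaceFillingCase {n : ℕ} (F : MvPolynomial (Fin (n + 2)) K) (d : ℕ) : Prop :=
  d = Nat.card K + 1 ∧
    ∃ A : Matrix (Fin (n + 2)) (Fin (n + 2)) K,
      A.transpose = -A ∧ (∀ i, A i i = 0) ∧ F = frobeniusForm A

/-- Hermitian case: `q = s ^ 2`, degree `s + 1`, and the hypersurface is a nonsingular Hermitian
hypersurface or a cone over one, with the stated dimensions. -/
def HermitianCase {n : ℕ} (F : MvPolynomial (Fin (n + 2)) K) (d k : ℕ) : Prop :=
  ∃ s : ℕ, s ^ 2 = Nat.card K ∧ d = s + 1 ∧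
    ((∃ h : ℕ, 1 ≤ h ∧ n = 2 * h ∧ 1 ≤ k ∧ k ≤ 2 * h - 1 ∧
        ((rationalSing F = ∅ ∧ k = h ∧ ProjEquivCone F (-1) (hermitianForm K (2 * h) s)) ∨
          (rationalSing F ≠ ∅ ∧ 2 ≤ h ∧ ∃ j : ℕ, 1 ≤ j ∧ j ≤ h - 1 ∧ k = h + j ∧
            ProjEquivCone F (2 * (j : ℤ) - 1) (hermitianForm K (2 * h - 2 * j) s)))) ∨
      (∃ h : ℕ, 1 ≤ h ∧ n = 2 * h + 1 ∧ 1 ≤ k ∧ k ≤ 2 * h ∧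
        ∃ j : ℕ, j ≤ h - 1 ∧ k = h + 1 + j ∧
          ProjEquivCone F (2 * (j : ℤ)) (hermitianForm K (2 * h - 2 * j) s)))

/-- Quadric case: a cone `ℙ^h * Q` over the hyperbolic quadric `Q` of dimension `n - h - 1`,
with `k = (n + h + 1) / 2`. -/
def QuadricCase {n : ℕ} (F : MvPolynomial (Fin (n + 2)) K) (d k : ℕ) : Prop :=
  d = 2 ∧ ∃ h : ℤ, -1 ≤ h ∧ h ≤ (n : ℤ) - 1 ∧ 2 * (k : ℤ) = n + h + 1 ∧
    ∃ t : ℕ, 2 * (t : ℤ) = n - h - 1 ∧ ProjEquivCone F h (hyperbolicForm K t)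

end FqHypersurface

end

open FqHypersurface

noncomputable section

namespace FqHypersurface

variable {K : Type*} [Field K]

/-! ### Homogeneous forms restricted to planes -/

/-! Write q for the cardinality of `K`, N = n + 2, and B(x, y) for `differential F x y`. All
counting is done with the Z affine zeros of F in `K ^ N`; the bound becomes Z + (d - 1) q ^ k ≤ (d -
1) q ^ (n + 1) + q ^ (k + 1).

If d > q, the excess of the bound over the trivial estimate Z ≤ q ^ N is a nonnegative multiple of d
- (q + 1) (`exists_bound_eq_add`), so equality means that d = q + 1 and F vanishes at every rational
point. Such forms are exactly the alternating Frobenius forms (`exists_eq_frobeniusForm`); if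
moreover k = n, the alternating matrix has rank two and F splits into linear factors
(`isUnionOfHyperplanes_frobeniusForm`).

If d ≤ q, let L be a linear space of zeros of dimension k + 1. On a coset u + L outside L, F is a
nonzero polynomial function of degree at most d - 1, because its part of degree d is F on L.
Schwartz-Zippel bounds its zeros, and summing over the cosets gives the bound (`card_zeros_add_le`).
In case of equality every coset attains the Schwartz-Zippel bound, which forces a product of
parallel hyperplanes (`IsPolyFun.eq_prod_of_card_zeros`), whence F(t u + l) = α t ∏ (φ(l) - a_i t)
and B(l, u) = α φ(l) ^ (d - 1) (`IsExtremal.exists_factorization`).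

This local structure decides everything. For k = n it is already the factorization of F. For d = 2
the number of zeros alone identifies the quadratic form, by splitting off radical vectors and
hyperbolic planes (`exists_hyperbolic_decomposition`). For d ≥ 3 and k < n, a zero off L lies on a
neighbouring zero space that meets L in a hyperplane of L, and moving between such spaces yields
B(x, z) = c B(z, x) ^ (d - 1) for every zero z (`IsExtremal.ratio`). The map t ↦ t ^ (d - 1) turns
out to be additive, then (d - 1) ^ 2 = q and c does not depend on z, so F is a scalar multiple of
the norm of a Hermitian form (`IsExtremal.exists_hermitian`). Diagonalizing it and counting zeros
determines its rank and the dimension of its radical. -/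

theorem pderiv_bind₁ {σ τ : Type*} [Fintype σ] (g : σ → MvPolynomial τ K) (j : τ)
    (F : MvPolynomial σ K) :
    pderiv j (bind₁ g F) = ∑ i, bind₁ g (pderiv i F) * pderiv j (g i) := by
  classical
  induction F using MvPolynomial.induction_on with
  | C a => simp
  | add p q hp hq => simp [hp, hq, add_mul, Finset.sum_add_distrib]
  | mul_X p i hp =>
    simp only [map_mul, bind₁_X_right, Derivation.leibniz, smul_eq_mul, hp, map_add, pderiv_X,
      add_mul, Finset.sum_add_distrib, Finset.mul_sum]
    congr 1
    · rw [Finset.sum_eq_single i]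
      · simp
      · intro b _ hb
        simp [Ne.symm hb]
      · simp
    · exact Finset.sum_congr rfl fun _ _ => by ring

/-- The differential at `x` of the form `F`. -/
def differential {N : ℕ} (F : MvPolynomial (Fin N) K) (x : Fin N → K) :
    (Fin N → K) →ₗ[K] K :=
  ∑ i, eval x (pderiv i F) • LinearMap.proj i

theorem differential_apply {N : ℕ} (F : MvPolynomial (Fin N) K) (x y : Fin N → K) :
    differential F x y = ∑ i, eval x (pderiv i F) * y i := by
  simp [differential]

theorem eval_smul_of_isHomogeneous {σ : Type*} {F : MvPolynomial σ K} {d : ℕ}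
    (hF : F.IsHomogeneous d) (t : K) (x : σ → K) : eval (t • x) F = t ^ d * eval x F := by
  simp only [eval_eq, Finset.mul_sum]
  refine Finset.sum_congr rfl fun m hm => ?_
  have : ∑ i ∈ m.support, m i = d := hF.degree_eq_sum_deg_support hm |>.symm ▸ rfl
  simp only [Pi.smul_apply, smul_eq_mul, mul_pow, Finset.prod_mul_distrib, Finset.prod_pow_eq_pow_sum,
    this]
  ring

theorem eval_zero_of_isHomogeneous {σ : Type*} {F : MvPolynomial σ K} {d : ℕ}
    (hF : F.IsHomogeneous d) (hd : d ≠ 0) : eval (0 : σ → K) F = 0 := by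
  simpa [hd] using eval_smul_of_isHomogeneous hF 0 0

theorem differential_smul {N d : ℕ} {F : MvPolynomial (Fin N) K} (hF : F.IsHomogeneous d) (t : K)
    (x y : Fin N → K) : differential F (t • x) y = t ^ (d - 1) * differential F x y := by
  simp only [differential_apply, eval_smul_of_isHomogeneous hF.pderiv, Finset.mul_sum, mul_assoc]

theorem differential_self {N d : ℕ} {F : MvPolynomial (Fin N) K} (hF : F.IsHomogeneous d)
    (x : Fin N → K) : differential F x x = d * eval x F := by
  have := congrArg (eval x) hF.sum_X_mul_pderiv
  simp only [map_sum, map_mul, eval_X, nsmul_eq_mul, map_natCast] at this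
  rw [← this, differential_apply]
  exact Finset.sum_congr rfl fun _ _ => mul_comm _ _

/-- A binary form is a combination of the monomials `X₀ ^ (d - j) X₁ ^ j`. -/
theorem binary_form_eq_sum {Q : MvPolynomial (Fin 2) K} {d : ℕ} (hQ : Q.IsHomogeneous d) :
    ∃ c : ℕ → K, Q = ∑ j ∈ Finset.range (d + 1), C (c j) * X 0 ^ (d - j) * X 1 ^ j := by
  classical
  let m : ℕ → (Fin 2 →₀ ℕ) := fun j => Finsupp.single 0 (d - j) + Finsupp.single 1 j
  refine ⟨fun j => coeff (m j) Q, ?_⟩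
  have key : ∀ j, C (coeff (m j) Q) * X 0 ^ (d - j) * X 1 ^ j = monomial (m j) (coeff (m j) Q) := by
    intro j
    rw [mul_assoc, X_pow_eq_monomial, X_pow_eq_monomial, monomial_mul, C_mul_monomial]
    simp [m]
  simp only [key]
  ext e
  rw [coeff_sum]
  simp only [coeff_monomial]
  by_cases he : e.degree = d
  · have h2 : e 0 + e 1 = d := by
      rw [← he, Finsupp.degree_eq_sum]; simp
    have hme : m (e 1) = e := by
      ext i
      fin_cases i
      · simp [m]; omega
      · simp [m]
    rw [Finset.sum_eq_single (e 1)]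
    · simp [hme]
    · intro j _ hj
      rw [if_neg]
      rintro rfl
      simp [m] at hj
    · intro h
      simp at h
      omega
  · rw [hQ.coeff_eq_zero he, Finset.sum_eq_zero]
    intro j hj
    rw [if_neg]
    rintro rfl
    apply he
    rw [Finsupp.degree_eq_sum]
    simp [m] at hj ⊢
    omega

/-- Restriction of a form to the plane spanned by two vectors. -/
theorem exists_binary_expansion {N d : ℕ} {F : MvPolynomial (Fin N) K} (hF : F.IsHomogeneous d)
    (x y : Fin N → K) :
    ∃ c : ℕ → K, c 0 = eval x F ∧ c d = eval y F ∧
      (2 ≤ d → c 1 = differential F x y ∧ c (d - 1) = differential F y x) ∧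
      ∀ v w : K, eval (v • x + w • y) F = ∑ j ∈ Finset.range (d + 1), c j * v ^ (d - j) * w ^ j := by
  let g : Fin N → MvPolynomial (Fin 2) K := fun i => C (x i) * X 0 + C (y i) * X 1
  have hg : ∀ i, (g i).IsHomogeneous 1 := fun i =>
    (isHomogeneous_C_mul_X _ _).add (isHomogeneous_C_mul_X _ _)
  have hQ : (bind₁ g F).IsHomogeneous d := by
    simpa using hF.aeval g hg
  have hev : ∀ (p : Fin 2 → K) (G : MvPolynomial (Fin N) K),
      eval p (bind₁ g G) = eval (p 0 • x + p 1 • y) G := by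
    intro p G
    rw [← aeval_eq_eval, ← aeval_eq_eval, aeval_bind₁]
    congr 2
    ext i
    simp [g, mul_comm]
  obtain ⟨c, hc⟩ := binary_form_eq_sum hQ
  have hsum : ∀ v w : K, eval (v • x + w • y) F =
      ∑ j ∈ Finset.range (d + 1), c j * v ^ (d - j) * w ^ j := by
    intro v w
    have := hev ![v, w] F
    rw [hc] at this
    simpa using this.symm
  refine ⟨c, ?_, ?_, ?_, hsum⟩
  · have := hsum 1 0
    simp only [one_smul, zero_smul, add_zero, one_pow, mul_one] at this
    rw [this, Finset.sum_eq_single 0] <;> simp +contextual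
  · have := hsum 0 1
    simp only [one_smul, zero_smul, zero_add, one_pow, mul_one] at this
    rw [this, Finset.sum_eq_single d]
    · simp
    · intro j hj hjd
      simp at hj
      have : d - j ≠ 0 := by omega
      simp [this]
    · simp
  -- The coefficients next to the two ends come from differentiating the binary form at (1, 0) and
  -- (0, 1); by the chain rule `pderiv_bind₁` they are the two mixed differentials.
  · intro hd
    have hch : ∀ (p : Fin 2 → K) (j : Fin 2), eval p (pderiv j (bind₁ g F)) =
        ∑ i, eval (p 0 • x + p 1 • y) (pderiv i F) * eval p (pderiv j (g i)) := by
      intro p j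
      rw [pderiv_bind₁]
      simp [hev]
    constructor
    · have h1 := hch ![1, 0] 1
      have h2 : ∀ i, eval (![1, 0] : Fin 2 → K) (pderiv 1 (g i)) = y i := by
        intro i; simp [g]
      simp only [h2] at h1
      simp only [Matrix.cons_val_zero, one_smul, Matrix.cons_val_one, zero_smul,
        add_zero] at h1
      rw [differential_apply, ← h1, hc, map_sum, map_sum, Finset.sum_eq_single 1]
      · simp
      · intro j _ hj
        simp only [pderiv_mul, pderiv_pow, pderiv_C, map_add, map_mul, eval_C, map_zero, eval_X,
          map_pow, pderiv_X_self, pderiv_X_of_ne (show (0 : Fin 2) ≠ 1 by decide)]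
        rcases j with _ | _ | j <;> simp at hj ⊢
      · intro h; simp at h; omega
    · have h1 := hch ![0, 1] 0
      have h2 : ∀ i, eval (![0, 1] : Fin 2 → K) (pderiv 0 (g i)) = x i := by
        intro i; simp [g]
      simp only [h2] at h1
      simp only [Matrix.cons_val_zero, one_smul, Matrix.cons_val_one, zero_smul,
        zero_add] at h1
      rw [differential_apply, ← h1, hc, map_sum, map_sum, Finset.sum_eq_single (d - 1)]
      · have : d - (d - 1) = 1 := by omega
        simp [this]
      · intro j hj hjd
        simp at hj
        simp only [pderiv_mul, pderiv_pow, pderiv_C, map_add, map_mul, eval_C, map_zero, eval_X,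
          map_pow, pderiv_X_self, pderiv_X_of_ne (show (1 : Fin 2) ≠ 0 by decide)]
        rcases hdj : d - j with _ | _ | e
        · simp
        · omega
        · simp
      · intro h; simp at h

/-- A binary form of degree at most `q` vanishing at all rational points is zero. -/
theorem binary_coeff_eq_zero [Finite K] {m : ℕ} (hm : m ≤ Nat.card K) {c : ℕ → K}
    (h : ∀ v w : K, ∑ j ∈ Finset.range (m + 1), c j * v ^ (m - j) * w ^ j = 0) :
    ∀ j ≤ m, c j = 0 := by
  -- The top coefficient is the value at (0, 1). Removing it first leaves degree less than q after
  -- setting v = 1, so that the borderline m = q is allowed.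
  have hcm : c m = 0 := by
    have := h 0 1
    rw [Finset.sum_eq_single m] at this
    · simpa using this
    · intro j hj hjd
      simp at hj
      have : m - j ≠ 0 := by omega
      simp [this]
    · simp
  have := Fintype.ofFinite K
  let P : Polynomial K := ∑ j ∈ Finset.range m, Polynomial.C (c j) * Polynomial.X ^ j
  have hP : P = 0 := by
    refine Polynomial.eq_zero_of_natDegree_lt_card_of_eval_eq_zero' P Finset.univ ?_ ?_
    · intro t _
      have := h 1 t
      rw [Finset.sum_range_succ, hcm] at this
      simpa [P, Polynomial.eval_finsetSum] using this
    · rcases Nat.eq_zero_or_pos m with rfl | hm0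
      · simp [P, Fintype.card_pos]
      · refine lt_of_le_of_lt (b := m - 1) ?_ ?_
        · refine Polynomial.natDegree_sum_le_of_forall_le _ _ fun j hj => ?_
          refine (Polynomial.natDegree_C_mul_X_pow_le _ _).trans ?_
          simp at hj; omega
        · rw [Finset.card_univ, ← Nat.card_eq_fintype_card]; omega
  intro j hj
  rcases Nat.lt_or_eq_of_le hj with hj | rfl
  · have := congrArg (fun p => Polynomial.coeff p j) hP
    simpa [P, Polynomial.finsetSum_coeff, Polynomial.coeff_C_mul, Polynomial.coeff_X_pow, hj]
      using this
  · exact hcm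

/-- The differential of a form of degree at most `q` can be read off from its values. -/
theorem differential_eq_of_expansion [Finite K] {N d : ℕ} {F : MvPolynomial (Fin N) K}
    (hF : F.IsHomogeneous d) (hd : 2 ≤ d) (hdq : d ≤ Nat.card K) {x y : Fin N → K} {e : ℕ → K}
    (h : ∀ v w : K, eval (v • x + w • y) F =
      ∑ j ∈ Finset.range (d + 1), e j * v ^ (d - j) * w ^ j) :
    differential F x y = e 1 := by
  obtain ⟨c, -, -, hc1, hc⟩ := exists_binary_expansion hF x y
  have := binary_coeff_eq_zero hdq (c := fun j => c j - e j) (by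
    intro v w
    have := (hc v w).symm.trans (h v w)
    rw [← sub_eq_zero, ← Finset.sum_sub_distrib] at this
    rw [← this]
    exact Finset.sum_congr rfl fun _ _ => by ring) 1 (by omega)
  rw [← (hc1 hd).1]
  exact sub_eq_zero.1 this

end FqHypersurface

end

noncomputable section

namespace FqHypersurface

variable {K : Type*} [Field K]

/-! ### Polynomial functions with the maximal number of zeros -/

variable {E : Type*} [AddCommGroup E] [Module K E]

/-- Polynomial functions of degree at most `m` on a vector space. -/
def IsPolyFun (m : ℕ) (f : E → K) : Prop :=
  ∃ (N : ℕ) (p : MvPolynomial (Fin N) K) (A : E →ₗ[K] (Fin N → K)) (c : Fin N → K),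
    p.totalDegree ≤ m ∧ ∀ x, f x = eval (A x + c) p

theorem IsPolyFun.comp_affine {E' : Type*} [AddCommGroup E'] [Module K E'] {m : ℕ} {f : E → K}
    (hf : IsPolyFun m f) (T : E' →ₗ[K] E) (e : E) : IsPolyFun m fun x => f (e + T x) := by
  obtain ⟨N, p, A, c, hp, h⟩ := hf
  refine ⟨N, p, A ∘ₗ T, A e + c, hp, fun x => ?_⟩
  simp only [h, map_add, LinearMap.comp_apply]
  congr 2
  abel

theorem totalDegree_bind₁_le {σ τ : Type*} (g : σ → MvPolynomial τ K)
    (hg : ∀ i, (g i).totalDegree ≤ 1) (p : MvPolynomial σ K) :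
    (bind₁ g p).totalDegree ≤ p.totalDegree := by
  have : bind₁ g p = ∑ m ∈ p.support, C (coeff m p) * ∏ i ∈ m.support, g i ^ m i := by
    conv_lhs => rw [p.as_sum]
    rw [map_sum]
    exact Finset.sum_congr rfl fun m _ => bind₁_monomial _ _ _
  rw [this]
  refine totalDegree_finsetSum_le fun m hm => ?_
  refine (totalDegree_mul _ _).trans ?_
  rw [totalDegree_C, zero_add]
  refine (totalDegree_finsetProd _ _).trans (le_trans ?_ (le_totalDegree hm))
  refine Finset.sum_le_sum fun i _ => (totalDegree_pow _ _).trans ?_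
  simpa using Nat.mul_le_mul_left (m i) (hg i)

theorem IsPolyFun.exists_mvPolynomial {m r : ℕ} {f : (Fin r → K) → K} (hf : IsPolyFun m f) :
    ∃ p : MvPolynomial (Fin r) K, p.totalDegree ≤ m ∧ ∀ x, f x = eval x p := by
  classical
  obtain ⟨N, p, A, c, hp, h⟩ := hf
  let g : Fin N → MvPolynomial (Fin r) K :=
    fun i => ∑ j, C (A (Pi.single j 1) i) * X j + C (c i)
  refine ⟨bind₁ g p, (totalDegree_bind₁_le g (fun i => ?_) p).trans hp, fun x => ?_⟩
  · refine (totalDegree_add _ _).trans (max_le (totalDegree_finsetSum_le fun j _ => ?_) (by simp))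
    exact (isHomogeneous_C_mul_X _ _).totalDegree_le
  · rw [h, ← aeval_eq_eval, ← aeval_eq_eval, aeval_bind₁]
    congr 2
    ext i
    have : A x = ∑ j, x j • A (Pi.single j 1) := by
      rw [LinearMap.pi_apply_eq_sum_univ A x]
      refine Finset.sum_congr rfl fun j _ => ?_
      congr 2
      ext k
      simp [Pi.single_apply, eq_comm]
    simp [g, this, mul_comm]

/-- Schwartz-Zippel with the whole field as sampling set, cleared of denominators. -/
theorem card_zeros_le [Finite K] {r : ℕ} {p : MvPolynomial (Fin r) K} (hp : p ≠ 0) :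
    Nat.card K * Nat.card {x : Fin r → K // eval x p = 0} ≤
      p.totalDegree * Nat.card K ^ r := by
  classical
  have := Fintype.ofFinite K
  have h := schwartz_zippel_totalDegree hp (Finset.univ : Finset K)
  have hK : (0 : ℚ≥0) < Fintype.card K := by exact_mod_cast Fintype.card_pos
  rw [Finset.card_univ, div_le_div_iff₀ (by positivity) hK] at h
  have h2 : Nat.card {x : Fin r → K // eval x p = 0} =
      (Finset.filter (fun x => eval x p = 0)
        (Fintype.piFinset fun _ : Fin r => (Finset.univ : Finset K))).card := by
    rw [Nat.card_eq_fintype_card, Fintype.card_subtype]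
    congr 1
  rw [h2, Nat.card_eq_fintype_card, mul_comm]
  exact_mod_cast h

theorem eq_zero_of_totalDegree_lt [Finite K] {r : ℕ} {p : MvPolynomial (Fin r) K}
    (hp : p.totalDegree < Nat.card K) (h : ∀ x, eval x p = 0) : p = 0 := by
  by_contra hne
  have h1 := card_zeros_le hne
  have h2 : Nat.card {x : Fin r → K // eval x p = 0} = Nat.card K ^ r := by
    rw [Nat.card_congr (Equiv.subtypeUnivEquiv h), Nat.card_fun, Nat.card_fin]
  rw [h2] at h1
  have : 0 < Nat.card K ^ r := pow_pos Nat.card_pos _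
  exact absurd (Nat.le_of_mul_le_mul_right h1 this) (by omega)

theorem exists_apply_eq_one {φ : E →ₗ[K] K} (hφ : φ ≠ 0) : ∃ e, φ e = 1 := by
  obtain ⟨x, hx⟩ : ∃ x, φ x ≠ 0 := by
    by_contra! h
    exact hφ (LinearMap.ext h)
  exact ⟨(φ x)⁻¹ • x, by simp [hx]⟩

theorem exists_eq_smul_of_ker_le {φ ψ : E →ₗ[K] K} (h : ∀ x, φ x = 0 → ψ x = 0) :
    ∃ c : K, ψ = c • φ := by
  by_cases hφ : φ = 0
  · exact ⟨0, LinearMap.ext fun x => by simpa using h x (by simp [hφ])⟩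
  obtain ⟨e, he⟩ := exists_apply_eq_one hφ
  refine ⟨ψ e, LinearMap.ext fun x => ?_⟩
  have := h (x - φ x • e) (by simp [he])
  rw [map_sub, map_smul, sub_eq_zero] at this
  rw [this]
  simp [mul_comm]

variable [FiniteDimensional K E]

theorem IsPolyFun.card_zeros_le [Finite K] {m : ℕ} {f : E → K} (hf : IsPolyFun m f) (h0 : ∃ x, f x ≠ 0) :
    Nat.card K * Nat.card {x // f x = 0} ≤ m * Nat.card E := by
  let e := (Module.finBasis K E).equivFun
  obtain ⟨p, hp, h⟩ := (hf.comp_affine e.symm.toLinearMap 0).exists_mvPolynomial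
  have hp0 : p ≠ 0 := by
    rintro rfl
    obtain ⟨x, hx⟩ := h0
    apply hx
    simpa using h (e x)
  have h1 := FqHypersurface.card_zeros_le hp0
  have h2 : Nat.card {x // f x = 0} = Nat.card {x : Fin _ → K // eval x p = 0} := by
    refine Nat.card_congr (e.toEquiv.subtypeEquiv fun x => ?_)
    rw [← h]
    simp
  have h3 : Nat.card E = Nat.card K ^ Module.finrank K E := Module.natCard_eq_pow_finrank
  rw [h2, h3]
  exact h1.trans (Nat.mul_le_mul_right _ hp)

theorem card_mul_card_ker {φ : E →ₗ[K] K} (hφ : φ ≠ 0) :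
    Nat.card K * Nat.card (LinearMap.ker φ) = Nat.card E := by
  rw [Module.natCard_eq_pow_finrank (K := K) (V := E),
    Module.natCard_eq_pow_finrank (K := K) (V := LinearMap.ker φ),
    ← Module.Dual.finrank_ker_add_one_of_ne_zero hφ, pow_succ, mul_comm]

/-- If a polynomial function of degree `m < q` has the maximal number of zeros, then some
hyperplane through each of its zeros consists of zeros. -/
theorem IsPolyFun.exists_hyperplane [Finite K] {m : ℕ} (hm : m < Nat.card K) {f : E → K}
    (hf : IsPolyFun m f) (hcard : Nat.card K * Nat.card {x // f x = 0} = m * Nat.card E)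
    {x₀ : E} (hx₀ : f x₀ = 0) : ∃ φ : E →ₗ[K] K, φ ≠ 0 ∧ ∀ x, φ x = φ x₀ → f x = 0 := by
  classical
  by_contra! hcon
  have : Finite E := Module.finite_of_finite K
  have : Finite (E →ₗ[K] K) := Module.finite_of_finite K
  have := Fintype.ofFinite K
  have := Fintype.ofFinite E
  have := Fintype.ofFinite (E →ₗ[K] K)
  set q := Nat.card K with hq
  set e := Nat.card E with he
  set Z : Finset E := Finset.univ.filter fun x => f x = 0 with hZ
  have hz : Nat.card {x // f x = 0} = Z.card := by
    rw [Nat.card_eq_fintype_card, Fintype.card_subtype]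
  have hdual : Fintype.card (E →ₗ[K] K) = e := by
    rw [← Nat.card_eq_fintype_card, he, Module.natCard_eq_pow_finrank (K := K) (V := E),
      Module.natCard_eq_pow_finrank (K := K) (V := (E →ₗ[K] K))]
    congr 1
    exact Subspace.dual_finrank_eq
  -- Double counting of the pairs (φ, x) with x a zero and φ x = φ x₀. Each nonzero φ contributes at
  -- most m e / q ^ 2, since by assumption f is not identically zero on that hyperplane; each zero x
  -- ≠ x₀ contributes exactly e / q.
  let S : (E →ₗ[K] K) → ℕ := fun φ => (Z.filter fun x => φ x = φ x₀).card
  have hS : ∀ φ, φ ≠ 0 → q ^ 2 * S φ ≤ m * e := by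
    intro φ hφ
    obtain ⟨x, hx, hfx⟩ := hcon φ hφ
    have h1 := (hf.comp_affine (LinearMap.ker φ).subtype x₀).card_zeros_le
      ⟨⟨x - x₀, by simp [hx]⟩, by simpa using hfx⟩
    have h2 : Nat.card {y : LinearMap.ker φ // f (x₀ + (LinearMap.ker φ).subtype y) = 0} = S φ := by
      rw [Nat.card_eq_fintype_card, Fintype.card_subtype]
      refine Finset.card_bij (fun y _ => x₀ + y.1) ?_ ?_ ?_
      · intro y hy
        have h5 : φ y.1 = 0 := y.2
        have h6 : f (x₀ + y.1) = 0 := by simpa using (Finset.mem_filter.1 hy).2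
        simp [hZ, h5, h6]
      · intro y _ z _ h
        simpa using h
      · intro y hy
        simp [hZ] at hy
        exact ⟨⟨y - x₀, by simp [hy]⟩, Finset.mem_filter.2 ⟨Finset.mem_univ _, by simp [hy]⟩, by simp⟩
    rw [h2] at h1
    have h3 := card_mul_card_ker hφ
    calc q ^ 2 * S φ = q * (q * S φ) := by ring
      _ ≤ q * (m * Nat.card (LinearMap.ker φ)) := Nat.mul_le_mul_left _ h1
      _ = m * e := by rw [he, ← h3, hq]; ring
  have hS0 : S 0 = Z.card := by simp [S]
  have hsum1 : q ^ 2 * ∑ φ, S φ ≤ q ^ 2 * Z.card + (e - 1) * (m * e) := by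
    rw [← Finset.add_sum_erase _ _ (Finset.mem_univ (0 : E →ₗ[K] K)), mul_add, hS0, Finset.mul_sum]
    refine Nat.add_le_add_left ((Finset.sum_le_card_nsmul _ _ (m * e) ?_).trans ?_) _
    · intro φ hφ
      exact hS φ (by simpa using hφ)
    · rw [Finset.card_erase_of_mem (Finset.mem_univ _), Finset.card_univ, hdual, smul_eq_mul]
  have hsum2 : ∑ φ, S φ = ∑ x ∈ Z, (Finset.univ.filter fun φ : E →ₗ[K] K => φ x = φ x₀).card := by
    simp only [S, Finset.card_filter]
    rw [Finset.sum_comm]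
  have hx₀Z : x₀ ∈ Z := by simp [hZ, hx₀]
  have hfib : ∀ x ∈ Z.erase x₀,
      q * (Finset.univ.filter fun φ : E →ₗ[K] K => φ x = φ x₀).card = e := by
    intro x hx
    have hne : x - x₀ ≠ 0 := sub_ne_zero.2 (Finset.ne_of_mem_erase hx)
    have hev : Module.Dual.eval K E (x - x₀) ≠ 0 := by
      intro h
      exact hne (Module.eval_apply_injective K (by simpa using h))
    have h3 := card_mul_card_ker (E := E →ₗ[K] K) hev
    have h4 : Nat.card (LinearMap.ker (Module.Dual.eval K E (x - x₀))) =
        (Finset.univ.filter fun φ : E →ₗ[K] K => φ x = φ x₀).card := by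
      rw [← Fintype.card_subtype, ← Nat.card_eq_fintype_card]
      refine Nat.card_congr (Equiv.subtypeEquivRight fun φ => ?_)
      simp [sub_eq_zero]
    rw [← h4, hq]
    refine h3.trans ?_
    rw [Nat.card_eq_fintype_card]
    exact hdual
  have hsum3 : q * ∑ φ, S φ = q * e + (Z.card - 1) * e := by
    rw [hsum2, ← Finset.add_sum_erase _ _ hx₀Z, mul_add, Finset.mul_sum, Finset.sum_congr rfl hfib]
    simp [hdual, Finset.card_erase_of_mem hx₀Z]
  have hZpos : 1 ≤ Z.card := Finset.card_pos.2 ⟨x₀, hx₀Z⟩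
  have hepos : 1 ≤ e := Nat.card_pos
  have hq1 : 2 ≤ q := Finite.one_lt_card
  rw [hz] at hcard
  have hepos' : (0 : ℤ) < e := by exact_mod_cast hepos
  zify [hZpos, hepos] at hsum1 hsum3 hcard hm hq1
  have h1 : (q : ℤ) * (q * e + (Z.card - 1) * e) ≤ q ^ 2 * Z.card + (e - 1) * (m * e) := by
    rw [← hsum3]; linarith
  have h2 : (q : ℤ) * (q * e + (Z.card - 1) * e) = q ^ 2 * e + m * e * e - q * e := by
    rw [← hcard]; ring
  have h3 : (q : ℤ) ^ 2 * Z.card + (e - 1) * (m * e) = q * m * e + m * e * e - m * e := by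
    have : (q : ℤ) ^ 2 * Z.card = q * (m * e) := by rw [← hcard]; ring
    rw [this]; ring
  rw [h2, h3] at h1
  -- The two counts leave (q - 1) (q - m) e ≤ 0, impossible for m < q.
  nlinarith [mul_pos (mul_pos (sub_pos.2 hm) (show (0 : ℤ) < q - 1 by linarith)) hepos']

theorem exists_eq_X_zero_mul {r m : ℕ} {p : MvPolynomial (Fin (r + 1)) K}
    (hp : p.totalDegree ≤ m + 1) (h0 : (finSuccEquiv K r p).coeff 0 = 0) :
    ∃ G : MvPolynomial (Fin (r + 1)) K, p = X 0 * G ∧ G.totalDegree ≤ m := by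
  obtain ⟨g, hg⟩ := Polynomial.X_dvd_iff.2 h0
  refine ⟨(finSuccEquiv K r).symm g, ?_, ?_⟩
  · apply (finSuccEquiv K r).injective
    rw [map_mul, finSuccEquiv_X_zero, hg, AlgEquiv.apply_symm_apply]
  · set G := (finSuccEquiv K r).symm g with hG
    have hpG : p = X 0 * G := by
      apply (finSuccEquiv K r).injective
      rw [map_mul, finSuccEquiv_X_zero, hg, AlgEquiv.apply_symm_apply]
    by_cases hG0 : G = 0
    · simp [hG0]
    · rw [hpG, totalDegree_mul_of_isDomain (X_ne_zero _) hG0, totalDegree_X] at hp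
      omega

theorem eval_coeff_zero_finSuccEquiv {r : ℕ} (p : MvPolynomial (Fin (r + 1)) K) (x : Fin r → K) :
    eval x ((finSuccEquiv K r p).coeff 0) = eval (Fin.cons 0 x) p := by
  rw [eval_eq_eval_mv_eval', ← Polynomial.coeff_zero_eq_eval_zero, Polynomial.coeff_map]

/-- A polynomial function of degree less than `q` vanishing on a hyperplane is divisible by the
equation of the hyperplane. -/
theorem IsPolyFun.exists_eq_mul [Finite K] {m : ℕ} (hm : m + 1 < Nat.card K) {f : E → K}
    (hf : IsPolyFun (m + 1) f) {φ : E →ₗ[K] K} (hφ : φ ≠ 0) {a : K}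
    (h : ∀ x, φ x = a → f x = 0) :
    ∃ f' : E → K, IsPolyFun m f' ∧ ∀ x, f x = (φ x - a) * f' x := by
  obtain ⟨e, he⟩ := exists_apply_eq_one hφ
  set r := Module.finrank K (LinearMap.ker φ)
  let b : Module.Basis (Fin r) K (LinearMap.ker φ) := Module.finBasis K _
  let P : E →ₗ[K] LinearMap.ker φ :=
    LinearMap.codRestrict _ (LinearMap.id - φ.smulRight e) (fun x => by simp [he])
  have hP : ∀ x, (P x : E) = x - φ x • e := fun x => rfl
  let S : E →ₗ[K] (Fin (r + 1) → K) :=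
    LinearMap.pi (Fin.cons φ fun j => b.coord j ∘ₗ P)
  let T : (Fin (r + 1) → K) →ₗ[K] E :=
    (LinearMap.proj 0).smulRight e +
      ∑ j : Fin r, (LinearMap.proj j.succ).smulRight (b j : E)
  have hT : ∀ y, T y = y 0 • e + ∑ j : Fin r, y j.succ • (b j : E) := fun y => by
    simp [T]
  have hTS : ∀ x, T (S x) = x := by
    intro x
    have h1 : ∑ j : Fin r, b.coord j (P x) • (b j : E) = P x := by
      conv_rhs => rw [← b.sum_repr (P x), Submodule.coe_sum]
      rfl
    rw [hT]
    simp only [S, LinearMap.pi_apply, Fin.cons_zero, Fin.cons_succ, LinearMap.comp_apply, h1, hP]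
    abel
  have hφT : ∀ y, φ (T y) = y 0 := by
    intro y
    simp [hT, he]
  -- In these coordinates, with origin at a • e, the hyperplane φ = a is y 0 = 0. The constant term
  -- of p in the variable 0 vanishes at every point and has degree less than q, so it is zero and `X
  -- 0` divides p.
  obtain ⟨p, hp, hfp⟩ := (hf.comp_affine T (a • e)).exists_mvPolynomial
  have hc0 : (finSuccEquiv K r p).coeff 0 = 0 := by
    refine eq_zero_of_totalDegree_lt ?_ fun x => ?_
    · by_cases h0 : (finSuccEquiv K r p).coeff 0 = 0
      · rw [h0, totalDegree_zero]; exact Nat.card_pos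
      · have := totalDegree_coeff_finSuccEquiv_add_le p 0 h0
        omega
    · rw [eval_coeff_zero_finSuccEquiv, ← hfp]
      apply h
      rw [map_add, hφT]
      simp [he]
  obtain ⟨G, hpG, hG⟩ := exists_eq_X_zero_mul hp hc0
  refine ⟨fun x => eval (S x + -(S (a • e))) G, ⟨_, G, S, _, hG, fun _ => rfl⟩, fun x => ?_⟩
  have h1 : f x = eval (S x + -(S (a • e))) p := by
    rw [← hfp, ← map_neg, ← map_add, hTS]
    congr 1
    abel
  rw [h1, hpG, map_mul, eval_X]
  congr 1
  simp [S, he, sub_eq_add_neg]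

/-- A polynomial function of degree `m < q` with the maximal number of zeros is a product of
equations of parallel hyperplanes. -/
theorem IsPolyFun.eq_prod_of_card_zeros [Finite K] [Nontrivial E] {m : ℕ}
    (hm : m < Nat.card K) {f : E → K}
    (hf : IsPolyFun m f) (h0 : ∃ x, f x ≠ 0)
    (hcard : Nat.card K * Nat.card {x // f x = 0} = m * Nat.card E) :
    ∃ (φ : E →ₗ[K] K) (α : K) (a : Fin m → K), φ ≠ 0 ∧ α ≠ 0 ∧ Function.Injective a ∧
      ∀ x, f x = α * ∏ i, (φ x - a i) := by
  classical
  have : Finite E := Module.finite_of_finite K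
  have hepos : 0 < Nat.card E := Nat.card_pos
  have hq : 0 < Nat.card K := Nat.card_pos
  induction m generalizing f with
  | zero =>
    obtain ⟨N, p, A, c, hp, h⟩ := hf
    obtain ⟨x, hx⟩ := h0
    obtain ⟨φ, hφ⟩ := exists_ne (0 : Module.Dual K E)
    rw [Nat.le_zero, totalDegree_eq_zero_iff_eq_C] at hp
    rw [hp] at h
    refine ⟨φ, coeff 0 p, Fin.elim0, hφ, ?_, fun i => i.elim0, fun x => by rw [h]; simp⟩
    rw [h] at hx
    simpa using hx
  | succ m ih =>
    have hne : Nat.card {x // f x = 0} ≠ 0 := by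
      intro h
      rw [h] at hcard
      have : 0 < (m + 1) * Nat.card E := by positivity
      omega
    obtain ⟨⟨x₀, hx₀⟩⟩ := (Nat.card_ne_zero.1 hne).1
    obtain ⟨φ, hφ, hvan⟩ := hf.exists_hyperplane hm hcard hx₀
    set a := φ x₀
    obtain ⟨f', hf', hff'⟩ := hf.exists_eq_mul hm hφ hvan
    have h0' : ∃ x, f' x ≠ 0 := by
      obtain ⟨x, hx⟩ := h0
      rw [hff'] at hx
      exact ⟨x, right_ne_zero_of_mul hx⟩
    have hle := hf'.card_zeros_le h0'
    have := Fintype.ofFinite E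
    have := Fintype.ofFinite K
    have hH : Nat.card K * Nat.card {x // φ x = a} = Nat.card E := by
      rw [← card_mul_card_ker hφ]
      congr 1
      refine Nat.card_congr ((Equiv.subRight x₀).subtypeEquiv fun x => ?_)
      simp [a, sub_eq_zero]
    -- The hyperplane has e / q points and f' at most m e / q zeros; a common point would leave f
    -- with fewer than (m + 1) e / q zeros.
    have hdisj : ∀ x, φ x = a → f' x ≠ 0 := by
      by_contra! hcon
      obtain ⟨y, hy, hy'⟩ := hcon
      have hlt : Nat.card {x // f x = 0} <
          Nat.card {x // φ x = a} + Nat.card {x // f' x = 0} := by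
        simp only [Nat.card_eq_fintype_card, Fintype.card_subtype]
        have h1 := Finset.card_union_add_card_inter (Finset.univ.filter fun x => φ x = a)
          (Finset.univ.filter fun x => f' x = 0)
        have h2 : 0 < ((Finset.univ.filter fun x => φ x = a) ∩
          (Finset.univ.filter fun x => f' x = 0)).card :=
            Finset.card_pos.2 ⟨y, by simp [hy, hy']⟩
        have h3 : (Finset.univ.filter fun x => f x = 0) ⊆ (Finset.univ.filter fun x => φ x = a) ∪
          (Finset.univ.filter fun x => f' x = 0) := by
          intro x hx
          simp [hff', sub_eq_zero] at hx ⊢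
          exact hx
        have := Finset.card_le_card h3
        omega
      have : Nat.card K * Nat.card {x // f x = 0} <
          Nat.card K * (Nat.card {x // φ x = a} + Nat.card {x // f' x = 0}) :=
        Nat.mul_lt_mul_of_pos_left hlt hq
      rw [mul_add, hH, hcard, add_mul] at this
      omega
    have hcard' : Nat.card K * Nat.card {x // f' x = 0} = m * Nat.card E := by
      refine le_antisymm hle ?_
      have hle2 : Nat.card {x // f x = 0} ≤
          Nat.card {x // φ x = a} + Nat.card {x // f' x = 0} := by
        simp only [Nat.card_eq_fintype_card, Fintype.card_subtype]
        refine le_trans (Finset.card_le_card ?_) (Finset.card_union_le _ _)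
        intro x hx
        simp [hff', sub_eq_zero] at hx ⊢
        exact hx
      have := Nat.mul_le_mul_left (Nat.card K) hle2
      rw [mul_add, hH, hcard, add_mul] at this
      omega
    obtain ⟨φ', α, a', hφ', hα, ha', hprod⟩ := ih (by omega) hf' h0' hcard'
    -- The hyperplanes are parallel: if φ' were not proportional to φ, moving along a direction in
    -- ker φ would reach a zero of f' on the hyperplane φ = a, against `hdisj`. For m = 0 there is
    -- nothing to compare.
    obtain ⟨c, hc0, hc⟩ : ∃ c : K, c ≠ 0 ∧ ∀ i : Fin m, ∀ x, φ' x - a' i = c * (φ x - a' i / c) := by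
      rcases Nat.eq_zero_or_pos m with rfl | hmpos
      · exact ⟨1, one_ne_zero, fun i => i.elim0⟩
      let i₀ : Fin m := ⟨0, hmpos⟩
      obtain ⟨c, hc⟩ : ∃ c : K, φ' = c • φ := by
        refine exists_eq_smul_of_ker_le fun y hy => ?_
        by_contra hy'
        refine hdisj (x₀ + ((a' i₀ - φ' x₀) / φ' y) • y) (by simp [hy, a]) ?_
        rw [hprod]
        refine mul_eq_zero_of_right _ (Finset.prod_eq_zero (Finset.mem_univ i₀) ?_)
        simp [hy']
      have hc0 : c ≠ 0 := by
        rintro rfl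
        exact hφ' (by simpa using hc)
      refine ⟨c, hc0, fun i x => ?_⟩
      rw [hc, mul_sub, mul_div_cancel₀ _ hc0]
      simp
    refine ⟨φ, α * c ^ m, Fin.cons a fun i => a' i / c, hφ, by simp [hα, hc0], ?_, fun x => ?_⟩
    · rw [Fin.cons_injective_iff]
      constructor
      · rintro ⟨i, hi⟩
        refine hdisj x₀ rfl ?_
        rw [hprod]
        refine mul_eq_zero_of_right _ (Finset.prod_eq_zero (Finset.mem_univ i) ?_)
        rw [hc]
        simp only at hi
        rw [hi]
        simp [a]
      · intro i j hij
        apply ha'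
        field_simp at hij
        exact hij
    · rw [hff', hprod, Fin.prod_univ_succ]
      simp only [hc, Finset.prod_mul_distrib, Finset.prod_const, Finset.card_univ, Fintype.card_fin,
        Fin.cons_zero, Fin.cons_succ]
      ring

end FqHypersurface

end

noncomputable section

namespace FqHypersurface

variable {K : Type*} [Field K]

/-! ### Counting points -/

/-- Each rational point has q - 1 representatives, and the origin is the one remaining zero. -/
theorem natCard_zeros_eq [Finite K] {N d : ℕ} {F : MvPolynomial (Fin N) K}
    (hF : F.IsHomogeneous d) (hd : d ≠ 0) :
    Nat.card {x : Fin N → K // eval x F = 0} = numPoints F * (Nat.card K - 1) + 1 := by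
  classical
  have h0 : eval (0 : Fin N → K) F = 0 := eval_zero_of_isHomogeneous hF hd
  let T : Type _ := {x : Fin N → K // x ≠ 0 ∧ eval x F = 0}
  have e1 : {x : Fin N → K // eval x F = 0} ≃ Option T :=
    { toFun := fun x => if h : x.1 = 0 then none else some ⟨x.1, h, x.2⟩
      invFun := fun y => y.elim ⟨0, h0⟩ fun t => ⟨t.1, t.2.2⟩
      left_inv := fun x => by
        by_cases h : x.1 = 0
        · ext; simp [h]
        · simp [h]
      right_inv := fun y => by
        rcases y with _ | t
        · simp
        · have := t.2.1
          simp [this] }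
  let g : rationalPoints F × Kˣ → T := fun p =>
    ⟨(p.2 : K) • p.1.1.rep, smul_ne_zero p.2.ne_zero p.1.1.rep_nonzero, by
      rw [eval_smul_of_isHomogeneous hF, show eval p.1.1.rep F = 0 from p.1.2, mul_zero]⟩
  have hg : Function.Bijective g := by
    constructor
    · rintro ⟨⟨P, hP⟩, a⟩ ⟨⟨Q, hQ⟩, b⟩ h
      have h' : (a : K) • P.rep = (b : K) • Q.rep := congrArg Subtype.val h
      have hPQ : P = Q := by
        rw [← P.mk_rep, ← Q.mk_rep, Projectivization.mk_eq_mk_iff']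
        refine ⟨(a : K)⁻¹ * b, ?_⟩
        rw [mul_smul, ← h', smul_smul]
        simp
      subst hPQ
      have : (a : K) = b := by
        by_contra hne
        have : ((a : K) - b) • P.rep = 0 := by rw [sub_smul, h', sub_self]
        rcases smul_eq_zero.1 this with h | h
        · exact hne (sub_eq_zero.1 h)
        · exact P.rep_nonzero h
      simp [Units.ext this]
    · rintro ⟨x, hx, hx0⟩
      obtain ⟨a, ha⟩ := Projectivization.exists_smul_eq_mk_rep K x hx
      have ha' : (a : K) • x = (Projectivization.mk K x hx).rep := ha
      refine ⟨⟨⟨Projectivization.mk K x hx, ?_⟩, a⁻¹⟩, ?_⟩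
      · change eval (Projectivization.mk K x hx).rep F = 0
        rw [← ha', eval_smul_of_isHomogeneous hF, hx0, mul_zero]
      · apply Subtype.ext
        simp only [g]
        rw [← ha', smul_smul]
        simp
  have : Finite T := Finite.of_injective (fun t => t.1) Subtype.val_injective
  rw [Nat.card_congr e1, Finite.card_option, ← Nat.card_congr (Equiv.ofBijective g hg),
    Nat.card_prod, Nat.card_units]
  rfl

theorem numPointsProj_mul [Finite K] (m : ℕ) :
    numPointsProj K m * (Nat.card K - 1) + 1 = Nat.card K ^ (m + 1) := by
  rw [numPointsProj, ← Projectivization.card', Nat.card_fun, Nat.card_fin]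

theorem two_le_card [Finite K] : 2 ≤ Nat.card K := Finite.one_lt_card

/-- The bound for the number of projective points, in terms of the zeros in affine space. -/
theorem bound_identity [Finite K] {n d k : ℕ} (hkn : k ≤ n) :
    ((d - 1) * Nat.card K ^ k * numPointsProj K (n - k) + numPointsProj K k) * (Nat.card K - 1) + 1
      + (d - 1) * Nat.card K ^ k = (d - 1) * Nat.card K ^ (n + 1) + Nat.card K ^ (k + 1) := by
  have h1 := numPointsProj_mul (K := K) (n - k)
  have h2 := numPointsProj_mul (K := K) k
  have h3 : Nat.card K ^ (n + 1) = Nat.card K ^ k * Nat.card K ^ (n - k + 1) := by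
    rw [← pow_add]; congr 1; omega
  rw [h3, ← h1, ← h2]
  ring

theorem numPoints_le_iff [Finite K] {n d k : ℕ} (hkn : k ≤ n) (hd : d ≠ 0)
    {F : MvPolynomial (Fin (n + 2)) K} (hF : F.IsHomogeneous d) :
    numPoints F ≤ (d - 1) * Nat.card K ^ k * numPointsProj K (n - k) + numPointsProj K k ↔
      Nat.card {x : Fin (n + 2) → K // eval x F = 0} + (d - 1) * Nat.card K ^ k ≤
        (d - 1) * Nat.card K ^ (n + 1) + Nat.card K ^ (k + 1) := by
  rw [← bound_identity hkn, natCard_zeros_eq hF hd]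
  have := two_le_card (K := K)
  rw [Nat.add_le_add_iff_right, Nat.add_le_add_iff_right, Nat.mul_le_mul_right_iff (by omega)]

theorem numPoints_eq_iff [Finite K] {n d k : ℕ} (hkn : k ≤ n) (hd : d ≠ 0)
    {F : MvPolynomial (Fin (n + 2)) K} (hF : F.IsHomogeneous d) :
    numPoints F = (d - 1) * Nat.card K ^ k * numPointsProj K (n - k) + numPointsProj K k ↔
      Nat.card {x : Fin (n + 2) → K // eval x F = 0} + (d - 1) * Nat.card K ^ k =
        (d - 1) * Nat.card K ^ (n + 1) + Nat.card K ^ (k + 1) := by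
  rw [← bound_identity hkn, natCard_zeros_eq hF hd]
  have := two_le_card (K := K)
  rw [Nat.add_right_cancel_iff, Nat.add_right_cancel_iff, Nat.mul_left_inj (by omega)]

/-! ### Linear subspaces of the hypersurface -/

theorem eval_eq_zero_of_containsSubspace {N : ℕ} {F : MvPolynomial (Fin N) K}
    {W : Submodule K (Fin N → K)} (h : ContainsSubspace F W) {x : Fin N → K} (hx : x ∈ W) :
    eval x F = 0 := by
  have := h _ (Submodule.subset_span ⟨x, hx, rfl⟩)
  exact (algebraMap K (AlgebraicClosure K)).injective
    (by rw [map_zero, ← this]; exact (aeval_algebraMap_apply _ _ _).symm)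

theorem exists_coords_of_mem_geometricSpan {N r : ℕ} {W : Submodule K (Fin N → K)}
    (b : Module.Basis (Fin r) K W) {x : Fin N → AlgebraicClosure K} (hx : x ∈ geometricSpan W) :
    ∃ ξ : Fin r → AlgebraicClosure K,
      x = fun i => ∑ j, algebraMap K (AlgebraicClosure K) ((b j : Fin N → K) i) * ξ j := by
  induction hx using Submodule.span_induction with
  | mem x hx =>
    obtain ⟨w, hw, rfl⟩ := hx
    refine ⟨fun j => algebraMap K _ (b.repr ⟨w, hw⟩ j), funext fun i => ?_⟩
    have h1 : w = ∑ j, b.repr ⟨w, hw⟩ j • (b j : Fin N → K) := by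
      have := congrArg Subtype.val (b.sum_repr ⟨w, hw⟩)
      rw [Submodule.coe_sum] at this
      exact this.symm
    have h2 := congrArg (algebraMap K (AlgebraicClosure K)) (congrFun h1 i)
    simp only [Finset.sum_apply, Pi.smul_apply, smul_eq_mul, map_sum, map_mul] at h2
    exact h2.trans (Finset.sum_congr rfl fun _ _ => mul_comm _ _)
  | zero => exact ⟨0, by ext; simp⟩
  | add x y _ _ hx hy =>
    obtain ⟨ξ, rfl⟩ := hx
    obtain ⟨η, rfl⟩ := hy
    exact ⟨ξ + η, by ext; simp [mul_add, Finset.sum_add_distrib]⟩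
  | smul a x _ hx =>
    obtain ⟨ξ, rfl⟩ := hx
    refine ⟨a • ξ, ?_⟩
    ext
    simp only [Pi.smul_apply, smul_eq_mul, Finset.mul_sum]
    exact Finset.sum_congr rfl fun _ _ => by ring

theorem natCast_le_mk {α : Type*} [Finite α] {d : ℕ} (hd : d ≤ Nat.card α) :
    (d : Cardinal) ≤ Cardinal.mk α := by
  rw [← Nat.cast_card]
  exact_mod_cast hd

/-- In a `K`-basis of W, F restricts to a form of degree at most q, which is the zero polynomial as
soon as it vanishes at all rational points. This fails in degree q + 1, which is why space-filling
forms need separate treatment. -/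
theorem containsSubspace_of_forall_eval [Finite K] {N d : ℕ} {F : MvPolynomial (Fin N) K}
    (hF : F.IsHomogeneous d) (hdq : d ≤ Nat.card K) {W : Submodule K (Fin N → K)}
    (h : ∀ x ∈ W, eval x F = 0) : ContainsSubspace F W := by
  intro x hx
  let b := Module.finBasis K W
  obtain ⟨ξ, rfl⟩ := exists_coords_of_mem_geometricSpan b hx
  let g : Fin N → MvPolynomial (Fin (Module.finrank K W)) K :=
    fun i => ∑ j, C ((b j : Fin N → K) i) * X j
  have hg : ∀ i, (g i).IsHomogeneous 1 := fun i =>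
    IsHomogeneous.sum _ _ _ fun j _ => isHomogeneous_C_mul_X _ _
  have hG : (bind₁ g F).IsHomogeneous d := by simpa using hF.aeval g hg
  have hG0 : bind₁ g F = 0 := by
    refine hG.eq_zero_of_forall_eval_eq_zero_of_le_card (fun t => ?_) (natCast_le_mk hdq)
    rw [← aeval_eq_eval, aeval_bind₁, aeval_eq_eval]
    refine h _ ?_
    have : (fun i => aeval t (g i)) = ∑ j, t j • (b j : Fin N → K) := by
      ext i
      simp [g, mul_comm]
    rw [this]
    exact Submodule.sum_mem _ fun j _ => Submodule.smul_mem _ _ (b j).2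
  have h2 := congrArg (aeval ξ) hG0
  rw [aeval_bind₁, map_zero] at h2
  rw [← h2]
  congr 2
  ext i
  simp [g]

/-- A `(k + 1)`-dimensional space of zeros of the form `F`. -/
structure IsZeroSpace {N : ℕ} (F : MvPolynomial (Fin N) K) (k : ℕ)
    (L : Submodule K (Fin N → K)) : Prop where
  finrank_eq : Module.finrank K L = k + 1
  eval_eq_zero : ∀ x ∈ L, eval x F = 0

theorem finrank_sup_span_singleton {E : Type*} [AddCommGroup E] [Module K E]
    [FiniteDimensional K E] {L : Submodule K E} {u : E} (hu : u ∉ L) :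
    Module.finrank K (L ⊔ K ∙ u : Submodule K E) = Module.finrank K L + 1 := by
  have hu0 : u ≠ 0 := fun h => hu (h ▸ L.zero_mem)
  have h1 := Submodule.finrank_sup_add_finrank_inf_eq L (K ∙ u)
  have h2 : L ⊓ (K ∙ u) = ⊥ := by
    rw [← disjoint_iff, Submodule.disjoint_span_singleton' hu0]
    exact hu
  rw [h2, finrank_bot, finrank_span_singleton hu0] at h1
  omega

/-- If F vanished on u + L, then by homogeneity it would vanish on the span of L and u, and k would
not be maximal. -/
theorem exists_eval_add_ne_zero [Finite K] {N d k : ℕ} {F : MvPolynomial (Fin N) K}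
    (hF : F.IsHomogeneous d) (hdq : d ≤ Nat.card K) (hk : k ∈ upperBounds (linearDims F))
    {L : Submodule K (Fin N → K)} (hL : IsZeroSpace F k L) {u : Fin N → K} (hu : u ∉ L) :
    ∃ l : L, eval (u + l.1) F ≠ 0 := by
  by_contra! hcon
  have hmem : k + 1 ∈ linearDims F := by
    refine ⟨L ⊔ K ∙ u, by rw [finrank_sup_span_singleton hu, hL.finrank_eq], ?_⟩
    refine containsSubspace_of_forall_eval hF hdq fun x hx => ?_
    obtain ⟨l, hl, w, hw, rfl⟩ := Submodule.mem_sup.1 hx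
    obtain ⟨t, rfl⟩ := Submodule.mem_span_singleton.1 hw
    by_cases ht : t = 0
    · simpa [ht] using hL.eval_eq_zero l hl
    · have h1 := hcon ⟨t⁻¹ • l, L.smul_mem _ hl⟩
      have h2 : l + t • u = t • (u + t⁻¹ • l) := by
        rw [smul_add, smul_smul, mul_inv_cancel₀ ht, one_smul, add_comm]
      rw [h2, eval_smul_of_isHomogeneous hF]
      rw [h1, mul_zero]
  have := hk hmem
  omega

/-- Introduce a variable `X 0` for the multiple of u. The part free of `X 0` is F on L, which is
zero as a polynomial because d ≤ q; dividing by `X 0` lowers the degree to d - 1 and does not affect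
the values at `X 0 = 1`. -/
theorem isPolyFun_eval_add [Finite K] {N d : ℕ} {F : MvPolynomial (Fin N) K}
    (hF : F.IsHomogeneous d) (hd : 1 ≤ d) (hdq : d ≤ Nat.card K) {L : Submodule K (Fin N → K)}
    (hL : ∀ x ∈ L, eval x F = 0) (u : Fin N → K) :
    IsPolyFun (d - 1) fun l : L => eval (u + l.1) F := by
  obtain ⟨r, ⟨b⟩⟩ : ∃ r, Nonempty (Module.Basis (Fin r) K L) := ⟨_, ⟨Module.finBasis K L⟩⟩
  let g : Fin N → MvPolynomial (Fin (r + 1)) K :=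
    fun i => C (u i) * X 0 + ∑ j : Fin r, C ((b j : Fin N → K) i) * X j.succ
  have hg : ∀ i, (g i).IsHomogeneous 1 := fun i =>
    (isHomogeneous_C_mul_X _ _).add
      (IsHomogeneous.sum _ _ _ fun j _ => isHomogeneous_C_mul_X _ _)
  have hG : (bind₁ g F).IsHomogeneous d := by simpa using hF.aeval g hg
  have hev : ∀ t : Fin (r + 1) → K, eval t (bind₁ g F) =
      eval (t 0 • u + ∑ j : Fin r, t j.succ • (b j : Fin N → K)) F := by
    intro t
    rw [← aeval_eq_eval, aeval_bind₁, aeval_eq_eval]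
    congr 2
    ext i
    simp [g, mul_comm]
  have hc0 : (finSuccEquiv K r (bind₁ g F)).coeff 0 = 0 := by
    refine (hG.finSuccEquiv_coeff_isHomogeneous 0 d (by simp)).eq_zero_of_forall_eval_eq_zero_of_le_card
      (fun t => ?_) (natCast_le_mk hdq)
    rw [eval_coeff_zero_finSuccEquiv, hev]
    refine hL _ ?_
    simp only [Fin.cons_zero, zero_smul, zero_add, Fin.cons_succ]
    exact Submodule.sum_mem _ fun j _ => Submodule.smul_mem _ _ (b j).2
  obtain ⟨G, hPG, hGdeg⟩ := exists_eq_X_zero_mul (m := d - 1)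
    (hG.totalDegree_le.trans (by omega)) hc0
  let S : L →ₗ[K] Fin (r + 1) → K := LinearMap.pi (Fin.cons 0 fun j => b.coord j)
  let e : Fin (r + 1) → K := Fin.cons 1 0
  have h1 : ∀ l, S l + e = Fin.cons 1 fun j => b.repr l j := by
    intro l
    ext i
    refine Fin.cases ?_ (fun j => ?_) i <;> simp [S, e]
  refine ⟨r + 1, G, S, e, hGdeg, fun l => ?_⟩
  rw [h1]
  have h2 := hev (Fin.cons 1 fun j => b.repr l j)
  rw [hPG, map_mul, eval_X, Fin.cons_zero, one_mul, one_smul] at h2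
  simp only [Fin.cons_succ] at h2
  have h3 : ∑ j, b.repr l j • (b j : Fin N → K) = l.1 := by
    have := congrArg Subtype.val (b.sum_repr l)
    rwa [Submodule.coe_sum] at this
  rw [h2, h3]

/-- Counting zeros along the cosets of a maximal linear space of zeros. -/
theorem card_zeros_add_le [Finite K] {N d k : ℕ} {F : MvPolynomial (Fin N) K}
    (hF : F.IsHomogeneous d) (hd : 1 ≤ d) (hdq : d ≤ Nat.card K)
    (hk : k ∈ upperBounds (linearDims F)) {L : Submodule K (Fin N → K)} (hL : IsZeroSpace F k L) :
    Nat.card K * Nat.card {x : Fin N → K // eval x F = 0} + (d - 1) * Nat.card L ≤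
        Nat.card K * Nat.card L + (d - 1) * Nat.card (Fin N → K) ∧
      (Nat.card K * Nat.card {x : Fin N → K // eval x F = 0} + (d - 1) * Nat.card L =
          Nat.card K * Nat.card L + (d - 1) * Nat.card (Fin N → K) →
        ∀ u ∉ L, Nat.card K * Nat.card {l : L // eval (u + l.1) F = 0} = (d - 1) * Nat.card L) := by
  classical
  have := Fintype.ofFinite K
  have hLpos : 0 < Nat.card L := Nat.card_pos
  -- Cosets are indexed by all their representatives u rather than by the quotient, so every zero is
  -- counted once for each element of L.
  let c : (Fin N → K) → ℕ := fun u => Nat.card {l : L // eval (u + l.1) F = 0}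
  have hc_mem : ∀ u ∈ L, c u = Nat.card L := by
    intro u hu
    refine Nat.card_congr (Equiv.subtypeUnivEquiv fun l => ?_)
    exact hL.eval_eq_zero _ (L.add_mem hu l.2)
  have hc_le : ∀ u ∉ L, Nat.card K * c u ≤ (d - 1) * Nat.card L := fun u hu =>
    (isPolyFun_eval_add hF hd hdq hL.eval_eq_zero u).card_zeros_le
      (exists_eval_add_ne_zero hF hdq hk hL hu)
  have hsum : ∑ u, c u = Nat.card L * Nat.card {x : Fin N → K // eval x F = 0} := by
    have h1 : ∀ u, c u = ∑ l : L, if eval (u + l.1) F = 0 then 1 else 0 := by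
      intro u
      simp only [c]
      rw [Nat.card_eq_fintype_card, Fintype.card_subtype, Finset.card_filter]
    simp only [h1]
    rw [Finset.sum_comm]
    have h2 : ∀ l : L, ∑ u : Fin N → K, (if eval (u + l.1) F = 0 then 1 else 0) =
        Nat.card {x : Fin N → K // eval x F = 0} := by
      intro l
      rw [Nat.card_eq_fintype_card, Fintype.card_subtype, Finset.card_filter]
      exact Fintype.sum_equiv (Equiv.addRight (l : Fin N → K)) _ _ fun u => rfl
    simp only [h2, Finset.sum_const, Finset.card_univ, smul_eq_mul, Nat.card_eq_fintype_card]
  set A := Finset.univ.filter fun u : Fin N → K => u ∈ L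
  set A' := Finset.univ.filter fun u : Fin N → K => u ∉ L
  have hA : A.card = Nat.card L := by
    rw [← Fintype.card_subtype, ← Nat.card_eq_fintype_card]
  have hA' : A'.card + Nat.card L = Nat.card (Fin N → K) := by
    have := Finset.card_filter_add_card_filter_not (s := (Finset.univ : Finset (Fin N → K)))
      (fun u => u ∈ L)
    rw [Finset.card_univ, ← Nat.card_eq_fintype_card] at this
    rw [← this, ← hA, add_comm]
  have hsplit : Nat.card K * (Nat.card L * Nat.card {x : Fin N → K // eval x F = 0}) =
      Nat.card K * (Nat.card L * Nat.card L) + ∑ u ∈ A', Nat.card K * c u := by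
    rw [← hsum, ← Finset.sum_filter_add_sum_filter_not Finset.univ (fun u => u ∈ L), mul_add,
      Finset.mul_sum A']
    congr 2
    rw [Finset.sum_congr rfl fun u hu => hc_mem u (Finset.mem_filter.1 hu).2, Finset.sum_const,
      smul_eq_mul, hA]
  have hle : ∑ u ∈ A', Nat.card K * c u ≤ ∑ u ∈ A', (d - 1) * Nat.card L :=
    Finset.sum_le_sum fun u hu => hc_le u (Finset.mem_filter.1 hu).2
  have hconst : ∑ u ∈ A', (d - 1) * Nat.card L + (d - 1) * Nat.card L * Nat.card L =
      (d - 1) * Nat.card L * Nat.card (Fin N → K) := by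
    rw [Finset.sum_const, smul_eq_mul, ← hA']
    ring
  constructor
  · refine Nat.le_of_mul_le_mul_left ?_ hLpos
    nlinarith [hsplit, hle, hconst]
  · intro heq u hu
    have heq' : ∑ u ∈ A', Nat.card K * c u = ∑ u ∈ A', (d - 1) * Nat.card L := by
      have := congrArg (fun t => Nat.card L * t) heq
      nlinarith [hsplit, hconst]
    exact (Finset.sum_eq_sum_iff_of_le
      (fun u hu => hc_le u (Finset.mem_filter.1 hu).2)).1 heq' u (by simp [hu])

end FqHypersurface

end

noncomputable section

namespace FqHypersurface

variable {K : Type*} [Field K]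

/-! ### Local structure of extremal hypersurfaces -/

/-- A form of degree `d ≤ q` attaining the bound given by linear subspaces of dimension `k`. -/
structure IsExtremal {N : ℕ} (F : MvPolynomial (Fin N) K) (d k : ℕ) : Prop where
  isHomogeneous : F.IsHomogeneous d
  two_le : 2 ≤ d
  le_card : d ≤ Nat.card K
  mem_upperBounds : k ∈ upperBounds (linearDims F)
  card_eq : Nat.card K * Nat.card {x : Fin N → K // eval x F = 0} + (d - 1) * Nat.card K ^ (k + 1) =
    Nat.card K * Nat.card K ^ (k + 1) + (d - 1) * Nat.card K ^ N

/-- The coefficient e 0 is what turns the differential into a (d - 1)-st power of a linear form in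
`IsExtremal.exists_factorization`. -/
theorem exists_prod_expansion {m : ℕ} (p : K) (b : Fin m → K) :
    ∃ e : ℕ → K, e 0 = p ^ m ∧ ∀ v w : K,
      ∏ i, (v * p + w * b i) = ∑ j ∈ Finset.range (m + 1), e j * v ^ (m - j) * w ^ j := by
  let Q : MvPolynomial (Fin 2) K := ∏ i, (C p * X 0 + C (b i) * X 1)
  have hQ : Q.IsHomogeneous m := by
    have := IsHomogeneous.prod Finset.univ (fun i : Fin m => (C p * X 0 + C (b i) * X 1 :
      MvPolynomial (Fin 2) K)) (fun _ => 1)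
      (fun i _ => (isHomogeneous_C_mul_X _ _).add (isHomogeneous_C_mul_X _ _))
    simpa using this
  obtain ⟨e, he⟩ := binary_form_eq_sum hQ
  have hval : ∀ v w : K,
      ∏ i, (v * p + w * b i) = ∑ j ∈ Finset.range (m + 1), e j * v ^ (m - j) * w ^ j := by
    intro v w
    have := congrArg (eval ![v, w]) he
    simp only [Q, map_prod, map_add, map_mul, eval_C, eval_X, map_sum, map_pow,
      Matrix.cons_val_zero, Matrix.cons_val_one] at this
    rw [← this]
    exact Finset.prod_congr rfl fun _ _ => by ring
  refine ⟨e, ?_, hval⟩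
  have := hval 1 0
  rw [Finset.sum_eq_single 0 (by simp +contextual) (by simp)] at this
  simpa using this.symm

variable {N d k : ℕ} {F : MvPolynomial (Fin N) K} {L : Submodule K (Fin N → K)}

/-- A form of degree `s` vanishing at `y` and at `s` further points of a line is zero at the
remaining points. -/
theorem eval_eq_zero_of_line {s : ℕ} {P : MvPolynomial (Fin N) K} (hP : P.IsHomogeneous s)
    {x y : Fin N → K} (hy : eval y P = 0) (A : Finset K) (hA : s ≤ A.card)
    (h : ∀ t ∈ A, eval (x + t • y) P = 0) : eval x P = 0 := by
  obtain ⟨c, hc0, hcs, -, hc⟩ := exists_binary_expansion hP x y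
  rcases Nat.eq_zero_or_pos s with rfl | hs
  · rw [← hc0, hcs, hy]
  -- The coefficient of t ^ s is the value at y, hence zero; what is left has degree less than s.
  let Q : Polynomial K := ∑ j ∈ Finset.range s, Polynomial.C (c j) * Polynomial.X ^ j
  have hQ : Q = 0 := by
    refine Polynomial.eq_zero_of_natDegree_lt_card_of_eval_eq_zero' Q A ?_ ?_
    · intro t ht
      have := hc 1 t
      rw [one_smul, h t ht, Finset.sum_range_succ, hcs, hy] at this
      simpa [Q, Polynomial.eval_finsetSum] using this.symm
    · refine lt_of_le_of_lt (b := s - 1) ?_ (by omega)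
      refine Polynomial.natDegree_sum_le_of_forall_le _ _ fun j hj => ?_
      refine (Polynomial.natDegree_C_mul_X_pow_le _ _).trans ?_
      simp at hj; omega
  have := congrArg (fun p => Polynomial.coeff p 0) hQ
  simp only [Q, Polynomial.finsetSum_coeff, Polynomial.coeff_C_mul, Polynomial.coeff_X_pow,
    Polynomial.coeff_zero] at this
  rw [Finset.sum_eq_single 0 (by simp +contextual [eq_comm]) (by simp; omega)] at this
  rw [← hc0]
  simpa using this

theorem IsZeroSpace.nontrivial (hL : IsZeroSpace F k L) : Nontrivial L :=
  Module.nontrivial_of_finrank_pos (R := K) (by rw [hL.finrank_eq]; omega)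

variable [Finite K]

namespace IsExtremal

/-- The hypersurface meets the span of a maximal zero space and one further point in `d`
hyperplanes containing a common subspace of codimension two. -/
theorem exists_factorization (h : IsExtremal F d k) (hL : IsZeroSpace F k L) {u : Fin N → K}
    (hu : u ∉ L) :
    ∃ (φ : L →ₗ[K] K) (α : K) (a : Fin (d - 1) → K), φ ≠ 0 ∧ α ≠ 0 ∧ Function.Injective a ∧
      (∀ (l : L) (t : K), eval (t • u + l.1) F = α * t * ∏ i, (φ l - a i * t)) ∧
      ∀ x : L, differential F x.1 u = α * φ x ^ (d - 1) := by
  have hd := h.two_le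
  have := hL.nontrivial
  have hcardL : Nat.card L = Nat.card K ^ (k + 1) := by
    rw [Module.natCard_eq_pow_finrank (K := K), hL.finrank_eq]
  have hV : Nat.card (Fin N → K) = Nat.card K ^ N := by rw [Nat.card_fun, Nat.card_fin]
  -- Equality in the global bound forces equality on each single coset outside L.
  have hc := (card_zeros_add_le h.isHomogeneous (by omega) h.le_card h.mem_upperBounds hL).2
    (by rw [hcardL, hV]; exact h.card_eq) u hu
  obtain ⟨φ, α, a, hφ, hα, ha, hprod⟩ :=
    (isPolyFun_eval_add h.isHomogeneous (by omega) h.le_card hL.eval_eq_zero u).eq_prod_of_card_zeros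
      (by have := h.le_card; omega)
      (exists_eval_add_ne_zero h.isHomogeneous h.le_card h.mem_upperBounds hL hu) hc
  have hform : ∀ (l : L) (t : K), eval (t • u + l.1) F = α * t * ∏ i, (φ l - a i * t) := by
    intro l t
    by_cases ht : t = 0
    · simp [ht, hL.eval_eq_zero l.1 l.2]
    · have h1 : t • u + l.1 = t • (u + (t⁻¹ • l : L).1) := by
        simp [smul_smul, ht]
      have h2 : ∀ i, φ l - a i * t = t * (φ (t⁻¹ • l) - a i) := by
        intro i
        rw [map_smul, smul_eq_mul]
        field_simp
      rw [h1, eval_smul_of_isHomogeneous h.isHomogeneous, hprod]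
      simp only [h2, Finset.prod_mul_distrib, Finset.prod_const, Finset.card_univ,
        Fintype.card_fin]
      rw [show t ^ d = t ^ (d - 1) * t by rw [← pow_succ]; congr 1; omega]
      ring
  refine ⟨φ, α, a, hφ, hα, ha, hform, fun x => ?_⟩
  obtain ⟨e, he0, he⟩ := exists_prod_expansion (φ x) (fun i => -a i)
  -- The expansion of F(v x + w u) is w α times that of the product: its coefficients are shifted by
  -- one, with 0 in front because F vanishes on L. The coefficient of index 1 is therefore α e 0.
  have := differential_eq_of_expansion h.isHomogeneous h.two_le h.le_card
    (x := x.1) (y := u) (e := fun j => Nat.casesOn j 0 fun j => α * e j) (by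
      intro v w
      have h3 := hform (v • x) w
      rw [add_comm] at h3
      have h4 : ∏ i, (φ (v • x) - a i * w) = ∏ i, (v * φ x + w * -a i) :=
        Finset.prod_congr rfl fun i _ => by rw [map_smul, smul_eq_mul]; ring
      rw [h4, he] at h3
      rw [Finset.sum_range_succ']
      refine h3.trans ?_
      change _ = _ + 0 * v ^ (d - 0) * w ^ 0
      rw [zero_mul, zero_mul, add_zero, Finset.mul_sum, show d - 1 + 1 = d by omega]
      refine Finset.sum_congr rfl fun j _ => ?_
      rw [show d - 1 - j = d - (j + 1) by omega]
      ring)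
  rw [this]
  simp [he0]

theorem differential_eq_zero (h : IsExtremal F d k) (hL : IsZeroSpace F k L) {x y : Fin N → K}
    (hx : x ∈ L) (hy : y ∈ L) : differential F x y = 0 :=
  differential_eq_of_expansion h.isHomogeneous h.two_le h.le_card (e := fun _ => 0) fun v w => by
    rw [hL.eval_eq_zero _ (L.add_mem (L.smul_mem v hx) (L.smul_mem w hy))]
    simp

/-- On its tangent hyperplane at `x`, the hypersurface is a cone with vertex `x`. -/
theorem eval_add_smul (h : IsExtremal F d k) (hL : IsZeroSpace F k L) {x y : Fin N → K}
    (hx : x ∈ L) (hxy : differential F x y = 0) (t : K) : eval (y + t • x) F = eval y F := by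
  have hd := h.two_le
  by_cases hy : y ∈ L
  · rw [hL.eval_eq_zero _ hy, hL.eval_eq_zero _ (L.add_mem hy (L.smul_mem t hx))]
  obtain ⟨φ, α, a, hφ, hα, ha, hform, hdiff⟩ := h.exists_factorization hL hy
  have hφx : φ ⟨x, hx⟩ = 0 := by
    have := hdiff ⟨x, hx⟩
    rw [hxy, eq_comm, mul_eq_zero, or_iff_right hα] at this
    exact eq_zero_of_pow_eq_zero this
  have h1 := hform (t • ⟨x, hx⟩) 1
  have h2 := hform 0 1
  rw [map_smul, hφx, smul_zero] at h1
  rw [map_zero] at h2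
  rw [← h1, one_smul, Submodule.coe_zero, add_zero] at h2
  exact h2.symm

/-- A zero outside of a maximal zero space lies on a neighbouring one. -/
theorem exists_adjacent (h : IsExtremal F d k) (hL : IsZeroSpace F k L) {y : Fin N → K}
    (hy : y ∉ L) (hy0 : eval y F = 0) :
    ∃ L', IsZeroSpace F k L' ∧ y ∈ L' ∧ ∀ x ∈ L, differential F x y = 0 → x ∈ L' := by
  have hd := h.two_le
  obtain ⟨φ, α, a, hφ, hα, ha, hform, hdiff⟩ := h.exists_factorization hL hy
  -- F(y) = 0 means that y itself lies on one of the hyperplanes of the coset y + L, that is, some a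
  -- i is 0.
  obtain ⟨i, hi⟩ : ∃ i, a i = 0 := by
    have := hform 0 1
    rw [one_smul, Submodule.coe_zero, add_zero, hy0, map_zero, eq_comm, mul_one, mul_eq_zero,
      or_iff_right hα, Finset.prod_eq_zero_iff] at this
    obtain ⟨i, -, hi⟩ := this
    exact ⟨i, by simpa using hi⟩
  -- The factor φ(l) - a i t is φ(l), so F vanishes on the span of ker φ and y; ker φ consists of
  -- the x in L with B(x, y) = 0.
  let D : Submodule K (Fin N → K) := (LinearMap.ker φ).map L.subtype
  have hDL : D ≤ L := Submodule.map_subtype_le _ _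
  refine ⟨D ⊔ K ∙ y, ⟨?_, ?_⟩, Submodule.mem_sup_right (Submodule.mem_span_singleton_self y), ?_⟩
  · rw [finrank_sup_span_singleton fun hyD => hy (hDL hyD), Submodule.finrank_map_subtype_eq]
    have := Module.Dual.finrank_ker_add_one_of_ne_zero hφ
    rw [hL.finrank_eq] at this
    exact this
  · intro x hx
    obtain ⟨c, hc, w, hw, rfl⟩ := Submodule.mem_sup.1 hx
    obtain ⟨t, rfl⟩ := Submodule.mem_span_singleton.1 hw
    obtain ⟨l, hl, rfl⟩ := hc
    have := hform l t
    rw [add_comm] at this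
    refine this.trans (mul_eq_zero_of_right _ (Finset.prod_eq_zero (Finset.mem_univ i) ?_))
    rw [hi, LinearMap.mem_ker.1 hl]
    simp
  · intro x hx hxy
    refine Submodule.mem_sup_left ⟨⟨x, hx⟩, ?_, rfl⟩
    have := hdiff ⟨x, hx⟩
    rw [hxy, eq_comm, mul_eq_zero, or_iff_right hα] at this
    exact eq_zero_of_pow_eq_zero this

theorem exists_mem_isZeroSpace (h : IsExtremal F d k) (hL : IsZeroSpace F k L) {y : Fin N → K}
    (hy0 : eval y F = 0) : ∃ L', IsZeroSpace F k L' ∧ y ∈ L' := by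
  by_cases hy : y ∈ L
  · exact ⟨L, hL, hy⟩
  · obtain ⟨L', h1, h2, -⟩ := h.exists_adjacent hL hy hy0
    exact ⟨L', h1, h2⟩

/-- If B(x, y) = 0, the cone property `eval_add_smul` at x makes F vanish on the whole plane spanned
by the zeros x and y, so the other mixed coefficient vanishes too. -/
theorem differential_symm (h : IsExtremal F d k) (hL : IsZeroSpace F k L) {x y : Fin N → K}
    (hx : eval x F = 0) (hy : eval y F = 0) (hxy : differential F x y = 0) :
    differential F y x = 0 := by
  obtain ⟨L', hL', hxL'⟩ := h.exists_mem_isZeroSpace hL hx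
  refine differential_eq_of_expansion h.isHomogeneous h.two_le h.le_card (e := fun _ => 0)
    fun v w => ?_
  have hd := h.two_le
  simp only [zero_mul, Finset.sum_const_zero]
  by_cases hv : v = 0
  · rw [hv, zero_smul, zero_add, eval_smul_of_isHomogeneous h.isHomogeneous, hx, mul_zero]
  · have : v • y + w • x = v • (y + (v⁻¹ * w) • x) := by
      rw [smul_add, smul_smul, mul_inv_cancel_left₀ hv]
    rw [this, eval_smul_of_isHomogeneous h.isHomogeneous, h.eval_add_smul hL' hxL' hxy, hy,
      mul_zero]

/-- On L the function B(·, z) is α times a power of a linear form φ, or zero if z is in L; φ does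
not see y. -/
theorem differential_comb (h : IsExtremal F d k) (hL : IsZeroSpace F k L) {x y z : Fin N → K}
    (hx : x ∈ L) (hy : y ∈ L) (hyz : differential F y z = 0) (u v : K) :
    differential F (u • x + v • y) z = u ^ (d - 1) * differential F x z := by
  have hd := h.two_le
  by_cases hz : z ∈ L
  · rw [h.differential_eq_zero hL hx hz, mul_zero]
    exact h.differential_eq_zero hL (L.add_mem (L.smul_mem u hx) (L.smul_mem v hy)) hz
  obtain ⟨φ, α, a, hφ, hα, ha, hform, hdiff⟩ := h.exists_factorization hL hz
  have hφy : φ ⟨y, hy⟩ = 0 := by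
    have := hdiff ⟨y, hy⟩
    rw [hyz, eq_comm, mul_eq_zero, or_iff_right hα] at this
    exact eq_zero_of_pow_eq_zero this
  have h1 := hdiff (u • ⟨x, hx⟩ + v • ⟨y, hy⟩)
  have h2 := hdiff ⟨x, hx⟩
  rw [map_add, map_smul, map_smul, hφy] at h1
  refine h1.trans ?_
  rw [h2]
  simp only [smul_eq_mul, mul_zero, add_zero, mul_pow]
  ring

/-- A maximal zero space of codimension at least two contains two points with different tangent
hyperplanes. -/
theorem exists_pair (h : IsExtremal F d k) (hL : IsZeroSpace F k L) (hkN : k + 2 < N) :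
    ∃ x ∈ L, ∃ y ∈ L, ∃ z₁ z₂, differential F x z₁ ≠ 0 ∧ differential F y z₁ = 0 ∧
      differential F x z₂ = 0 ∧ differential F y z₂ ≠ 0 := by
  have hd := h.two_le
  have hne : ∀ u ∉ L, ∃ x ∈ L, differential F x u ≠ 0 := by
    intro u hu
    obtain ⟨φ, α, a, hφ, hα, ha, hform, hdiff⟩ := h.exists_factorization hL hu
    obtain ⟨x, hx⟩ := exists_apply_eq_one hφ
    exact ⟨x.1, x.2, by rw [hdiff, hx]; simpa using hα⟩
  have hNV : Module.finrank K (Fin N → K) = N := by simp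
  obtain ⟨u, hu⟩ : ∃ u, u ∉ L := by
    by_contra! hcon
    have : L = ⊤ := Submodule.eq_top_iff'.2 hcon
    have h1 := hL.finrank_eq
    rw [this, finrank_top, hNV] at h1
    omega
  obtain ⟨x, hx, hxu⟩ := hne u hu
  have hBx : differential F x ≠ 0 := fun h0 => hxu (by rw [h0]; rfl)
  -- The tangent hyperplane at x has dimension N - 1 > k + 1 and does not fit into L. A point u' in
  -- it and off L provides y, and u is then corrected along u' to be tangent at y.
  obtain ⟨u', hu', hu'L⟩ : ∃ u', differential F x u' = 0 ∧ u' ∉ L := by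
    by_contra! hcon
    have h1 : LinearMap.ker (differential F x) ≤ L := fun w hw => hcon w hw
    have h2 := Submodule.finrank_mono h1
    have h3 := Module.Dual.finrank_ker_add_one_of_ne_zero hBx
    rw [hL.finrank_eq] at h2
    rw [hNV] at h3
    omega
  obtain ⟨y, hy, hyu'⟩ := hne u' hu'L
  refine ⟨x, hx, y, hy, u - (differential F y u / differential F y u') • u', u', ?_, ?_, hu', hyu'⟩
  · rw [map_sub, map_smul, hu', smul_zero, sub_zero]
    exact hxu
  · rw [map_sub, map_smul, smul_eq_mul, div_mul_cancel₀ _ hyu', sub_self]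

/-- On the span of x and y, B(·, z₁ + z₂) splits by `differential_comb` into separate (d - 1)-st
powers of the two coordinates, while by the factorization it is the (d - 1)-st power of a single
linear form. Both φ(x) and φ(y) are nonzero, so the coordinates can be rescaled to arbitrary a and
b. -/
theorem add_pow (h : IsExtremal F d k) (hL : IsZeroSpace F k L) (hkN : k + 2 < N) (a b : K) :
    (a + b) ^ (d - 1) = a ^ (d - 1) + b ^ (d - 1) := by
  have hd := h.two_le
  obtain ⟨x, hx, y, hy, z₁, z₂, h1, h2, h3, h4⟩ := h.exists_pair hL hkN
  have hz : z₁ + z₂ ∉ L := by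
    intro hz
    have := h.differential_eq_zero hL hx hz
    rw [map_add, h3, add_zero] at this
    exact h1 this
  obtain ⟨φ, α, c, hφ, hα, -, -, hdiff⟩ := h.exists_factorization hL hz
  have e1 := hdiff ⟨x, hx⟩
  have e2 := hdiff ⟨y, hy⟩
  simp only [map_add, h2, h3, add_zero, zero_add] at e1 e2
  have hA : φ ⟨x, hx⟩ ≠ 0 := by
    intro h0
    rw [h0, zero_pow (by omega), mul_zero] at e1
    exact h1 e1
  have hB : φ ⟨y, hy⟩ ≠ 0 := by
    intro h0
    rw [h0, zero_pow (by omega), mul_zero] at e2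
    exact h4 e2
  set A := φ ⟨x, hx⟩
  set B := φ ⟨y, hy⟩
  have e3 := hdiff ((a / A) • ⟨x, hx⟩ + (b / B) • ⟨y, hy⟩)
  have e4 := h.differential_comb hL hx hy h2 (a / A) (b / B)
  have e5 := h.differential_comb hL hy hx h3 (b / B) (a / A)
  rw [add_comm] at e5
  simp only [map_add, map_smul, smul_eq_mul, Submodule.coe_add, Submodule.coe_smul, e4, e5] at e3
  rw [e1, e2] at e3
  change _ = α * (a / A * A + b / B * B) ^ (d - 1) at e3
  rw [div_mul_cancel₀ _ hA, div_mul_cancel₀ _ hB, div_pow, div_pow] at e3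
  have hA' := pow_ne_zero (d - 1) hA
  have hB' := pow_ne_zero (d - 1) hB
  field_simp at e3
  exact e3.symm

/-- A suitable combination of the pair x, y is killed by ψ, and its differential stays nonzero at
z₁. -/
theorem exists_nonsingular_mem_ker (h : IsExtremal F d k) (hL : IsZeroSpace F k L)
    (hkN : k + 2 < N) (ψ : (Fin N → K) →ₗ[K] K) :
    ∃ x ∈ L, ψ x = 0 ∧ differential F x ≠ 0 := by
  obtain ⟨x, hx, y, hy, z₁, z₂, h1, h2, h3, h4⟩ := h.exists_pair hL hkN
  by_cases hψ : ψ y = 0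
  · exact ⟨y, hy, hψ, fun h0 => h4 (by rw [h0]; rfl)⟩
  · refine ⟨ψ y • x + (-ψ x) • y, L.add_mem (L.smul_mem _ hx) (L.smul_mem _ hy), ?_, fun h0 => ?_⟩
    · simp [mul_comm]
    · have := h.differential_comb hL hx hy h2 (ψ y) (-ψ x)
      rw [h0, LinearMap.zero_apply, eq_comm, mul_eq_zero] at this
      rcases this with h5 | h5
      · exact hψ (eq_zero_of_pow_eq_zero h5)
      · exact h1 h5

/-- For z off L, B(x, z) = α φ(x) ^ (d - 1) on L, and φ is a multiple of B(z, ·) because B(z, x) = 0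
implies B(x, z) = 0 for zeros. The statement is cross-multiplied so as to hold without nonvanishing
assumptions. -/
theorem ratio_on_isZeroSpace (h : IsExtremal F d k) (hL : IsZeroSpace F k L) {z x₁ x : Fin N → K}
    (hz : eval z F = 0) (hx₁ : x₁ ∈ L) (hx : x ∈ L) :
    differential F x z * differential F z x₁ ^ (d - 1) =
      differential F x₁ z * differential F z x ^ (d - 1) := by
  by_cases hzL : z ∈ L
  · rw [h.differential_eq_zero hL hx hzL, h.differential_eq_zero hL hx₁ hzL, zero_mul, zero_mul]
  obtain ⟨φ, α, a, hφ, hα, -, -, hdiff⟩ := h.exists_factorization hL hzL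
  obtain ⟨c, hc⟩ : ∃ c : K, φ = c • (differential F z ∘ₗ L.subtype) := by
    refine exists_eq_smul_of_ker_le fun x hx => ?_
    have h1 := h.differential_symm hL hz (hL.eval_eq_zero _ x.2) hx
    change differential F x.1 z = 0 at h1
    rw [hdiff, mul_eq_zero, or_iff_right hα] at h1
    exact eq_zero_of_pow_eq_zero h1
  have h1 := hdiff ⟨x, hx⟩
  have h2 := hdiff ⟨x₁, hx₁⟩
  simp only [hc, LinearMap.smul_apply, LinearMap.comp_apply, Submodule.subtype_apply,
    smul_eq_mul, mul_pow] at h1 h2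
  rw [h1, h2]
  ring

end IsExtremal

/-! ### Reciprocity between B(x, z) and B(z, x), and additivity of B -/

namespace IsExtremal

/-- For a zero `z`, the form `x ↦ B(x, z)` is proportional to a power of the linear form `B(z, x)`,
where `B` is the differential. -/
theorem ratio (h : IsExtremal F d k) (hL₀ : IsZeroSpace F k L) (hkN : k + 2 < N)
    {z x₀ : Fin N → K} (hz : eval z F = 0) (hx₀ : eval x₀ F = 0)
    (hzx : differential F z x₀ ≠ 0) (x : Fin N → K) :
    differential F x z * differential F z x₀ ^ (d - 1) =
      differential F x₀ z * differential F z x ^ (d - 1) := by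
  classical
  have := Fintype.ofFinite K
  have hd := h.two_le
  obtain ⟨L, hL, hx₀L⟩ := h.exists_mem_isZeroSpace hL₀ hx₀
  -- The claim is the vanishing of this form of degree d - 1. It holds on L, and is spread to the
  -- whole space along lines.
  let P : MvPolynomial (Fin N) K :=
    C (differential F z x₀ ^ (d - 1)) * ∑ i, C (z i) * pderiv i F -
      C (differential F x₀ z) * (∑ i, C (eval z (pderiv i F)) * X i) ^ (d - 1)
  have hP : P.IsHomogeneous (d - 1) := by
    refine IsHomogeneous.sub (IsHomogeneous.C_mul (IsHomogeneous.sum _ _ _ fun i _ =>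
      h.isHomogeneous.pderiv.C_mul _) _) (IsHomogeneous.C_mul ?_ _)
    have := (IsHomogeneous.sum Finset.univ (fun i => C (eval z (pderiv i F)) * X i :
      Fin N → MvPolynomial (Fin N) K) 1 fun i _ => isHomogeneous_C_mul_X _ _).pow (d - 1)
    simpa using this
  have hPev : ∀ w, eval w P = differential F w z * differential F z x₀ ^ (d - 1) -
      differential F x₀ z * differential F z w ^ (d - 1) := by
    intro w
    simp only [P, map_sub, map_mul, eval_C, map_sum, map_pow, eval_X, differential_apply]
    rw [mul_comm]
    congr 2
    exact Finset.sum_congr rfl fun _ _ => mul_comm _ _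
  suffices hall : ∀ w, eval w P = 0 by
    have := hall x
    rw [hPev, sub_eq_zero] at this
    exact this
  have hPL : ∀ w ∈ L, eval w P = 0 := fun w hw => by
    rw [hPev, sub_eq_zero]
    exact h.ratio_on_isZeroSpace hL hz hx₀L hw
  -- The line through y and x₂ meets F = 0 in d - 1 points w off L. Each lies on a neighbouring zero
  -- space that still contains x₁, so the relation passes from L through x₁ to w. With x₂ itself, P
  -- has enough zeros on the line to vanish at y.
  have hgood : ∀ y ∉ L, ∀ x₁ ∈ L, differential F x₁ y = 0 → differential F z x₁ ≠ 0 →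
      eval y P = 0 := by
    intro y hy x₁ hx₁ hx₁y hzx₁
    obtain ⟨φ, α, a, hφ, hα, ha, hform, hdiff⟩ := h.exists_factorization hL hy
    obtain ⟨x₂, hx₂⟩ := exists_apply_eq_one hφ
    refine eval_eq_zero_of_line hP (hPL x₂.1 x₂.2) (Finset.univ.image a)
      (by rw [Finset.card_image_of_injective _ ha]; simp) fun t ht => ?_
    obtain ⟨i, -, rfl⟩ := Finset.mem_image.1 ht
    set w := y + a i • x₂.1 with hw
    have hw0 : eval w F = 0 := by
      have := hform (a i • x₂) 1
      rw [one_smul] at this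
      refine this.trans (mul_eq_zero_of_right _ (Finset.prod_eq_zero (Finset.mem_univ i) ?_))
      simp [hx₂]
    have hwL : w ∉ L := fun hwL => hy (by
      have := L.sub_mem hwL (L.smul_mem (a i) x₂.2)
      rwa [hw, add_sub_cancel_right] at this)
    obtain ⟨L', hL', hwL', hsub⟩ := h.exists_adjacent hL hwL hw0
    have hx₁L' : x₁ ∈ L' := hsub x₁ hx₁ (by
      rw [hw, map_add, map_smul, hx₁y, h.differential_eq_zero hL hx₁ x₂.2, smul_zero, add_zero])
    have e1 := h.ratio_on_isZeroSpace hL' hz hx₁L' hwL'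
    have e2 := h.ratio_on_isZeroSpace hL hz hx₀L hx₁
    rw [hPev]
    apply mul_left_cancel₀ (pow_ne_zero (d - 1) hzx₁)
    linear_combination differential F z x₀ ^ (d - 1) * e1 + differential F z w ^ (d - 1) * e2
  -- If `hgood` does not apply to y, then φ is proportional to B(z, ·) on L, so φ(x₃) = 0 and y is
  -- tangent at x₃. Hence P vanishes off the tangent hyperplane of x₃.
  obtain ⟨x₃, hx₃, hzx₃, hBx₃⟩ := h.exists_nonsingular_mem_ker hL hkN (differential F z)
  have hoff : ∀ y, differential F x₃ y ≠ 0 → eval y P = 0 := by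
    intro y hy3
    by_cases hy : y ∈ L
    · exact hPL y hy
    obtain ⟨φ, α, a, hφ, hα, ha, hform, hdiff⟩ := h.exists_factorization hL hy
    by_contra hPy
    obtain ⟨c, hc⟩ : ∃ c : K, differential F z ∘ₗ L.subtype = c • φ := by
      refine exists_eq_smul_of_ker_le fun x₁ hx₁ => ?_
      by_contra hzx₁
      refine hPy (hgood y hy x₁.1 x₁.2 ?_ hzx₁)
      rw [hdiff, hx₁, zero_pow (by omega), mul_zero]
    have hc0 : c ≠ 0 := by
      rintro rfl
      exact hzx (by simpa using LinearMap.congr_fun hc ⟨x₀, hx₀L⟩)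
    have h1 : φ ⟨x₃, hx₃⟩ = 0 := by
      have := LinearMap.congr_fun hc ⟨x₃, hx₃⟩
      simp only [LinearMap.comp_apply, Submodule.subtype_apply, hzx₃, LinearMap.smul_apply,
        smul_eq_mul] at this
      exact (mul_eq_zero.1 this.symm).resolve_left hc0
    have h2 := hdiff ⟨x₃, hx₃⟩
    rw [h1, zero_pow (by omega), mul_zero] at h2
    exact hy3 h2
  obtain ⟨w₀, hw₀⟩ := exists_apply_eq_one hBx₃
  intro y
  -- For y on that hyperplane, the points y + t w₀ with t ≠ 0 lie off it; there are q - 1 ≥ d - 1 of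
  -- them.
  by_cases hy : differential F x₃ y = 0
  · refine eval_eq_zero_of_line hP (hoff w₀ (by simp [hw₀])) (Finset.univ.erase 0) ?_ fun t ht => ?_
    · rw [Finset.card_erase_of_mem (Finset.mem_univ _), Finset.card_univ,
        ← Nat.card_eq_fintype_card]
      have := h.le_card
      omega
    · refine hoff _ ?_
      rw [map_add, map_smul, hy, hw₀]
      simpa using ht
  · exact hoff y hy

/-- For y off L the coset y + L contains a zero of F, which differs from y by an element of L.
Identities linear in one argument may thus be checked on zeros only. -/
theorem mem_span_zeros (h : IsExtremal F d k) (hL : IsZeroSpace F k L) (y : Fin N → K) :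
    y ∈ Submodule.span K {x | eval x F = 0} := by
  have hd := h.two_le
  have hsub : L ≤ Submodule.span K {x | eval x F = 0} := fun x hx =>
    Submodule.subset_span (hL.eval_eq_zero x hx)
  by_cases hy : y ∈ L
  · exact hsub hy
  obtain ⟨φ, α, a, hφ, hα, ha, hform, hdiff⟩ := h.exists_factorization hL hy
  obtain ⟨x₂, hx₂⟩ := exists_apply_eq_one hφ
  let i : Fin (d - 1) := ⟨0, by omega⟩
  have h0 : eval (y + a i • x₂.1) F = 0 := by
    have := hform (a i • x₂) 1
    rw [one_smul] at this
    refine this.trans (mul_eq_zero_of_right _ (Finset.prod_eq_zero (Finset.mem_univ i) ?_))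
    simp [hx₂]
  have h1 : y + a i • x₂.1 ∈ Submodule.span K {x | eval x F = 0} := Submodule.subset_span h0
  have := Submodule.sub_mem _ h1 (Submodule.smul_mem _ (a i) (hsub x₂.2))
  rwa [add_sub_cancel_right] at this

/-- Since the zeros span, a nonsingular zero z has a zero x₀ with B(z, x₀) ≠ 0, which serves as
reference point in `ratio`; the constant is nonzero by `differential_symm`. If z is singular, F is a
cone with vertex z and B(x, z) = 0. -/
theorem exists_differential_eq_mul_pow (h : IsExtremal F d k) (hL : IsZeroSpace F k L)
    (hkN : k + 2 < N) {z : Fin N → K} (hz : eval z F = 0) :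
    ∃ c : K, (differential F z ≠ 0 → c ≠ 0) ∧
      ∀ x, differential F x z = c * differential F z x ^ (d - 1) := by
  have hd := h.two_le
  by_cases hBz : differential F z = 0
  · refine ⟨0, fun h => absurd hBz h, fun x => ?_⟩
    obtain ⟨L', hL', hzL'⟩ := h.exists_mem_isZeroSpace hL hz
    rw [zero_mul]
    refine (differential_eq_of_expansion h.isHomogeneous h.two_le h.le_card
      (e := fun j => if j = 0 then eval x F else 0) fun v w => ?_).trans (by simp)
    rw [h.eval_add_smul hL' hzL' (by rw [hBz]; rfl),
      eval_smul_of_isHomogeneous h.isHomogeneous, Finset.sum_eq_single 0 (by simp +contextual)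
        (by simp)]
    simp [mul_comm]
  · obtain ⟨x₀, hx₀, hzx⟩ : ∃ x₀, eval x₀ F = 0 ∧ differential F z x₀ ≠ 0 := by
      by_contra! hcon
      apply hBz
      refine LinearMap.ext fun y => ?_
      refine Submodule.span_induction (p := fun y _ => differential F z y = 0) hcon (map_zero _)
        (fun a b _ _ ha hb => by rw [map_add, ha, hb, add_zero])
        (fun t a _ ha => by rw [map_smul, ha, smul_zero]) (h.mem_span_zeros hL y)
    refine ⟨differential F x₀ z / differential F z x₀ ^ (d - 1), fun _ => ?_, fun x => ?_⟩
    · refine div_ne_zero (fun h0 => hzx (h.differential_symm hL hx₀ hz h0)) (pow_ne_zero _ hzx)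
    · have := h.ratio hL hkN hz hx₀ hzx x
      field_simp
      exact this

/-- For a zero y, B(·, y) is a constant times a (d - 1)-st power of a linear form, and that power is
additive; zeros span the space. -/
theorem differential_add (h : IsExtremal F d k) (hL : IsZeroSpace F k L) (hkN : k + 2 < N)
    (x x' y : Fin N → K) :
    differential F (x + x') y = differential F x y + differential F x' y := by
  refine Submodule.span_induction
    (p := fun y _ => differential F (x + x') y = differential F x y + differential F x' y)
    (fun z hz => ?_) (by simp) (fun a b _ _ ha hb => by simp only [map_add, ha, hb]; ring)
    (fun t a _ ha => by simp only [map_smul, ha, smul_add]) (h.mem_span_zeros hL y)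
  obtain ⟨c, -, hc⟩ := h.exists_differential_eq_mul_pow hL hkN hz
  rw [hc, hc, hc, map_add, h.add_pow hL hkN, mul_add]

end IsExtremal

end FqHypersurface

end

noncomputable section

namespace FqHypersurface

variable {K : Type*} [Field K]

/-! ### Power maps of finite fields -/

section PowerMaps

variable [Finite K]

/-- As m < q, the polynomial (X + 1) ^ m - X ^ m - 1 is zero, and its coefficient at X is m. -/
theorem natCast_eq_zero_of_add_pow {m : ℕ} (hm : 2 ≤ m) (hmq : m < Nat.card K)
    (h : ∀ a b : K, (a + b) ^ m = a ^ m + b ^ m) : (m : K) = 0 := by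
  have := Fintype.ofFinite K
  let P : Polynomial K := (Polynomial.X + 1) ^ m - (Polynomial.X ^ m + 1)
  have hP : P = 0 := by
    refine Polynomial.eq_zero_of_natDegree_lt_card_of_eval_eq_zero' P Finset.univ ?_ ?_
    · intro t _
      simp [P, h t 1]
    · refine lt_of_le_of_lt (b := m) ?_ (by rwa [Finset.card_univ, ← Nat.card_eq_fintype_card])
      refine (Polynomial.natDegree_sub_le _ _).trans (max_le ?_ ?_)
      · refine (Polynomial.natDegree_pow_le).trans ?_
        have : (Polynomial.X + 1 : Polynomial K).natDegree ≤ 1 :=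
          Polynomial.natDegree_add_le_of_degree_le Polynomial.natDegree_X_le (by simp)
        nlinarith
      · exact Polynomial.natDegree_add_le_of_degree_le (Polynomial.natDegree_X_pow_le m) (by simp)
  have h1 := congrArg (fun p => Polynomial.coeff p 1) hP
  have h2 : ¬ (1 = m) := by omega
  simpa [P, Polynomial.coeff_X_add_one_pow, Polynomial.coeff_X_pow, Polynomial.coeff_one, h2]
    using h1

/-- Write s = p ^ e m with p not dividing m. By injectivity of Frobenius the m-th power is additive
as well, so m ≥ 2 would force p to divide m. -/
theorem exists_eq_prime_pow_of_add_pow {p s : ℕ} [Fact p.Prime] [CharP K p] (hs : 1 ≤ s)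
    (hsq : s < Nat.card K) (h : ∀ a b : K, (a + b) ^ s = a ^ s + b ^ s) : ∃ e, s = p ^ e := by
  obtain ⟨e, m, hm, rfl⟩ := Nat.exists_eq_pow_mul_and_not_dvd (n := s) (by omega) p
    (Fact.out : p.Prime).ne_one
  refine ⟨e, ?_⟩
  have hp : 1 ≤ p ^ e := Nat.one_le_pow _ _ (Fact.out : p.Prime).pos
  have hm1 : 1 ≤ m := by
    rcases Nat.eq_zero_or_pos m with rfl | h0
    · simp at hm
    · exact h0
  have hinj : Function.Injective fun t : K => t ^ p ^ e := by
    intro a b hab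
    have := iterateFrobenius_inj K p e
    exact this (by simpa [iterateFrobenius_def] using hab)
  have hadd : ∀ a b : K, (a + b) ^ m = a ^ m + b ^ m := by
    intro a b
    apply hinj
    simp only
    rw [add_pow_char_pow, ← pow_mul, ← pow_mul, ← pow_mul, mul_comm m]
    exact h a b
  by_cases hm2 : 2 ≤ m
  · have := natCast_eq_zero_of_add_pow hm2 (lt_of_le_of_lt (by nlinarith) hsq) hadd
    exact absurd ((CharP.cast_eq_zero_iff K p m).1 this) hm
  · have : m = 1 := by omega
    simp [this]

theorem exists_pow_ne_self {m : ℕ} (hm : 2 ≤ m) (hmq : m < Nat.card K) : ∃ t : K, t ^ m ≠ t := by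
  by_contra! hcon
  have := Fintype.ofFinite K
  have hP : (Polynomial.X ^ m - Polynomial.X : Polynomial K) = 0 := by
    refine Polynomial.eq_zero_of_natDegree_lt_card_of_eval_eq_zero' _ Finset.univ ?_ ?_
    · intro t _
      simp [hcon t]
    · refine lt_of_le_of_lt (b := m) ?_ (by rwa [Finset.card_univ, ← Nat.card_eq_fintype_card])
      refine (Polynomial.natDegree_sub_le _ _).trans (max_le (Polynomial.natDegree_X_pow_le m) ?_)
      exact Polynomial.natDegree_X_le.trans (by omega)
  have h1 := congrArg (fun p => Polynomial.coeff p 1) hP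
  have h2 : ¬ (1 = m) := by omega
  simp [Polynomial.coeff_X_pow, h2] at h1

/-- With s = p ^ e and q = p ^ f, the map t ↦ t ^ (p ^ (2 e)) is the identity and e < f. Reducing 2
e by f when it is at least f leaves an exponent p ^ w < q that fixes everything, so w = 0; and 2 e <
f is excluded in the same way. -/
theorem sq_eq_card_of_pow {s : ℕ} (hs : 2 ≤ s) (hsq : s < Nat.card K)
    (h : ∀ a b : K, (a + b) ^ s = a ^ s + b ^ s) (h2 : ∀ t : K, t ^ (s ^ 2) = t) :
    s ^ 2 = Nat.card K := by
  have := Fintype.ofFinite K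
  obtain ⟨p, hp⟩ := CharP.exists K
  obtain ⟨f, hpp, hf⟩ := FiniteField.card K p
  have : Fact p.Prime := ⟨hpp⟩
  rw [← Nat.card_eq_fintype_card] at hf
  obtain ⟨e, rfl⟩ := exists_eq_prime_pow_of_add_pow (p := p) (by omega) hsq h
  by_contra hne
  rw [← pow_mul] at h2 hne
  by_cases hle : (f : ℕ) ≤ e * 2
  · obtain ⟨w, hw⟩ := Nat.exists_eq_add_of_le hle
    have hlt : p ^ w < Nat.card K := by
      rw [hf] at hsq ⊢
      have := (Nat.pow_lt_pow_iff_right hpp.one_lt).1 hsq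
      exact Nat.pow_lt_pow_right hpp.one_lt (by omega)
    have hw0 : w ≠ 0 := by
      rintro rfl
      exact hne (by rw [hf, hw]; rfl)
    obtain ⟨t, ht⟩ := exists_pow_ne_self (K := K) (m := p ^ w)
      (hpp.two_le.trans (Nat.le_self_pow hw0 p)) hlt
    apply ht
    have := h2 t
    rw [hw, pow_add, pow_mul, ← hf, Nat.card_eq_fintype_card, FiniteField.pow_card] at this
    exact this
  · obtain ⟨t, ht⟩ := exists_pow_ne_self (K := K) (m := p ^ (e * 2))
      (by rw [pow_mul]; nlinarith) (by
        rw [hf]; exact Nat.pow_lt_pow_right hpp.one_lt (by omega))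
    exact ht (h2 t)

variable {s : ℕ}

theorem two_le_of_sq_eq_card (hs : s ^ 2 = Nat.card K) : 2 ≤ s := by
  have := two_le_card (K := K)
  by_contra h
  interval_cases s <;> omega

theorem add_pow_of_sq_eq_card (hs : s ^ 2 = Nat.card K) (a b : K) :
    (a + b) ^ s = a ^ s + b ^ s := by
  have := Fintype.ofFinite K
  obtain ⟨p, hp⟩ := CharP.exists K
  obtain ⟨f, hpp, hf⟩ := FiniteField.card K p
  have : Fact p.Prime := ⟨hpp⟩
  rw [← Nat.card_eq_fintype_card] at hf
  have hdvd : s ∣ p ^ (f : ℕ) := by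
    rw [← hf, ← hs, pow_two]
    exact dvd_mul_right s s
  obtain ⟨e, -, rfl⟩ := (Nat.dvd_prime_pow hpp).1 hdvd
  exact add_pow_char_pow a b p e

theorem pow_pow_of_sq_eq_card (hs : s ^ 2 = Nat.card K) (a : K) : (a ^ s) ^ s = a := by
  have := Fintype.ofFinite K
  rw [← pow_mul, ← pow_two, hs, Nat.card_eq_fintype_card, FiniteField.pow_card]

theorem sum_pow_of_sq_eq_card (hs : s ^ 2 = Nat.card K) {ι : Type*} (A : Finset ι) (f : ι → K) :
    (∑ i ∈ A, f i) ^ s = ∑ i ∈ A, f i ^ s := by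
  classical
  have h2 := two_le_of_sq_eq_card hs
  induction A using Finset.induction_on with
  | empty => simp [show s ≠ 0 by omega]
  | insert i A hi ih => rw [Finset.sum_insert hi, Finset.sum_insert hi, add_pow_of_sq_eq_card hs, ih]

/-- The norm to the subfield with `s` elements takes each nonzero value `s + 1` times. -/
theorem natCard_pow_succ_eq (hs : s ^ 2 = Nat.card K) {b : K} (hb : b ≠ 0) (hbs : b ^ s = b) :
    Nat.card {t : K // t ^ (s + 1) = b} = s + 1 := by
  classical
  have := Fintype.ofFinite K
  have hs2 := two_le_of_sq_eq_card hs
  -- The (s + 1)-st power maps the q - 1 = (s - 1) (s + 1) units into B, which has at most s - 1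
  -- elements, with fibres of size at most s + 1. Both estimates must be sharp.
  let B : Finset K := Finset.univ.filter fun b => b ^ (s - 1) = 1
  let c : K → ℕ := fun b => (Finset.univ.filter fun t : K => t ^ (s + 1) = b).card
  have hroots : ∀ (m : ℕ) (b : K), 0 < m →
      (Finset.univ.filter fun t : K => t ^ m = b).card ≤ m := by
    intro m b hm
    have h1 : (Finset.univ.filter fun t : K => t ^ m = b) ⊆ (Polynomial.nthRoots m b).toFinset := by
      intro t ht
      simpa [Polynomial.mem_nthRoots hm] using ht
    exact (Finset.card_le_card h1).trans
      ((Multiset.toFinset_card_le _).trans (Polynomial.card_nthRoots m b))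
  have hBcard : B.card ≤ s - 1 := hroots (s - 1) 1 (by omega)
  have hc : ∀ b ∈ B, c b ≤ s + 1 := fun b _ => hroots (s + 1) b (by omega)
  have hmaps : ∀ t ∈ Finset.univ.erase (0 : K), t ^ (s + 1) ∈ B := by
    intro t ht
    have ht0 : t ≠ 0 := Finset.ne_of_mem_erase ht
    simp only [B, Finset.mem_filter, Finset.mem_univ, true_and]
    rw [← pow_mul, show (s + 1) * (s - 1) = Nat.card K - 1 by
      rw [← hs]; zify [show 1 ≤ s by omega, show 1 ≤ s ^ 2 by nlinarith]; ring,
      Nat.card_eq_fintype_card, FiniteField.pow_card_sub_one_eq_one t ht0]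
  have hsum := Finset.card_eq_sum_card_fiberwise hmaps
  have hfib : ∀ b ∈ B, ((Finset.univ.erase (0 : K)).filter fun t => t ^ (s + 1) = b).card = c b := by
    intro b hb
    congr 1
    ext t
    simp only [Finset.mem_filter, Finset.mem_erase, Finset.mem_univ, true_and, and_true, ne_eq,
      and_iff_right_iff_imp]
    rintro rfl rfl
    simp [B, show s - 1 ≠ 0 by omega] at hb
  rw [Finset.sum_congr rfl hfib, Finset.card_erase_of_mem (Finset.mem_univ _), Finset.card_univ,
    ← Nat.card_eq_fintype_card, ← hs] at hsum
  have hle : ∑ b ∈ B, c b ≤ ∑ b ∈ B, (s + 1) := Finset.sum_le_sum hc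
  have heq : ∑ b ∈ B, c b = ∑ b ∈ B, (s + 1) := by
    refine le_antisymm hle ?_
    rw [← hsum, Finset.sum_const, smul_eq_mul]
    calc B.card * (s + 1) ≤ (s - 1) * (s + 1) := Nat.mul_le_mul_right _ hBcard
      _ = s ^ 2 - 1 := by zify [show 1 ≤ s by omega, show 1 ≤ s ^ 2 by nlinarith]; ring
  have hbB : b ∈ B := by
    simp only [B, Finset.mem_filter, Finset.mem_univ, true_and]
    apply mul_right_cancel₀ hb
    rw [← pow_succ, Nat.sub_add_cancel (by omega), hbs, one_mul]
  rw [Nat.card_eq_fintype_card, Fintype.card_subtype]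
  exact (Finset.sum_eq_sum_iff_of_le hc).1 heq b hbB

/-! ### Diagonal Hermitian forms -/

/-- Fixing all coordinates but the first leaves t ^ (s + 1) = b with b fixed by the s-th power: one
solution if b = 0, otherwise s + 1. The number of zeros thus satisfies Z' = (s + 1) s ^ (2 M) - s Z.
-/
theorem natCard_hermitian_zeros (hs : s ^ 2 = Nat.card K) (M : ℕ) :
    (s : ℤ) * Nat.card {x : Fin M → K // ∑ i, x i ^ (s + 1) = 0} =
      s ^ (2 * M) + (-1) ^ M * (s - 1) * s ^ M := by
  classical
  have := Fintype.ofFinite K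
  have hs2 := two_le_of_sq_eq_card hs
  induction M with
  | zero =>
    have : Nat.card {x : Fin 0 → K // ∑ i, x i ^ (s + 1) = 0} = 1 := by
      rw [Nat.card_eq_fintype_card, Fintype.card_subtype]
      simp
    rw [this]
    simp
  | succ M ih =>
    set Z := Nat.card {x : Fin M → K // ∑ i, x i ^ (s + 1) = 0} with hZ
    have hfix : ∀ y : Fin M → K, (∑ i, y i ^ (s + 1)) ^ s = ∑ i, y i ^ (s + 1) := by
      intro y
      rw [sum_pow_of_sq_eq_card hs]
      refine Finset.sum_congr rfl fun i _ => ?_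
      rw [pow_succ, mul_pow, pow_pow_of_sq_eq_card hs, mul_comm]
    have hneg : ∀ b : K, b ^ s = b → (-b) ^ s = -b := by
      intro b hb
      have h0 := add_pow_of_sq_eq_card hs b (-b)
      rw [add_neg_cancel, zero_pow (by omega), hb] at h0
      exact (neg_eq_of_add_eq_zero_right h0.symm).symm
    have hfib : ∀ y : Fin M → K, Nat.card {t : K // t ^ (s + 1) = -∑ i, y i ^ (s + 1)} =
        if ∑ i, y i ^ (s + 1) = 0 then 1 else s + 1 := by
      intro y
      split_ifs with h
      · rw [h, neg_zero, Nat.card_eq_fintype_card, Fintype.card_subtype]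
        rw [Finset.card_eq_one]
        exact ⟨0, by ext t; simp⟩
      · exact natCard_pow_succ_eq hs (neg_ne_zero.2 h) (hneg _ (hfix y))
    have hcount : Nat.card {x : Fin (M + 1) → K // ∑ i, x i ^ (s + 1) = 0} =
        ∑ y : Fin M → K, Nat.card {t : K // t ^ (s + 1) = -∑ i, y i ^ (s + 1)} := by
      rw [← Nat.card_sigma]
      refine Nat.card_congr
        { toFun := fun x => ⟨fun i => x.1 i.succ, x.1 0, ?_⟩
          invFun := fun x => ⟨Fin.cons x.2.1 x.1, ?_⟩
          left_inv := fun x => ?_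
          right_inv := fun x => ?_ }
      · have := x.2
        rw [Fin.sum_univ_succ] at this
        exact eq_neg_of_add_eq_zero_left this
      · rw [Fin.sum_univ_succ]
        simp only [Fin.cons_zero, Fin.cons_succ]
        rw [x.2.2, neg_add_cancel]
      · apply Subtype.ext
        exact Fin.cons_self_tail x.1
      · rfl
    have htotal : ∑ y : Fin M → K, (if ∑ i, y i ^ (s + 1) = 0 then 1 else s + 1) + s * Z =
        (s + 1) * s ^ (2 * M) := by
      have h1 : Z = ∑ y : Fin M → K, if ∑ i, y i ^ (s + 1) = 0 then 1 else 0 := by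
        rw [hZ, Nat.card_eq_fintype_card, Fintype.card_subtype, Finset.card_filter]
      rw [h1, Finset.mul_sum, ← Finset.sum_add_distrib]
      have h2 : ∀ y : Fin M → K, ((if ∑ i, y i ^ (s + 1) = 0 then 1 else s + 1) +
          s * if ∑ i, y i ^ (s + 1) = 0 then 1 else 0) = s + 1 := by
        intro y
        split_ifs <;> ring
      simp only [h2, Finset.sum_const, Finset.card_univ, smul_eq_mul]
      rw [Fintype.card_fun, Fintype.card_fin, ← Nat.card_eq_fintype_card, ← hs, ← pow_mul, mul_comm]
    rw [hcount]
    simp only [hfib]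
    zify at htotal ⊢
    have e1 : (s : ℤ) ^ (2 * (M + 1)) = s ^ 2 * s ^ (2 * M) := by rw [← pow_add]; congr 1; ring
    rw [e1]
    linear_combination (s : ℤ) * htotal - (s : ℤ) * ih

/-- Every Hermitian form over a finite field has an orthogonal basis of vectors of norm `0` or
`1`. -/
theorem exists_hermitian_diagonalization (hs : s ^ 2 = Nat.card K) (m : ℕ) {E : Type*}
    [AddCommGroup E] [Module K E] [FiniteDimensional K E] (hm : Module.finrank K E = m)
    (H : E → E →ₗ[K] K) (hH : ∀ x y, H y x = H x y ^ s) :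
    ∃ (M r : ℕ) (e : ((Fin M → K) × (Fin r → K)) ≃ₗ[K] E),
      ∀ a b, H (e a) (e b) = ∑ i, a.1 i ^ s * b.1 i := by
  have hs2 := two_le_of_sq_eq_card hs
  have hadd : ∀ x y z, H (x + y) z = H x z + H y z := by
    intro x y z
    rw [hH z, map_add, add_pow_of_sq_eq_card hs, ← hH, ← hH]
  have hsmul : ∀ (t : K) x z, H (t • x) z = t ^ s * H x z := by
    intro t x z
    rw [hH z, map_smul, smul_eq_mul, mul_pow, ← hH]
  induction m generalizing E with
  | zero =>
    refine ⟨0, 0, LinearEquiv.ofFinrankEq _ _ (by simp [hm]), fun a b => ?_⟩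
    have : Subsingleton E := Module.finrank_zero_iff.1 hm
    rw [Subsingleton.elim ((LinearEquiv.ofFinrankEq _ _ _) b) 0, map_zero]
    simp
  | succ m ih =>
    by_cases hall : ∀ v, H v v = 0
    · have hzero : ∀ x y, H x y = 0 := by
        by_contra! hcon
        obtain ⟨x, y, hxy⟩ := hcon
        obtain ⟨t, ht⟩ := exists_pow_ne_self (K := K) hs2 (by rw [← hs]; nlinarith)
        -- If all norms vanish, expanding the norm of x + (a / H x y) y gives a + a ^ s = 0 for all
        -- a. The case a = 1 then shows that the s-th power is the identity, which is false as 2 ≤ s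
        -- < q.
        have key : ∀ a : K, a + a ^ s = 0 := by
          intro a
          have h1 := hall (x + (a / H x y) • y)
          rw [hadd, map_add, map_add, hall, hsmul, hsmul] at h1
          simp only [map_smul, smul_eq_mul, hall, mul_zero, add_zero, zero_add] at h1
          rw [hH x y, ← mul_pow, div_mul_cancel₀ _ hxy] at h1
          exact h1
        have k1 := key 1
        have k2 := key t
        rw [one_pow] at k1
        apply ht
        linear_combination k2 - t * k1
      refine ⟨0, m + 1, LinearEquiv.ofFinrankEq _ _ (by simp [hm]), fun a b => ?_⟩
      rw [hzero]
      simp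
    · push Not at hall
      obtain ⟨v, hv⟩ := hall
      -- The norm hits every nonzero fixed element, so v can be rescaled to norm 1; the induction
      -- continues on the orthogonal complement.
      obtain ⟨w, hw⟩ : ∃ w, H w w = 1 := by
        have h1 : ((H v v)⁻¹) ^ s = (H v v)⁻¹ := by rw [inv_pow, ← hH]
        have h2 := natCard_pow_succ_eq hs (inv_ne_zero hv) h1
        obtain ⟨⟨t, ht⟩⟩ : Nonempty {t : K // t ^ (s + 1) = (H v v)⁻¹} :=
          (Nat.card_ne_zero.1 (by rw [h2]; omega)).1
        refine ⟨t • v, ?_⟩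
        rw [hsmul, map_smul, smul_eq_mul, ← mul_assoc, ← pow_succ, ht, inv_mul_cancel₀ hv]
      have hw0 : H w ≠ 0 := fun h => by rw [h] at hw; simp at hw
      let W := LinearMap.ker (H w)
      have hWfin : Module.finrank K W = m := by
        have := Module.Dual.finrank_ker_add_one_of_ne_zero hw0
        rw [hm] at this
        exact Nat.succ_injective this
      have hwW : ∀ x : W, H w x.1 = 0 := fun x => x.2
      have hWw : ∀ x : W, H x.1 w = 0 := fun x => by
        rw [hH w, hwW, zero_pow (by omega)]
      obtain ⟨M, r, e, he⟩ := ih hWfin (fun x => H x.1 ∘ₗ W.subtype) (fun x y => hH x.1 y.1)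
        (fun x y z => hadd _ _ _) (fun t x z => hsmul _ _ _)
      let T : ((Fin (M + 1) → K) × (Fin r → K)) →ₗ[K] E :=
        ((LinearMap.proj 0 ∘ₗ LinearMap.fst K _ _).smulRight w) +
          W.subtype ∘ₗ e.toLinearMap ∘ₗ
            ((LinearMap.funLeft K K Fin.succ ∘ₗ LinearMap.fst K _ _).prod (LinearMap.snd K _ _))
      have hT : ∀ a, T a = a.1 0 • w + (e (fun i => a.1 i.succ, a.2)).1 := fun a => rfl
      have hTbij : Function.Bijective T := by
        constructor
        · rw [← LinearMap.ker_eq_bot, LinearMap.ker_eq_bot']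
          intro a ha
          rw [hT] at ha
          have h1 := congrArg (H w) ha
          rw [map_add, map_smul, hw, hwW, map_zero] at h1
          simp only [smul_eq_mul, mul_one, add_zero] at h1
          rw [h1, zero_smul, zero_add] at ha
          have h2 : e (fun i => a.1 i.succ, a.2) = 0 := Subtype.ext ha
          rw [LinearEquiv.map_eq_zero_iff] at h2
          have h3 := congrArg Prod.fst h2
          have h4 := congrArg Prod.snd h2
          refine Prod.ext (funext fun i => ?_) h4
          refine Fin.cases h1 (fun j => ?_) i
          exact congrFun h3 j
        · intro x
          let y : W := ⟨x - H w x • w, by simp [W, hw]⟩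
          refine ⟨(Fin.cons (H w x) (e.symm y).1, (e.symm y).2), ?_⟩
          rw [hT]
          simp [y]
      refine ⟨M + 1, r, LinearEquiv.ofBijective T hTbij, fun a b => ?_⟩
      have h1 := he (fun i => a.1 i.succ, a.2) (fun i => b.1 i.succ, b.2)
      simp only [LinearMap.comp_apply, Submodule.subtype_apply] at h1
      rw [LinearEquiv.ofBijective_apply, LinearEquiv.ofBijective_apply, hT, hT, hadd, map_add,
        map_add, hsmul, hsmul, map_smul, map_smul, hw, hwW, hWw, h1, Fin.sum_univ_succ]
      simp

end PowerMaps

end FqHypersurface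

end

noncomputable section

namespace FqHypersurface

variable {K : Type*} [Field K]

/-! ### Extremal forms of degree at least three are Hermitian -/

variable [Finite K] {N d k : ℕ} {F : MvPolynomial (Fin N) K} {L : Submodule K (Fin N → K)}

namespace IsExtremal

/-- Compare the constants c of `exists_differential_eq_mul_pow` at x, y and t x + y. Testing on z₂
shows that the last one equals that of y, and testing on z₁ gives t c_x = c_y t ^ ((d - 1) ^ 2) for
every t. -/
theorem sub_one_sq_eq_card (h : IsExtremal F d k) (hL : IsZeroSpace F k L) (hkN : k + 2 < N)
    (hd : 3 ≤ d) : (d - 1) ^ 2 = Nat.card K := by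
  have hdq := h.le_card
  obtain ⟨x, hx, y, hy, z₁, z₂, h1, h2, h3, h4⟩ := h.exists_pair hL hkN
  obtain ⟨cx, hcx0, hcx⟩ := h.exists_differential_eq_mul_pow hL hkN (hL.eval_eq_zero x hx)
  obtain ⟨cy, -, hcy⟩ := h.exists_differential_eq_mul_pow hL hkN (hL.eval_eq_zero y hy)
  have hcx0 := hcx0 fun h0 => h1 (by rw [h0]; rfl)
  have key : ∀ t : K, t * cx = cy * (t ^ (d - 1)) ^ (d - 1) := by
    intro t
    have hm : t • x + (1 : K) • y ∈ L := L.add_mem (L.smul_mem t hx) (L.smul_mem 1 hy)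
    obtain ⟨cm, -, hcm⟩ := h.exists_differential_eq_mul_pow hL hkN (hL.eval_eq_zero _ hm)
    have e1 := hcm z₁
    have e2 := hcm z₂
    rw [h.differential_comb hL hx hy h2, map_add, map_smul, map_smul, hcx, hcy, h2,
      zero_pow (by omega), mul_zero, smul_zero, add_zero, smul_eq_mul, mul_pow] at e1
    rw [add_comm, h.differential_comb hL hy hx h3, map_add, map_smul, map_smul, hcx, hcy, h3,
      zero_pow (by omega), mul_zero, smul_zero, add_zero, one_smul, one_pow, one_mul] at e2
    have hcc : cy = cm := mul_right_cancel₀ (pow_ne_zero _ h4) e2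
    rw [hcc]
    apply mul_right_cancel₀ (pow_ne_zero (d - 1) h1)
    linear_combination e1
  have hcxy : cx = cy := by simpa using key 1
  refine sq_eq_card_of_pow (by omega) (by omega) (h.add_pow hL hkN) fun t => ?_
  have := key t
  rw [hcxy, mul_comm, ← pow_mul, ← pow_two] at this
  exact (mul_left_cancel₀ (hcxy ▸ hcx0) this).symm

/-- Put s = d - 1. For w not tangent at x, B(·, w) = α φ ^ s and B(w, ·) = e φ on L; as s ^ 2 = q,
B(z, w) ^ s = α ^ s φ(z), so the ratio is the same for all z in L, in particular for x. Tangent w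
are reached by additivity. -/
theorem exists_const_on_isZeroSpace (h : IsExtremal F d k) (hL : IsZeroSpace F k L)
    (hkN : k + 2 < N) (hd : 3 ≤ d) :
    ∃ c : K, ∀ z ∈ L, ∀ w, differential F w z = c * differential F z w ^ (d - 1) := by
  have hq := h.sub_one_sq_eq_card hL hkN hd
  obtain ⟨x, hx, y, hy, z₁, z₂, h1, h2, h3, h4⟩ := h.exists_pair hL hkN
  obtain ⟨c, -, hc⟩ := h.exists_differential_eq_mul_pow hL hkN (hL.eval_eq_zero x hx)
  have hmain : ∀ w, differential F x w ≠ 0 →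
      ∀ z ∈ L, differential F w z = c * differential F z w ^ (d - 1) := by
    intro w hxw
    have hw : w ∉ L := fun hw => hxw (h.differential_eq_zero hL hx hw)
    obtain ⟨φ, α, a, hφ, hα, -, -, hdiff⟩ := h.exists_factorization hL hw
    obtain ⟨e, he⟩ : ∃ e : K, differential F w ∘ₗ L.subtype = e • φ := by
      refine exists_eq_smul_of_ker_le fun z hz => ?_
      obtain ⟨cz, -, hcz⟩ := h.exists_differential_eq_mul_pow hL hkN (hL.eval_eq_zero z.1 z.2)
      change differential F w z.1 = 0
      rw [hcz, hdiff, hz, zero_pow (by omega), mul_zero, zero_pow (by omega), mul_zero]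
    have hval : ∀ (z) (hz : z ∈ L), differential F z w ^ (d - 1) = α ^ (d - 1) * φ ⟨z, hz⟩ := by
      intro z hz
      rw [hdiff ⟨z, hz⟩, mul_pow, pow_pow_of_sq_eq_card hq]
    have hval2 : ∀ (z) (hz : z ∈ L), differential F w z = e * φ ⟨z, hz⟩ := fun z hz =>
      LinearMap.congr_fun he ⟨z, hz⟩
    have hec : e = c * α ^ (d - 1) := by
      have hx0 : φ ⟨x, hx⟩ ≠ 0 := by
        intro h0
        have := hdiff ⟨x, hx⟩
        rw [h0, zero_pow (by omega), mul_zero] at this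
        exact hxw this
      apply mul_right_cancel₀ hx0
      rw [← hval2, hc, hval x hx, mul_assoc]
    intro z hz
    rw [hval2 z hz, hval z hz, hec, mul_assoc]
  refine ⟨c, fun z hz w => ?_⟩
  by_cases hxw : differential F x w = 0
  · have e1 := hmain z₁ h1 z hz
    have e2 := hmain (w + z₁) (by rwa [map_add, hxw, zero_add]) z hz
    rw [h.differential_add hL hkN, map_add, h.add_pow hL hkN, mul_add, e1] at e2
    exact add_right_cancel e2
  · exact hmain w hxw z hz

/-- Neighbouring zero spaces share a nonsingular point, so they have the same constant. Any y off L
is a zero on a neighbouring space minus a multiple of a point of L, and the relation is additive in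
y. -/
theorem exists_const (h : IsExtremal F d k) (hL : IsZeroSpace F k L)
    (hkN : k + 2 < N) (hd : 3 ≤ d) :
    ∃ c : K, ∀ z w, differential F w z = c * differential F z w ^ (d - 1) := by
  have hq := h.sub_one_sq_eq_card hL hkN hd
  obtain ⟨c, hc⟩ := h.exists_const_on_isZeroSpace hL hkN hd
  refine ⟨c, fun y w => ?_⟩
  by_cases hy : y ∈ L
  · exact hc y hy w
  obtain ⟨φ, α, a, hφ, hα, ha, hform, hdiff⟩ := h.exists_factorization hL hy
  obtain ⟨x₂, hx₂⟩ := exists_apply_eq_one hφ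
  let i : Fin (d - 1) := ⟨0, by omega⟩
  set y' := y + a i • x₂.1 with hy'
  have h0 : eval y' F = 0 := by
    have := hform (a i • x₂) 1
    rw [one_smul] at this
    refine this.trans (mul_eq_zero_of_right _ (Finset.prod_eq_zero (Finset.mem_univ i) ?_))
    simp [hx₂]
  have hy'L : y' ∉ L := fun hyL => hy (by
    have := L.sub_mem hyL (L.smul_mem (a i) x₂.2)
    rwa [hy', add_sub_cancel_right] at this)
  obtain ⟨L', hL', hyL', hsub⟩ := h.exists_adjacent hL hy'L h0
  obtain ⟨c', hc'⟩ := h.exists_const_on_isZeroSpace hL' hkN hd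
  -- φ lives on L only; it is extended so that `exists_nonsingular_mem_ker` supplies a nonsingular
  -- point of ker φ.
  obtain ⟨ψ, hψ⟩ := LinearMap.exists_extend φ
  obtain ⟨x₃, hx₃, hψx₃, hBx₃⟩ := h.exists_nonsingular_mem_ker hL hkN ψ
  have hx₃L' : x₃ ∈ L' := by
    refine hsub x₃ hx₃ ?_
    have e1 : φ ⟨x₃, hx₃⟩ = 0 := by rw [← hψ]; exact hψx₃
    have e2 := hdiff ⟨x₃, hx₃⟩
    rw [e1, zero_pow (by omega), mul_zero] at e2
    rw [hy', map_add, map_smul, e2, h.differential_eq_zero hL hx₃ x₂.2, smul_zero, add_zero]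
  obtain ⟨v, hv⟩ := exists_apply_eq_one hBx₃
  have hcc : c' = c := by
    have e1 := hc x₃ hx₃ v
    have e2 := hc' x₃ hx₃L' v
    rw [hv, one_pow, mul_one] at e1 e2
    rw [← e1, e2]
  have e1 := hc' y' hyL' w
  have e2 := hc x₂.1 x₂.2 w
  rw [hcc, hy', map_add, map_smul, h.differential_add hL hkN, differential_smul h.isHomogeneous,
    h.add_pow hL hkN, mul_pow, pow_pow_of_sq_eq_card hq, e2, smul_eq_mul] at e1
  linear_combination e1

/-- An extremal form of degree at least three is the norm form of a Hermitian form, up to a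
scalar. -/
theorem exists_hermitian (h : IsExtremal F d k) (hL : IsZeroSpace F k L) (hkN : k + 2 < N)
    (hd : 3 ≤ d) :
    ∃ μ : K, μ ≠ 0 ∧ (∀ x, eval x F = differential F x x) ∧
      ∀ x y, μ⁻¹ * differential F y x = (μ⁻¹ * differential F x y) ^ (d - 1) := by
  have hdq := h.le_card
  obtain ⟨c, hc⟩ := h.exists_const hL hkN hd
  -- Since d - 1 = 0 in `K`, Euler's identity reads F(x) = B(x, x).
  have hs0 := natCast_eq_zero_of_add_pow (K := K) (m := d - 1) (by omega) (by omega)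
    (h.add_pow hL hkN)
  have hself : ∀ x, eval x F = differential F x x := by
    intro x
    rw [differential_self h.isHomogeneous, show d = d - 1 + 1 by omega, Nat.cast_add, hs0]
    simp
  obtain ⟨x, hx, -, -, z, -, hxz, -⟩ := h.exists_pair hL hkN
  have hz : z ∉ L := fun hz => hxz (h.differential_eq_zero hL hx hz)
  obtain ⟨l, hl⟩ := exists_eval_add_ne_zero h.isHomogeneous h.le_card h.mem_upperBounds hL hz
  set y := z + l.1
  -- With μ = F(y) = B(y, y) ≠ 0, the relation at (y, y) gives c = μ / μ ^ (d - 1), so dividing B by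
  -- μ removes the constant.
  refine ⟨eval y F, hl, hself, fun u v => ?_⟩
  have e1 := hc y y
  rw [← hself] at e1
  rw [hc u v, mul_pow, inv_pow]
  have : c = eval y F / eval y F ^ (d - 1) := by
    field_simp
    exact e1.symm
  rw [this]
  field_simp

end IsExtremal

end FqHypersurface

end

noncomputable section

namespace FqHypersurface

variable {K : Type*} [Field K]

/-! ### Projective equivalence with cones -/

theorem eval_linearSubst {N : ℕ} (g : Matrix (Fin N) (Fin N) K) (F : MvPolynomial (Fin N) K)
    (x : Fin N → K) : eval x (linearSubst g F) = eval (g.mulVec x) F := by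
  rw [linearSubst, ← aeval_eq_eval, aeval_bind₁, aeval_eq_eval]
  congr 2
  ext i
  simp [Matrix.mulVec, dotProduct]

theorem isHomogeneous_linearSubst {N d : ℕ} (g : Matrix (Fin N) (Fin N) K)
    {F : MvPolynomial (Fin N) K} (hF : F.IsHomogeneous d) : (linearSubst g F).IsHomogeneous d := by
  have := hF.aeval (fun i => ∑ j, C (g i j) * X j) fun i =>
    IsHomogeneous.sum _ _ 1 fun j _ => isHomogeneous_C_mul_X _ _
  simpa [linearSubst] using this

/-- As d ≤ q, equality of values suffices for the polynomial identity that projective equivalence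
demands. -/
theorem projEquivCone_of_eval [Finite K] {N M r d : ℕ} {F : MvPolynomial (Fin N) K}
    (hF : F.IsHomogeneous d) (hdq : d ≤ Nat.card K) {G : MvPolynomial (Fin M) K}
    (hG : G.IsHomogeneous d) {c : K} (hc : c ≠ 0) {l : ℤ} (hl : (r : ℤ) = l + 1)
    (e : ((Fin M → K) × (Fin r → K)) ≃ₗ[K] (Fin N → K))
    (h : ∀ a, eval (e a) F = c * eval a.1 G) : ProjEquivCone F l G := by
  have hN : M + r = N := by simpa using e.finrank_eq
  subst hN
  let A : (Fin (M + r) → K) ≃ₗ[K] (Fin (M + r) → K) :=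
    (LinearEquiv.funCongrLeft K K finSumFinEquiv).trans
      ((LinearEquiv.sumArrowLequivProdArrow (Fin M) (Fin r) K K).trans e)
  have hA : ∀ x, A x = e (fun i => x (Fin.castAdd r i), fun i => x (Fin.natAdd M i)) :=
    fun x => rfl
  let g : GL (Fin (M + r)) K := Matrix.GeneralLinearGroup.mkOfDetNeZero
    (LinearMap.toMatrix' A.toLinearMap) (by
      rw [LinearMap.det_toMatrix']
      exact A.isUnit_det'.ne_zero)
  refine ⟨r, hl, rfl, g, c, hc, ?_⟩
  refine (isHomogeneous_linearSubst _ hF).funext_of_le_card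
    (hG.rename_isHomogeneous.C_mul c) (fun x => ?_) (natCast_le_mk hdq)
  rw [eval_linearSubst, map_mul, eval_C, eval_rename]
  have hg : (g : Matrix _ _ K).mulVec x = A x := by
    change (LinearMap.toMatrix' A.toLinearMap).mulVec x = A x
    rw [LinearMap.toMatrix'_mulVec]
    rfl
  rw [hg, hA, h]
  rfl

theorem natCard_zeros_of_projEquivCone [Finite K] {N M : ℕ} {F : MvPolynomial (Fin N) K} {l : ℤ}
    {G : MvPolynomial (Fin M) K} (h : ProjEquivCone F l G) :
    ∃ r : ℕ, (r : ℤ) = l + 1 ∧ M + r = N ∧ Nat.card {x : Fin N → K // eval x F = 0} =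
      Nat.card {x : Fin M → K // eval x G = 0} * Nat.card K ^ r := by
  obtain ⟨r, hr, rfl, g, c, hc, hg⟩ := h
  refine ⟨r, hr, rfl, ?_⟩
  obtain ⟨A, B, hAB, hBA, hA⟩ : ∃ A B : Matrix (Fin (M + r)) (Fin (M + r)) K,
      A * B = 1 ∧ B * A = 1 ∧ linearSubst A F =
        C c * rename (fun i : Fin M => Fin.cast rfl (Fin.castAdd r i)) G :=
    ⟨g, (g⁻¹ : GL (Fin (M + r)) K), g.mul_inv, g.inv_mul, hg⟩
  have e1 : {x : Fin (M + r) → K // eval x (linearSubst A F) = 0} ≃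
      {x : Fin (M + r) → K // eval x F = 0} :=
    { toFun := fun x => ⟨A.mulVec x.1, by rw [← eval_linearSubst]; exact x.2⟩
      invFun := fun x => ⟨B.mulVec x.1, by
        rw [eval_linearSubst, Matrix.mulVec_mulVec, hAB, Matrix.one_mulVec]
        exact x.2⟩
      left_inv := fun x => Subtype.ext (by
        change B.mulVec (A.mulVec x.1) = x.1
        rw [Matrix.mulVec_mulVec, hBA, Matrix.one_mulVec])
      right_inv := fun x => Subtype.ext (by
        change A.mulVec (B.mulVec x.1) = x.1
        rw [Matrix.mulVec_mulVec, hAB, Matrix.one_mulVec]) }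
  have hval : ∀ x : Fin (M + r) → K, eval x (linearSubst A F) = 0 ↔
      eval (fun i => x (Fin.castAdd r i)) G = 0 := by
    intro x
    rw [hA, map_mul, eval_C, eval_rename, mul_eq_zero, or_iff_right hc]
    rfl
  have e2 : {x : Fin (M + r) → K // eval x (linearSubst A F) = 0} ≃
      {x : Fin M → K // eval x G = 0} × (Fin r → K) :=
    { toFun := fun x => (⟨fun i => x.1 (Fin.castAdd r i), (hval x.1).1 x.2⟩,
        fun i => x.1 (Fin.natAdd M i))
      invFun := fun y => ⟨Fin.append y.1.1 y.2, (hval _).2 (by simpa using y.1.2)⟩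
      left_inv := fun x => Subtype.ext (Fin.append_castAdd_natAdd)
      right_inv := fun y => by
        refine Prod.ext (Subtype.ext ?_) ?_ <;> ext i <;> simp }
  rw [← Nat.card_congr e1, Nat.card_congr e2, Nat.card_prod, Nat.card_fun, Nat.card_fin]

/-! ### Quadratic forms -/

open Classical in
theorem natCard_mul_eq [Finite K] (b : K) :
    Nat.card {p : K × K // p.1 * p.2 = b} + 1 =
      if b = 0 then 2 * Nat.card K else Nat.card K := by
  have := Fintype.ofFinite K
  split_ifs with hb
  · subst hb
    have h1 : (Finset.univ.filter fun p : K × K => p.1 * p.2 = 0) =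
        ({0} ×ˢ Finset.univ) ∪ (Finset.univ ×ˢ {0}) := by
      ext ⟨a, b⟩
      simp [mul_eq_zero, eq_comm]
    have h2 := Finset.card_union_add_card_inter (({0} : Finset K) ×ˢ (Finset.univ : Finset K))
      (Finset.univ ×ˢ {0})
    have h3 : ((({0} : Finset K) ×ˢ (Finset.univ : Finset K)) ∩ (Finset.univ ×ˢ {0})) = {(0, 0)} := by
      ext p
      simp [Prod.ext_iff, eq_comm]
    rw [h3, ← h1, Finset.card_singleton, Finset.card_product, Finset.card_product] at h2
    rw [Nat.card_eq_fintype_card, Fintype.card_subtype, h2, Nat.card_eq_fintype_card]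
    simp
    ring
  · have e : {p : K × K // p.1 * p.2 = b} ≃ Kˣ :=
      { toFun := fun p => Units.mk0 p.1.1 fun h => hb (by rw [← p.2, h, zero_mul])
        invFun := fun u => ⟨(u, (u : K)⁻¹ * b), by simp⟩
        left_inv := fun p => by
          have h1 : p.1.1 ≠ 0 := fun h => hb (by rw [← p.2, h, zero_mul])
          refine Subtype.ext (Prod.ext rfl ?_)
          simp only [Units.val_mk0]
          rw [inv_mul_eq_iff_eq_mul₀ h1, p.2]
        right_inv := fun u => by ext; simp }
    rw [Nat.card_congr e, Nat.card_units]
    have := two_le_card (K := K)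
    omega

/-- Effect on the count of adding a hyperbolic plane: over each w, the equation has 2 q - 1
solutions if f w = 0 and q - 1 otherwise. -/
theorem natCard_add_mul_zeros [Finite K] {W : Type*} [Finite W] (f : W → K) :
    Nat.card {p : W × (K × K) // f p.1 + p.2.1 * p.2.2 = 0} + Nat.card W =
      Nat.card K * Nat.card {w // f w = 0} + Nat.card K * Nat.card W := by
  classical
  have := Fintype.ofFinite W
  have := Fintype.ofFinite K
  have e : {p : W × (K × K) // f p.1 + p.2.1 * p.2.2 = 0} ≃
      Σ w : W, {p : K × K // p.1 * p.2 = -f w} :=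
    { toFun := fun p => ⟨p.1.1, p.1.2, by linear_combination p.2⟩
      invFun := fun p => ⟨(p.1, p.2.1), by simp [p.2.2]⟩
      left_inv := fun p => rfl
      right_inv := fun p => rfl }
  have h1 : ∀ w, Nat.card {p : K × K // p.1 * p.2 = -f w} + 1 =
      Nat.card K + if f w = 0 then Nat.card K else 0 := by
    intro w
    rw [natCard_mul_eq]
    simp only [neg_eq_zero]
    split_ifs <;> omega
  have h2 : Nat.card W = ∑ _w : W, 1 := by simp
  have h3 : Nat.card {w // f w = 0} = ∑ w : W, if f w = 0 then 1 else 0 := by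
    rw [Nat.card_eq_fintype_card, Fintype.card_subtype, Finset.card_filter]
  rw [Nat.card_congr e, Nat.card_sigma, h3]
  nth_rewrite 1 [h2]
  rw [← Finset.sum_add_distrib, Finset.sum_congr rfl fun w _ => h1 w, Finset.sum_add_distrib,
    Finset.mul_sum, Finset.sum_const, Finset.card_univ, Nat.card_eq_fintype_card (α := W)]
  simp
  ring

open QuadraticMap in
/-- A quadratic form with the number of zeros of a hyperbolic form, possibly degenerate, is
hyperbolic. -/
theorem exists_hyperbolic_decomposition [Finite K] (m : ℕ) {E : Type*} [AddCommGroup E]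
    [Module K E] [FiniteDimensional K E] (hm : Module.finrank K E = m) (Q : QuadraticForm K E)
    (j : ℕ) (hcard : Nat.card K * Nat.card {x // Q x = 0} =
      Nat.card K ^ m + (Nat.card K - 1) * Nat.card K ^ j) :
    ∃ (M r : ℕ) (e : ((Fin M → K × K) × (Fin r → K)) ≃ₗ[K] E),
      m = 2 * M + r ∧ j = M + r ∧ ∀ a, Q (e a) = ∑ i, (a.1 i).1 * (a.1 i).2 := by
  classical
  have hq := two_le_card (K := K)
  have hqpos : 0 < Nat.card K := by omega
  obtain ⟨q', hq'⟩ : ∃ q', Nat.card K = q' + 2 := ⟨Nat.card K - 2, by omega⟩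
  induction m using Nat.strong_induction_on generalizing E j with
  | _ m ih =>
  have : Finite E := Module.finite_of_finite K
  have hEcard : Nat.card E = Nat.card K ^ m := by
    rw [Module.natCard_eq_pow_finrank (K := K), hm]
  -- For m ≥ 1 and j = 0 the prescribed count is -1 modulo q, while the left side is divisible by q.
  have hdvd : 1 ≤ m → 1 ≤ j ∨ ¬ Nat.card K ∣ Nat.card K * Nat.card {x // Q x = 0} := by
    intro hm1
    by_contra! hcon
    have hj : j = 0 := by omega
    have h1 := hcon.2
    rw [hcard, hj, pow_zero, mul_one, Nat.dvd_add_right (dvd_pow_self _ (by omega))] at h1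
    have := Nat.le_of_dvd (by omega) h1
    omega
  rcases Nat.eq_zero_or_pos m with rfl | hmpos
  · have hsub : Subsingleton E := Module.finrank_zero_iff.1 hm
    have h1 : Nat.card {x // Q x = 0} = 1 := by
      rw [Nat.card_eq_one_iff_unique]
      exact ⟨⟨fun a b => Subtype.ext (Subsingleton.elim _ _)⟩, ⟨⟨0, map_zero Q⟩⟩⟩
    have hj : j = 0 := by
      by_contra hj
      have h2 : Nat.card K ≤ Nat.card K ^ j := Nat.le_self_pow hj _
      rw [h1, pow_zero, mul_one] at hcard
      have : (Nat.card K - 1) * Nat.card K ≤ (Nat.card K - 1) * Nat.card K ^ j :=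
        Nat.mul_le_mul_left _ h2
      have h3 : 1 * Nat.card K ≤ (Nat.card K - 1) * Nat.card K := Nat.mul_le_mul_right _ (by omega)
      omega
    refine ⟨0, 0, LinearEquiv.ofFinrankEq _ _ (by
      rw [hm, Module.finrank_zero_of_subsingleton]), rfl, hj, fun a => ?_⟩
    rw [Subsingleton.elim ((LinearEquiv.ofFinrankEq _ _ _) a) 0, map_zero]
    simp
  have hj1 : 1 ≤ j := (hdvd hmpos).resolve_right (not_not.2 (dvd_mul_right _ _))
  obtain ⟨j, rfl⟩ : ∃ i, j = i + 1 := ⟨j - 1, by omega⟩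
  -- With the origin as the only zero, `hcard` would read q = q ^ m plus a positive term.
  obtain ⟨x, hx0, hQx⟩ : ∃ x : E, x ≠ 0 ∧ Q x = 0 := by
    by_contra! hcon
    have h1 : Nat.card {x // Q x = 0} = 1 := by
      rw [Nat.card_eq_one_iff_unique]
      refine ⟨⟨fun a b => Subtype.ext ?_⟩, ⟨⟨0, map_zero Q⟩⟩⟩
      rw [not_imp_comm.1 (hcon a.1) (not_not.2 a.2), not_imp_comm.1 (hcon b.1) (not_not.2 b.2)]
    rw [h1, mul_one] at hcard
    have h2 : Nat.card K ≤ Nat.card K ^ m := Nat.le_self_pow (by omega) _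
    have h3 : 0 < (Nat.card K - 1) * Nat.card K ^ (j + 1) :=
      Nat.mul_pos (by omega) (pow_pos hqpos _)
    omega
  -- A radical isotropic vector is split off as a free coordinate and lowers m and j by one;
  -- otherwise x lies in a hyperbolic plane, which lowers m by two and j by one. No division by 2
  -- occurs, so characteristic 2 is included.
  by_cases hrad : ∀ y, polar Q x y = 0
  · obtain ⟨ψ, hψ⟩ : ∃ ψ : E →ₗ[K] K, ψ x = 1 := by
      have h1 : ¬ ∀ φ : Module.Dual K E, φ x = 0 :=
        fun h => hx0 ((Module.forall_dual_apply_eq_zero_iff K x).1 h)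
      push Not at h1
      obtain ⟨φ, hφ⟩ := h1
      exact ⟨(φ x)⁻¹ • φ, by simp [hφ]⟩
    let W := LinearMap.ker ψ
    have hW : ∀ w : W, ψ w.1 = 0 := fun w => w.2
    let D : (W × K) →ₗ[K] E := W.subtype.coprod (LinearMap.toSpanSingleton K E x)
    have hD : ∀ p, D p = p.1.1 + p.2 • x := fun p => rfl
    have hDbij : Function.Bijective D := by
      constructor
      · rw [← LinearMap.ker_eq_bot, LinearMap.ker_eq_bot']
        intro p hp
        rw [hD] at hp
        have h1 := congrArg ψ hp
        rw [map_add, map_smul, hψ, hW, map_zero, zero_add, smul_eq_mul, mul_one] at h1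
        rw [h1, zero_smul, add_zero] at hp
        exact Prod.ext (Subtype.ext hp) h1
      · intro z
        refine ⟨(⟨z - ψ z • x, by simp [W, hψ]⟩, ψ z), ?_⟩
        rw [hD]
        simp
    let D' := LinearEquiv.ofBijective D hDbij
    have hD' : ∀ p, D' p = p.1.1 + p.2 • x := hD
    have hQ : ∀ p, Q (D' p) = Q p.1.1 := by
      intro p
      rw [hD', QuadraticMap.map_add (⇑Q), QuadraticMap.map_smul, hQx, polar_smul_right, polar_comm, hrad]
      simp
    have hfin : Module.finrank K W + 1 = m := by
      rw [← hm, ← D'.finrank_eq]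
      simp
    have hZ : Nat.card {z // Q z = 0} = Nat.card {w : W // Q.comp W.subtype w = 0} * Nat.card K := by
      rw [← Nat.card_prod]
      refine Nat.card_congr ((D'.toEquiv.subtypeEquiv fun p => ?_).symm.trans
        (Equiv.prodSubtypeFstEquivSubtypeProd (p := fun w : W => Q.comp W.subtype w = 0)))
      change _ ↔ Q (D' p) = 0
      rw [hQ]
      rfl
    obtain ⟨M, r, e, h1, h2, h3⟩ := ih (Module.finrank K W) (by omega) rfl (Q.comp W.subtype) j (by
      rw [hZ, ← hfin, pow_succ, pow_succ] at hcard
      refine Nat.eq_of_mul_eq_mul_right hqpos ?_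
      linear_combination hcard)
    refine ⟨M, r + 1, ((LinearEquiv.refl K _).prodCongr
      ((Fin.consLinearEquiv K fun _ : Fin (r + 1) => K).symm.trans (LinearEquiv.prodComm K _ _))).trans
      ((LinearEquiv.prodAssoc K _ _ _).symm.trans ((e.prodCongr (LinearEquiv.refl K K)).trans D')),
      by omega, by omega, fun a => ?_⟩
    have h4 := h3 (a.1, Fin.tail a.2)
    rw [← h4]
    exact hQ (e (a.1, Fin.tail a.2), a.2 0)
  · push Not at hrad
    obtain ⟨y₀, hy₀⟩ := hrad
    obtain ⟨y, hQy, hxy⟩ : ∃ y, Q y = 0 ∧ polar Q x y = 1 := by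
      have h1 : polar Q x ((polar Q x y₀)⁻¹ • y₀) = 1 := by
        rw [polar_smul_right, smul_eq_mul, inv_mul_cancel₀ hy₀]
      have hxx : polar Q x x = 0 := by rw [polar_self, hQx, smul_zero]
      generalize (polar Q x y₀)⁻¹ • y₀ = y₁ at h1
      -- Subtracting Q(y₁) x makes y₁ isotropic without changing its pairing with x.
      refine ⟨y₁ + (-Q y₁) • x, ?_, ?_⟩
      · rw [QuadraticMap.map_add (⇑Q), QuadraticMap.map_smul, hQx, polar_smul_right, polar_comm, h1]
        simp
      · rw [polar_add_right, polar_smul_right, h1, hxx]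
        simp
    have hxx : polar Q x x = 0 := by rw [polar_self, hQx, smul_zero]
    have hyy : polar Q y y = 0 := by rw [polar_self, hQy, smul_zero]
    have hyx : polar Q y x = 1 := by rw [polar_comm, hxy]
    let W := LinearMap.ker (Q.polarBilin x) ⊓ LinearMap.ker (Q.polarBilin y)
    have hWx : ∀ w : W, polar Q x w.1 = 0 := fun w => w.2.1
    have hWy : ∀ w : W, polar Q y w.1 = 0 := fun w => w.2.2
    let D : (W × (K × K)) →ₗ[K] E := W.subtype.coprod
      ((LinearMap.toSpanSingleton K E x).coprod (LinearMap.toSpanSingleton K E y))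
    have hD : ∀ p, D p = p.1.1 + (p.2.1 • x + p.2.2 • y) := fun p => rfl
    have hDbij : Function.Bijective D := by
      constructor
      · rw [← LinearMap.ker_eq_bot, LinearMap.ker_eq_bot']
        intro p hp
        rw [hD] at hp
        have h1 := congrArg (Q.polarBilin x) hp
        have h2 := congrArg (Q.polarBilin y) hp
        simp only [map_add, map_smul, map_zero, polarBilin_apply_apply, hWx, hWy, hxx, hyy, hxy, hyx,
          smul_eq_mul, mul_zero, mul_one, zero_add, add_zero] at h1 h2
        rw [h1, h2, zero_smul, zero_smul, add_zero, add_zero] at hp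
        exact Prod.ext (Subtype.ext hp) (Prod.ext h2 h1)
      · intro z
        refine ⟨(⟨z - (polar Q y z • x + polar Q x z • y), ?_, ?_⟩, (polar Q y z, polar Q x z)), ?_⟩
        · simp [hxx, hxy]
        · simp [hyy, hyx]
        · rw [hD]
          simp
    let D' := LinearEquiv.ofBijective D hDbij
    have hD' : ∀ p, D' p = p.1.1 + (p.2.1 • x + p.2.2 • y) := hD
    have hQ : ∀ p, Q (D' p) = Q.comp W.subtype p.1 + p.2.1 * p.2.2 := by
      intro p
      rw [hD', QuadraticMap.map_add (⇑Q), QuadraticMap.map_add (⇑Q), QuadraticMap.map_smul,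
        QuadraticMap.map_smul, hQx, hQy, polar_add_right, polar_smul_right, polar_smul_right,
        polar_smul_left, polar_smul_right, polar_comm Q p.1.1 x, polar_comm Q p.1.1 y, hWx,
        hWy, hxy]
      simp [mul_comm]
    have hfin : Module.finrank K W + 2 = m := by
      rw [← hm, ← D'.finrank_eq]
      simp
    have : Finite W := Module.finite_of_finite K
    have hZ := natCard_add_mul_zeros fun w : W => Q.comp W.subtype w
    rw [Nat.card_congr (D'.toEquiv.subtypeEquiv (q := fun z => Q z = 0) fun p => by
      change _ ↔ Q (D' p) = 0
      rw [hQ]), Module.natCard_eq_pow_finrank (K := K) (V := W)] at hZ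
    obtain ⟨M, r, e, h1, h2, h3⟩ := ih (Module.finrank K W) (by omega) rfl (Q.comp W.subtype) j (by
      rw [← hfin] at hcard
      refine Nat.eq_of_mul_eq_mul_right hqpos ?_
      obtain ⟨c, hc⟩ : ∃ c, Nat.card K - 1 = c := ⟨_, rfl⟩
      rw [hc] at hcard ⊢
      simp only [pow_succ] at hcard ⊢
      linear_combination hcard - Nat.card K * hZ)
    refine ⟨M + 1, r, (((Fin.consLinearEquiv K fun _ : Fin (M + 1) => K × K).symm.prodCongr
      (LinearEquiv.refl K _)).trans ((LinearEquiv.prodAssoc K _ _ _).trans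
        (LinearEquiv.prodComm K _ _))).trans ((e.prodCongr (LinearEquiv.refl K _)).trans D'),
      by omega, by omega, fun a => ?_⟩
    have h4 := h3 (Fin.tail a.1, a.2)
    refine (hQ (e (Fin.tail a.1, a.2), a.1 0)).trans ?_
    rw [h4, Fin.sum_univ_succ, add_comm]
    rfl

end FqHypersurface

end

noncomputable section

namespace FqHypersurface

variable {K : Type*} [Field K]

/-! ### Hyperbolic quadrics -/

theorem natCard_hyperbolic_zeros [Finite K] (M : ℕ) :
    Nat.card K * Nat.card {a : Fin M → K × K // ∑ i, (a i).1 * (a i).2 = 0} =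
      Nat.card K ^ (2 * M) + (Nat.card K - 1) * Nat.card K ^ M := by
  obtain ⟨c, hc⟩ : ∃ c, Nat.card K = c + 1 := ⟨Nat.card K - 1, by
    have := two_le_card (K := K)
    omega⟩
  have hc' : Nat.card K - 1 = c := by omega
  rw [hc']
  induction M with
  | zero =>
    have : Nat.card {a : Fin 0 → K × K // ∑ i, (a i).1 * (a i).2 = 0} = 1 := by
      rw [Nat.card_eq_one_iff_unique]
      exact ⟨⟨fun a b => Subtype.ext (Subsingleton.elim _ _)⟩, ⟨⟨0, by simp⟩⟩⟩
    rw [this]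
    simp [hc, add_comm]
  | succ M ih =>
    have h1 := natCard_add_mul_zeros (K := K) (W := Fin M → K × K)
      fun a => ∑ i, (a i).1 * (a i).2
    have e : {a : Fin (M + 1) → K × K // ∑ i, (a i).1 * (a i).2 = 0} ≃
        {p : (Fin M → K × K) × (K × K) // ∑ i, (p.1 i).1 * (p.1 i).2 + p.2.1 * p.2.2 = 0} :=
      ((Fin.consEquiv fun _ : Fin (M + 1) => K × K).symm.trans (Equiv.prodComm _ _)).subtypeEquiv
        fun a => by
          rw [Fin.sum_univ_succ, add_comm]
          rfl
    rw [← Nat.card_congr e, Nat.card_fun, Nat.card_prod, Nat.card_fin] at h1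
    generalize Nat.card {a : Fin (M + 1) → K × K // ∑ i, (a i).1 * (a i).2 = 0} = Z' at h1 ⊢
    generalize Nat.card {a : Fin M → K × K // ∑ i, (a i).1 * (a i).2 = 0} = Z at h1 ih
    have h2 : (Nat.card K * Nat.card K) ^ M = Nat.card K ^ (2 * M) := by rw [pow_mul, sq]
    rw [h2] at h1
    have h3 : Nat.card K ^ (2 * (M + 1)) = Nat.card K ^ (2 * M) * Nat.card K ^ 2 := by
      rw [← pow_add]
      congr 1
    rw [h3, pow_succ]
    zify at h1 ih ⊢
    linear_combination (Nat.card K : ℤ) * h1 + (Nat.card K : ℤ) * ih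

variable (K) in
/-- Grouping coordinates in consecutive pairs. -/
def pairEquiv (t : ℕ) : (Fin (2 * t + 2) → K) ≃ₗ[K] (Fin (t + 1) → K × K) :=
  LinearMap.linearEquivOfInjective
    (LinearMap.pi fun i : Fin (t + 1) =>
      (LinearMap.proj (⟨2 * (i : ℕ), by omega⟩ : Fin (2 * t + 2))).prod
        (LinearMap.proj (⟨2 * (i : ℕ) + 1, by omega⟩ : Fin (2 * t + 2))))
    (by
      rw [← LinearMap.ker_eq_bot, LinearMap.ker_eq_bot']
      intro x hx
      funext j
      have h1 := congrFun hx ⟨(j : ℕ) / 2, by omega⟩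
      have h2 : x ⟨2 * ((j : ℕ) / 2), _⟩ = 0 := congrArg Prod.fst h1
      have h3 : x ⟨2 * ((j : ℕ) / 2) + 1, _⟩ = 0 := congrArg Prod.snd h1
      rcases Nat.mod_two_eq_zero_or_one (j : ℕ) with h | h
      · rw [Pi.zero_apply, ← h2]
        congr 1
        ext
        simp only
        omega
      · rw [Pi.zero_apply, ← h3]
        congr 1
        ext
        simp only
        omega)
    (by
      have h := Module.finrank_pi_fintype K (M := fun _ : Fin (t + 1) => K × K)
      rw [h]
      simp
      ring)

theorem pairEquiv_apply (t : ℕ) (x : Fin (2 * t + 2) → K) (i : Fin (t + 1)) :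
    pairEquiv K t x i = (x ⟨2 * (i : ℕ), by omega⟩, x ⟨2 * (i : ℕ) + 1, by omega⟩) := rfl

theorem eval_hyperbolicForm (t : ℕ) (x : Fin (2 * t + 2) → K) :
    eval x (hyperbolicForm K t) = ∑ i, (pairEquiv K t x i).1 * (pairEquiv K t x i).2 := by
  simp [hyperbolicForm, pairEquiv_apply]

variable (K) in
theorem isHomogeneous_hyperbolicForm (t : ℕ) : (hyperbolicForm K t).IsHomogeneous 2 :=
  IsHomogeneous.sum _ _ _ fun _ _ => (isHomogeneous_X _ _).mul (isHomogeneous_X _ _)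

theorem natCard_hyperbolicForm_zeros [Finite K] (t : ℕ) :
    Nat.card K * Nat.card {x // eval x (hyperbolicForm K t) = 0} =
      Nat.card K ^ (2 * t + 2) + (Nat.card K - 1) * Nat.card K ^ (t + 1) := by
  refine Eq.trans ?_ (natCard_hyperbolic_zeros (K := K) (t + 1))
  congr 1
  refine Nat.card_congr ((pairEquiv K t).toEquiv.subtypeEquiv fun x => ?_)
  rw [eval_hyperbolicForm]
  rfl

/-- The quadratic form attached to a homogeneous polynomial of degree two. -/
def toQuadraticForm {N : ℕ} {F : MvPolynomial (Fin N) K} (hF : F.IsHomogeneous 2) :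
    QuadraticForm K (Fin N → K) :=
  have hpolar : ∀ x y, QuadraticMap.polar (fun z => eval z F) x y = differential F y x := by
    intro x y
    obtain ⟨c, h0, h2, h1, h⟩ := exists_binary_expansion hF x y
    have h3 := h 1 1
    simp only [one_smul, one_pow, mul_one, Finset.sum_range_succ, Finset.sum_range_zero,
      zero_add] at h3
    rw [QuadraticMap.polar, h3, h0, h2, ← (h1 le_rfl).2]
    ring
  QuadraticMap.ofPolar (fun z => eval z F)
    (fun a x => by rw [eval_smul_of_isHomogeneous hF, sq, smul_eq_mul])
    (fun x x' y => by rw [hpolar, hpolar, hpolar, map_add])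
    (fun a x y => by rw [hpolar, hpolar, map_smul])

theorem toQuadraticForm_apply {N : ℕ} {F : MvPolynomial (Fin N) K} (hF : F.IsHomogeneous 2)
    (x : Fin N → K) : toQuadraticForm hF x = eval x F := rfl

/-- From 2 M + r = n + 2 and M + r = k + 1 there are M = n + 1 - k ≥ 1 hyperbolic planes and a
vertex of dimension r - 1 = 2 k - n - 1. -/
theorem quadricCase_of_natCard [Finite K] {n k : ℕ} {F : MvPolynomial (Fin (n + 2)) K}
    (hF : F.IsHomogeneous 2) (hkn : k ≤ n)
    (hcard : Nat.card K * Nat.card {x // eval x F = 0} =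
      Nat.card K ^ (n + 2) + (Nat.card K - 1) * Nat.card K ^ (k + 1)) : QuadricCase F 2 k := by
  obtain ⟨M, r, e, hm, hj, he⟩ := exists_hyperbolic_decomposition (n + 2) (by simp)
    (toQuadraticForm hF) (k + 1) hcard
  obtain ⟨t, rfl⟩ : ∃ t, M = t + 1 := ⟨M - 1, by omega⟩
  refine ⟨rfl, (r : ℤ) - 1, by omega, by omega, by omega, t, by omega, ?_⟩
  refine projEquivCone_of_eval hF (two_le_card (K := K)) (isHomogeneous_hyperbolicForm K t)
    one_ne_zero (r := r) (by ring) (((pairEquiv K t).prodCongr (LinearEquiv.refl K _)).trans e)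
    fun a => ?_
  rw [one_mul, eval_hyperbolicForm, ← toQuadraticForm_apply hF, LinearEquiv.trans_apply, he]
  rfl

theorem QuadricCase.natCard_zeros [Finite K] {n d k : ℕ} {F : MvPolynomial (Fin (n + 2)) K}
    (h : QuadricCase F d k) : Nat.card K * Nat.card {x // eval x F = 0} =
      Nat.card K ^ (n + 2) + (Nat.card K - 1) * Nat.card K ^ (k + 1) := by
  obtain ⟨-, h, h1, h2, h3, t, h4, h5⟩ := h
  obtain ⟨r, h6, h7, h8⟩ := natCard_zeros_of_projEquivCone h5
  rw [h8, ← mul_assoc, natCard_hyperbolicForm_zeros, add_mul, mul_assoc, ← pow_add, ← pow_add, h7]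
  congr 3
  omega

end FqHypersurface

end

noncomputable section

namespace FqHypersurface

variable {K : Type*} [Field K]

/-! ### Hermitian hypersurfaces -/

theorem differential_eq_zero_iff {N : ℕ} {F : MvPolynomial (Fin N) K} {x : Fin N → K} :
    differential F x = 0 ↔ ∀ i, eval x (pderiv i F) = 0 := by
  constructor
  · intro h i
    have := LinearMap.congr_fun h (Pi.single i 1)
    rw [differential_apply] at this
    simpa [Pi.single_apply] using this
  · intro h
    ext i
    simp [differential_apply, h]

theorem eval_hermitianForm (m s : ℕ) (x : Fin (m + 2) → K) :
    eval x (hermitianForm K m s) = ∑ i, x i ^ (s + 1) := by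
  simp [hermitianForm]

variable (K) in
theorem isHomogeneous_hermitianForm (m s : ℕ) : (hermitianForm K m s).IsHomogeneous (s + 1) :=
  IsHomogeneous.sum _ _ _ fun i _ => by
    simpa using (isHomogeneous_X K i).pow (s + 1)

section

variable {n d k : ℕ} {F : MvPolynomial (Fin (n + 2)) K}

/-- The three subcases form one family with m = h - j and r the linear dimension of the vertex: r =
0, 2 j or 2 j + 1. -/
theorem HermitianCase.exists_cone [Finite K] (h : HermitianCase F d k) :
    ∃ s m r : ℕ, s ^ 2 = Nat.card K ∧ d = s + 1 ∧ k = m + r ∧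
      ProjEquivCone F ((r : ℤ) - 1) (hermitianForm K (2 * m) s) := by
  obtain ⟨s, hs, hd, ⟨h, h1, hn, hk1, hk2, ⟨-, hk, hF⟩ | ⟨-, h2, j, hj1, hj2, hk, hF⟩⟩ |
    ⟨h, h1, hn, hk1, hk2, j, hj, hk, hF⟩⟩ := h
  · exact ⟨s, h, 0, hs, hd, by omega, by simpa using hF⟩
  · refine ⟨s, h - j, 2 * j, hs, hd, by omega, ?_⟩
    rw [show 2 * (h - j) = 2 * h - 2 * j by omega]
    simpa using hF
  · refine ⟨s, h - j, 2 * j + 1, hs, hd, by omega, ?_⟩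
    rw [show 2 * (h - j) = 2 * h - 2 * j by omega]
    simpa using hF

theorem HermitianCase.natCard_zeros [Finite K] (h : HermitianCase F d k) :
    Nat.card {x // eval x F = 0} + (d - 1) * Nat.card K ^ k =
      (d - 1) * Nat.card K ^ (n + 1) + Nat.card K ^ (k + 1) := by
  obtain ⟨s, m, r, hs, rfl, rfl, hF⟩ := h.exists_cone
  obtain ⟨r', h1, h2, h3⟩ := natCard_zeros_of_projEquivCone hF
  obtain rfl : r' = r := by omega
  obtain rfl : n = 2 * m + r' := by omega
  have hs2 := two_le_of_sq_eq_card hs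
  have h4 := natCard_hermitian_zeros hs (2 * m + 2)
  simp only [eval_hermitianForm] at h3
  rw [h3, ← hs]
  rw [Even.neg_one_pow (by simp [parity_simps])] at h4
  generalize Nat.card {x : Fin (2 * m + 2) → K // ∑ i, x i ^ (s + 1) = 0} = Z at h4 ⊢
  have hs0 : (s : ℤ) ≠ 0 := by omega
  zify
  rw [Nat.add_sub_cancel]
  refine mul_left_cancel₀ hs0 ?_
  linear_combination ((s : ℤ) ^ 2) ^ r' * h4

/-- The rational singular points are those of the radical of the Hermitian form, whose dimension is
r. -/
theorem rationalSing_eq_empty_iff [Finite K] {M r s : ℕ} (hF : F.IsHomogeneous d)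
    {μ : K} (hμ : μ ≠ 0) (hself : ∀ x, eval x F = differential F x x) (hs : s ≠ 0)
    (e : ((Fin M → K) × (Fin r → K)) ≃ₗ[K] (Fin (n + 2) → K))
    (he : ∀ a b, differential F (e a) (e b) = μ * ∑ i, a.1 i ^ s * b.1 i) :
    rationalSing F = ∅ ↔ r = 0 := by
  constructor
  · intro h
    by_contra hr
    have hv : e (0, 1) ≠ 0 := by
      rw [Ne, LinearEquiv.map_eq_zero_iff, Prod.ext_iff]
      rintro ⟨-, h1⟩
      exact one_ne_zero (congrFun h1 ⟨0, by omega⟩)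
    have hv0 : differential F (e (0, 1)) = 0 := by
      refine LinearMap.ext fun y => ?_
      obtain ⟨b, rfl⟩ := e.surjective y
      rw [he]
      simp [hs]
    have hrep : differential F (Projectivization.mk K (e (0, 1)) hv).rep = 0 := by
      obtain ⟨a, ha⟩ := Projectivization.exists_smul_eq_mk_rep K (e (0, 1)) hv
      rw [← ha]
      refine LinearMap.ext fun y => ?_
      rw [Units.smul_def, differential_smul hF, hv0]
      simp
    have : Projectivization.mk K (e (0, 1)) hv ∈ rationalSing F := by
      refine ⟨?_, differential_eq_zero_iff.1 hrep⟩
      rw [hself, hrep, LinearMap.zero_apply]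
    rw [h] at this
    exact this
  · rintro rfl
    refine Set.eq_empty_of_forall_notMem fun P hP => P.rep_nonzero ?_
    have h1 := differential_eq_zero_iff.2 hP.2
    obtain ⟨a, ha⟩ := e.surjective P.rep
    rw [← ha] at h1 ⊢
    rw [LinearEquiv.map_eq_zero_iff]
    refine Prod.ext (funext fun i => ?_) (Subsingleton.elim _ _)
    have h2 := he a (Pi.single i 1, 0)
    rw [h1] at h2
    simpa [Pi.single_apply, hμ, hs] using h2

/-- Inserting the Hermitian count reduces equality to (-1) ^ M s ^ (M + 2 r) = s ^ (2 k + 2); the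
sign and the exponent give the two conclusions. -/
theorem exists_eq_of_natCard_hermitian_zeros [Finite K] {s M r Z : ℕ}
    (hs : s ^ 2 = Nat.card K) (hMr : M + r = n + 2)
    (hZ : Z = Nat.card {x : Fin M → K // ∑ i, x i ^ (s + 1) = 0} * Nat.card K ^ r)
    (hcard : Nat.card K * Z + s * Nat.card K ^ (k + 1) =
      Nat.card K * Nat.card K ^ (k + 1) + s * Nat.card K ^ (n + 2)) :
    Even M ∧ M + 2 * r = 2 * k + 2 := by
  have hs2 := two_le_of_sq_eq_card hs
  have h1 := natCard_hermitian_zeros hs M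
  generalize Nat.card {x : Fin M → K // ∑ i, x i ^ (s + 1) = 0} = Y at hZ h1
  rw [hZ, ← hs, ← hMr] at hcard
  zify at hcard
  have hs0 : (s : ℤ) ≠ 0 := by omega
  have hs1 : (s : ℤ) - 1 ≠ 0 := by omega
  have hs3 : (0 : ℤ) < s := by omega
  have h2 : (-1) ^ M * (s : ℤ) ^ (M + 2 * r) = (s : ℤ) ^ (2 * k + 2) := by
    refine mul_left_cancel₀ (mul_ne_zero hs0 hs1) ?_
    have h3 : ((s : ℤ) ^ 2) ^ (M + r) = s ^ (2 * M) * s ^ (2 * r) := by ring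
    have h4 : ((s : ℤ) ^ 2) ^ r = s ^ (2 * r) := by ring
    have h5 : ((s : ℤ) ^ 2) ^ (k + 1) = s ^ (2 * k + 2) := by ring
    have h6 : (s : ℤ) ^ (M + 2 * r) = s ^ M * s ^ (2 * r) := by ring
    rw [h3, h4, h5] at hcard
    rw [h6]
    linear_combination hcard - (s : ℤ) * s ^ (2 * r) * h1
  have hM : Even M := by
    by_contra hM
    rw [Nat.not_even_iff_odd] at hM
    rw [hM.neg_one_pow] at h2
    have h3 := pow_pos hs3 (M + 2 * r)
    have h4 := pow_pos hs3 (2 * k + 2)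
    omega
  refine ⟨hM, ?_⟩
  rw [hM.neg_one_pow, one_mul] at h2
  exact Nat.pow_right_injective hs2 (by exact_mod_cast h2)

theorem IsExtremal.hermitianCase [Finite K] {L : Submodule K (Fin (n + 2) → K)}
    (h : IsExtremal F d k) (hL : IsZeroSpace F k L) (hk : 1 ≤ k) (hkn : k + 1 ≤ n) (hd : 3 ≤ d) :
    HermitianCase F d k := by
  have hs := h.sub_one_sq_eq_card hL (by omega) hd
  obtain ⟨s, rfl⟩ : ∃ s, d = s + 1 := ⟨d - 1, by omega⟩
  rw [Nat.add_sub_cancel] at hs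
  obtain ⟨μ, hμ, hself, hH⟩ := h.exists_hermitian hL (by omega) hd
  rw [Nat.add_sub_cancel] at hH
  obtain ⟨M, r, e, he⟩ := exists_hermitian_diagonalization hs (n + 2) (by simp)
    (fun x => μ⁻¹ • differential F x) (fun x y => hH x y)
  have hdiff : ∀ a b, differential F (e a) (e b) = μ * ∑ i, a.1 i ^ s * b.1 i := by
    intro a b
    rw [← he, LinearMap.smul_apply, smul_eq_mul, mul_inv_cancel_left₀ hμ]
  have heval : ∀ a, eval (e a) F = μ * ∑ i, a.1 i ^ (s + 1) := by
    intro a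
    rw [hself, hdiff]
    simp only [pow_succ]
  have hMr : M + r = n + 2 := by simpa using e.finrank_eq
  have hZ : Nat.card {x // eval x F = 0} =
      Nat.card {x : Fin M → K // ∑ i, x i ^ (s + 1) = 0} * Nat.card K ^ r := by
    rw [← Nat.card_fin r, ← Nat.card_fun, ← Nat.card_prod]
    refine Nat.card_congr ((e.toEquiv.subtypeEquiv fun a => ?_).symm.trans
      (Equiv.prodSubtypeFstEquivSubtypeProd
        (p := fun x : Fin M → K => ∑ i, x i ^ (s + 1) = 0)))
    change _ ↔ eval (e a) F = 0
    rw [heval, mul_eq_zero, or_iff_right hμ]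
  have hcard := h.card_eq
  rw [Nat.add_sub_cancel] at hcard
  obtain ⟨hM, hMk⟩ := exists_eq_of_natCard_hermitian_zeros hs hMr hZ hcard
  obtain ⟨m, rfl⟩ : ∃ m, M = 2 * m + 2 := by
    obtain ⟨c, hc⟩ := hM
    exact ⟨c - 1, by omega⟩
  have hcone : ∀ l : ℤ, (r : ℤ) = l + 1 → ProjEquivCone F l (hermitianForm K (2 * m) s) :=
    fun l hl => projEquivCone_of_eval h.isHomogeneous h.le_card
      (isHomogeneous_hermitianForm K (2 * m) s) hμ hl e fun a => by
        rw [heval, eval_hermitianForm]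
  have hsing := rationalSing_eq_empty_iff h.isHomogeneous hμ hself (by omega) e hdiff
  refine ⟨s, hs, rfl, ?_⟩
  -- Now n = 2 m + r and k = m + r, so the parity of r is that of n; in both cases h = m + j.
  obtain ⟨j, hj⟩ := Nat.even_or_odd' r
  rcases hj with rfl | rfl
  · refine Or.inl ⟨m + j, by omega, by omega, by omega, by omega, ?_⟩
    rcases Nat.eq_zero_or_pos j with rfl | hj
    · exact Or.inl ⟨hsing.2 rfl, by omega, hcone _ (by simp)⟩
    · refine Or.inr ⟨fun h0 => ?_, by omega, j, by omega, by omega, by omega, ?_⟩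
      · have := hsing.1 h0
        omega
      · rw [show 2 * (m + j) - 2 * j = 2 * m by omega]
        exact hcone _ (by push_cast; ring)
  · refine Or.inr ⟨m + j, by omega, by omega, by omega, by omega, j, by omega, by omega, ?_⟩
    rw [show 2 * (m + j) - 2 * j = 2 * m by omega]
    exact hcone _ (by push_cast; ring)

end

end FqHypersurface

end

noncomputable section

namespace FqHypersurface

variable {K : Type*} [Field K]

/-! ### Unions of hyperplanes -/

/-- The extension of scalars of a linear form to the algebraic closure. -/
def geometricForm {N : ℕ} (ℓ : (Fin N → K) →ₗ[K] K) :
    (Fin N → AlgebraicClosure K) →ₗ[AlgebraicClosure K] AlgebraicClosure K :=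
  Fintype.linearCombination (AlgebraicClosure K)
    fun i => algebraMap K (AlgebraicClosure K) (ℓ (Pi.single i 1))

theorem geometricForm_apply {N : ℕ} (ℓ : (Fin N → K) →ₗ[K] K) (x : Fin N → AlgebraicClosure K) :
    geometricForm ℓ x = ∑ i, x i * algebraMap K (AlgebraicClosure K) (ℓ (Pi.single i 1)) := rfl

theorem apply_eq_sum_single {N : ℕ} (ℓ : (Fin N → K) →ₗ[K] K) (x : Fin N → K) :
    ℓ x = ∑ i, x i * ℓ (Pi.single i 1) := by
  conv_lhs => rw [← Finset.univ_sum_single x]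
  rw [map_sum]
  refine Finset.sum_congr rfl fun i _ => ?_
  rw [← smul_eq_mul, ← map_smul, ← Pi.single_smul, smul_eq_mul, mul_one]

theorem geometricForm_algebraMap {N : ℕ} (ℓ : (Fin N → K) →ₗ[K] K) (x : Fin N → K) :
    geometricForm ℓ (fun i => algebraMap K (AlgebraicClosure K) (x i)) =
      algebraMap K (AlgebraicClosure K) (ℓ x) := by
  rw [geometricForm_apply, apply_eq_sum_single ℓ x, map_sum]
  simp only [map_mul]

theorem geometricForm_sub_smul {N : ℕ} (ℓ m : (Fin N → K) →ₗ[K] K) (a : K)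
    (x : Fin N → AlgebraicClosure K) : geometricForm (ℓ - a • m) x =
      geometricForm ℓ x - algebraMap K (AlgebraicClosure K) a * geometricForm m x := by
  simp only [geometricForm_apply, LinearMap.sub_apply, LinearMap.smul_apply, smul_eq_mul, map_sub,
    map_mul, Finset.mul_sum, ← Finset.sum_sub_distrib]
  exact Finset.sum_congr rfl fun i _ => by ring

theorem geometricForm_eq_zero_of_mem {N : ℕ} {W : Submodule K (Fin N → K)}
    {ℓ : (Fin N → K) →ₗ[K] K} (h : ∀ w ∈ W, ℓ w = 0) {x : Fin N → AlgebraicClosure K}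
    (hx : x ∈ geometricSpan W) : geometricForm ℓ x = 0 := by
  have h1 : geometricSpan W ≤ LinearMap.ker (geometricForm ℓ) := by
    rw [geometricSpan, Submodule.span_le]
    rintro _ ⟨w, hw, rfl⟩
    rw [SetLike.mem_coe, LinearMap.mem_ker, geometricForm_algebraMap, h w hw, map_zero]
  exact h1 hx

theorem mem_geometricSpan_ker {N : ℕ} {ℓ : (Fin N → K) →ₗ[K] K} (hℓ : ℓ ≠ 0)
    {x : Fin N → AlgebraicClosure K} :
    x ∈ geometricSpan (LinearMap.ker ℓ) ↔ geometricForm ℓ x = 0 := by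
  refine ⟨geometricForm_eq_zero_of_mem fun w hw => hw, fun h => ?_⟩
  obtain ⟨u, hu⟩ := exists_apply_eq_one hℓ
  -- On the kernel, x is unchanged when each unit vector is replaced by its projection to ker ℓ
  -- along u, and these projections are rational.
  have h1 : x = ∑ i, x i • fun j => algebraMap K (AlgebraicClosure K)
      ((Pi.single i 1 - ℓ (Pi.single i 1) • u : Fin N → K) j) := by
    have h2 : ∀ j, x j = x j - geometricForm ℓ x * algebraMap K (AlgebraicClosure K) (u j) := by
      intro j
      rw [h, zero_mul, sub_zero]
    funext j
    rw [h2 j, geometricForm_apply, Finset.sum_apply]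
    simp only [Pi.smul_apply, Pi.sub_apply, smul_eq_mul, map_sub, map_mul, mul_sub,
      Finset.sum_sub_distrib, Finset.sum_mul, mul_assoc]
    congr 1
    rw [Finset.sum_eq_single j]
    · simp
    · intro i _ hij
      simp [hij.symm]
    · simp
  rw [h1]
  refine Submodule.sum_mem _ fun i _ => Submodule.smul_mem _ _ (Submodule.subset_span ?_)
  exact ⟨_, by simp [hu], rfl⟩

theorem algebraMap_mem_geometricSpan {N : ℕ} {W : Submodule K (Fin N → K)} {x : Fin N → K} :
    (fun i => algebraMap K (AlgebraicClosure K) (x i)) ∈ geometricSpan W ↔ x ∈ W := by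
  refine ⟨fun h => ?_, fun h => Submodule.subset_span ⟨x, h, rfl⟩⟩
  by_contra hx
  obtain ⟨ℓ, hℓ, hW⟩ := Submodule.exists_le_ker_of_notMem hx
  have h1 := geometricForm_eq_zero_of_mem (fun w hw => hW hw) h
  rw [geometricForm_algebraMap] at h1
  exact hℓ ((map_eq_zero _).1 h1)

theorem aeval_algebraMap {N : ℕ} (F : MvPolynomial (Fin N) K) (x : Fin N → K) :
    aeval (fun i => algebraMap K (AlgebraicClosure K) (x i)) F =
      algebraMap K (AlgebraicClosure K) (eval x F) := by
  have := aeval_algebraMap_apply (AlgebraicClosure K) x F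
  rwa [aeval_eq_eval] at this

/-- If `T` and `Φ` are independent linear forms and the geometric zero set of `F` is given by
`T * ∏ i, (Φ - a i * T)`, then it is a union of hyperplanes through a common subspace. -/
theorem isUnionOfHyperplanes_of_aeval_eq_zero_iff {N m : ℕ} {F : MvPolynomial (Fin N) K}
    {T Φ : (Fin N → K) →ₗ[K] K} {u v : Fin N → K} (hTu : T u = 1) (hTv : T v = 0) (hΦu : Φ u = 0)
    (hΦv : Φ v = 1) {a : Fin m → K} (ha : Function.Injective a)
    (h : ∀ x : Fin N → AlgebraicClosure K, aeval x F = 0 ↔ geometricForm T x = 0 ∨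
      ∃ i, geometricForm Φ x = algebraMap K (AlgebraicClosure K) (a i) * geometricForm T x) :
    IsUnionOfHyperplanesThroughCodimTwo F (m + 1) := by
  let ℓ : Fin (m + 1) → ((Fin N → K) →ₗ[K] K) := Fin.cons T fun i => Φ - a i • T
  have hℓ0 : ℓ 0 = T := rfl
  have hℓs : ∀ i : Fin m, ℓ i.succ = Φ - a i • T := fun i => rfl
  have hℓ : ∀ i, ℓ i ≠ 0 := by
    refine Fin.cases (fun h0 => ?_) fun i h0 => ?_
    · rw [hℓ0] at h0
      simp [h0] at hTu
    · have := LinearMap.congr_fun h0 v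
      simp [hℓs, hTv, hΦv] at this
  refine ⟨LinearMap.ker (T.prod Φ), fun i => LinearMap.ker (ℓ i), ?_, ?_, fun i => ⟨?_, ?_⟩,
    fun x => ?_⟩
  · have h1 : LinearMap.range (T.prod Φ) = ⊤ := by
      rw [LinearMap.range_eq_top]
      intro p
      refine ⟨p.1 • u + p.2 • v, ?_⟩
      ext <;> simp [hTu, hTv, hΦu, hΦv]
    have h2 := LinearMap.finrank_range_add_finrank_ker (T.prod Φ)
    rw [h1] at h2
    simp at h2
    omega
  · have h0 : ∀ i : Fin m, LinearMap.ker (ℓ 0) ≠ LinearMap.ker (ℓ i.succ) := by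
      intro i hi
      have : v ∈ LinearMap.ker (ℓ i.succ) := by
        rw [← hi, hℓ0]
        exact hTv
      rw [hℓs] at this
      simp [hTv, hΦv] at this
    intro i j hij
    induction i using Fin.cases with
    | zero =>
      induction j using Fin.cases with
      | zero => rfl
      | succ j => exact absurd hij (h0 j)
    | succ i =>
      induction j using Fin.cases with
      | zero => exact absurd hij.symm (h0 i)
      | succ j =>
        have : u + a i • v ∈ LinearMap.ker (ℓ j.succ) := by
          rw [← show LinearMap.ker (ℓ i.succ) = LinearMap.ker (ℓ j.succ) from hij, hℓs]
          simp [hTu, hTv, hΦu, hΦv]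
        rw [hℓs] at this
        simp [hTu, hTv, hΦu, hΦv, sub_eq_zero] at this
        rw [ha this]
  · have := Module.Dual.finrank_ker_add_one_of_ne_zero (hℓ i)
    simpa using this
  · intro x hx
    rw [LinearMap.mem_ker, LinearMap.prod_apply, Function.prod, Prod.mk_eq_zero] at hx
    rw [LinearMap.mem_ker]
    induction i using Fin.cases with
    | zero => exact hx.1
    | succ i => simp [hℓs, hx]
  · rw [h, Fin.exists_fin_succ]
    simp only [mem_geometricSpan_ker (hℓ _)]
    rw [hℓ0]
    simp only [hℓs, geometricForm_sub_smul, sub_eq_zero]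

theorem IsUnionOfHyperplanesThroughCodimTwo.natCard_zeros [Finite K] {n d : ℕ} (hd : 1 ≤ d)
    {F : MvPolynomial (Fin (n + 2)) K} (h : IsUnionOfHyperplanesThroughCodimTwo F d) :
    Nat.card {x // eval x F = 0} + (d - 1) * Nat.card K ^ n =
      (d - 1) * Nat.card K ^ (n + 1) + Nat.card K ^ (n + 1) := by
  classical
  have := Fintype.ofFinite K
  obtain ⟨W, H, hW, hinj, hH, hF⟩ := h
  have hzero : ∀ x, eval x F = 0 ↔ ∃ i, x ∈ H i := by
    intro x
    have h1 := hF fun i => algebraMap K (AlgebraicClosure K) (x i)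
    rw [aeval_algebraMap, map_eq_zero] at h1
    simpa only [algebraMap_mem_geometricSpan] using h1
  have hcap : ∀ i j, i ≠ j → H i ⊓ H j = W := by
    intro i j hij
    refine (Submodule.eq_of_le_of_finrank_le (le_inf (hH i).2 (hH j).2) ?_).symm
    have h1 : H i ⊓ H j < H i := by
      refine lt_of_le_of_ne inf_le_left fun h => hij (hinj ?_)
      refine Submodule.eq_of_le_of_finrank_le (inf_eq_left.1 h) ?_
      have h2 := (hH i).1
      have h3 := (hH j).1
      omega
    have h2 := Submodule.finrank_lt_finrank_of_lt h1
    have h3 := (hH i).1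
    omega
  let S : Submodule K (Fin (n + 2) → K) → Finset (Fin (n + 2) → K) :=
    fun U => Finset.univ.filter (· ∈ U)
  have hS : ∀ (U : Submodule K (Fin (n + 2) → K)) x, x ∈ S U ↔ x ∈ U := fun U x => by simp [S]
  have hcard : ∀ U, (S U).card = Nat.card K ^ Module.finrank K U := by
    intro U
    rw [← Module.natCard_eq_pow_finrank (K := K), Nat.card_eq_fintype_card]
    exact (Fintype.card_of_subtype (S U) (hS U)).symm
  -- Distinct hyperplanes meet only in W, so the zeros are the disjoint union of W and the d sets H
  -- i minus W.
  have hZ : Nat.card {x // eval x F = 0} =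
      (S W ∪ Finset.univ.biUnion fun i => S (H i) \ S W).card := by
    rw [Nat.card_eq_fintype_card]
    refine Fintype.card_of_subtype _ fun x => ?_
    rw [hzero]
    simp only [Finset.mem_union, Finset.mem_biUnion, Finset.mem_univ, true_and, Finset.mem_sdiff, hS]
    constructor
    · rintro (hx | ⟨i, hx, -⟩)
      · exact ⟨⟨0, hd⟩, (hH _).2 hx⟩
      · exact ⟨i, hx⟩
    · rintro ⟨i, hx⟩
      by_cases hxW : x ∈ W
      · exact Or.inl hxW
      · exact Or.inr ⟨i, hx, hxW⟩
  rw [Finset.card_union_of_disjoint, Finset.card_biUnion] at hZ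
  · have h1 : ∀ i, (S (H i) \ S W).card = Nat.card K ^ (n + 1) - Nat.card K ^ n := by
      intro i
      have h2 : S W ⊆ S (H i) := fun x hx => (hS _ _).2 ((hH i).2 ((hS _ _).1 hx))
      rw [Finset.card_sdiff_of_subset h2, hcard, hcard]
      have h3 := (hH i).1
      rw [show Module.finrank K (H i) = n + 1 by omega, show Module.finrank K W = n by omega]
    rw [Finset.sum_congr rfl fun i _ => h1 i, hcard, show Module.finrank K W = n by omega] at hZ
    simp only [Finset.sum_const, Finset.card_univ, Fintype.card_fin, smul_eq_mul] at hZ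
    obtain ⟨c, rfl⟩ : ∃ c, d = c + 1 := ⟨d - 1, by omega⟩
    have h4 : Nat.card K ^ n ≤ Nat.card K ^ (n + 1) :=
      Nat.pow_le_pow_right (Nat.card_pos) (by omega)
    obtain ⟨b, hb⟩ := Nat.exists_eq_add_of_le h4
    rw [hZ, Nat.add_sub_cancel, hb, Nat.add_sub_cancel_left]
    ring
  · intro i _ j _ hij
    rw [Function.onFun, Finset.disjoint_left]
    intro x hx hx'
    simp only [Finset.mem_sdiff, hS] at hx hx'
    exact hx.2 (by rw [← hcap i j hij]; exact ⟨hx.1, hx'.1⟩)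
  · rw [Finset.disjoint_left]
    intro x hx hx'
    simp only [Finset.mem_biUnion, Finset.mem_sdiff] at hx'
    obtain ⟨i, -, -, h⟩ := hx'
    exact h hx

end FqHypersurface

end

/-! ### Extremal forms with k = n, alternating matrices, Frobenius on the algebraic closure -/

noncomputable section

namespace FqHypersurface

variable {K : Type*} [Field K]

/-- The linear form `ℓ` as a homogeneous polynomial of degree one. -/
def linearPolynomial {N : ℕ} (ℓ : (Fin N → K) →ₗ[K] K) : MvPolynomial (Fin N) K :=
  ∑ i, C (ℓ (Pi.single i 1)) * X i

theorem isHomogeneous_linearPolynomial {N : ℕ} (ℓ : (Fin N → K) →ₗ[K] K) :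
    (linearPolynomial ℓ).IsHomogeneous 1 :=
  IsHomogeneous.sum _ _ _ fun _ _ => isHomogeneous_C_mul_X _ _

theorem eval_linearPolynomial {N : ℕ} (ℓ : (Fin N → K) →ₗ[K] K) (x : Fin N → K) :
    eval x (linearPolynomial ℓ) = ℓ x := by
  rw [apply_eq_sum_single ℓ x]
  simp [linearPolynomial, mul_comm]

theorem aeval_linearPolynomial {N : ℕ} (ℓ : (Fin N → K) →ₗ[K] K)
    (x : Fin N → AlgebraicClosure K) : aeval x (linearPolynomial ℓ) = geometricForm ℓ x := by
  rw [geometricForm_apply]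
  simp [linearPolynomial, mul_comm]

theorem exists_dual_of_finrank_add_one {N : ℕ} {L : Submodule K (Fin N → K)}
    (hL : Module.finrank K L + 1 = N) :
    ∃ (T : (Fin N → K) →ₗ[K] K) (u : Fin N → K), T u = 1 ∧ LinearMap.ker T = L := by
  obtain ⟨u, hu⟩ : ∃ u, u ∉ L := by
    by_contra! h
    have : L = ⊤ := by
      ext x
      simp [h x]
    rw [this] at hL
    simp at hL
  obtain ⟨ℓ, hℓ, hLℓ⟩ := Submodule.exists_le_ker_of_notMem hu
  have hT : ((ℓ u)⁻¹ • ℓ) u = 1 := by simp [hℓ]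
  refine ⟨(ℓ u)⁻¹ • ℓ, u, hT, ?_⟩
  refine (Submodule.eq_of_le_of_finrank_le (fun x hx => ?_) ?_).symm
  · have : ℓ x = 0 := hLℓ hx
    simp [this]
  · have h0 : (ℓ u)⁻¹ • ℓ ≠ 0 := fun h => by
      rw [h] at hT
      simp at hT
    have h1 := Module.Dual.finrank_ker_add_one_of_ne_zero h0
    simp only [Module.finrank_fintype_fun_eq_card, Fintype.card_fin] at h1
    omega

/-- L is the kernel of a linear form T, so the factorization along L describes F at all rational
points; d ≤ q turns it into a polynomial identity valid over the closure. -/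
theorem IsExtremal.isUnionOfHyperplanes [Finite K] {n d : ℕ} {F : MvPolynomial (Fin (n + 2)) K}
    {L : Submodule K (Fin (n + 2) → K)} (h : IsExtremal F d n) (hL : IsZeroSpace F n L) :
    IsUnionOfHyperplanesThroughCodimTwo F d := by
  obtain ⟨T, u, hTu, rfl⟩ := exists_dual_of_finrank_add_one
    (show Module.finrank K L + 1 = n + 2 by rw [hL.finrank_eq])
  have hu : u ∉ LinearMap.ker T := by simp [hTu]
  obtain ⟨φ, α, a, hφ, hα, ha, hfac, -⟩ := h.exists_factorization hL hu
  let π : (Fin (n + 2) → K) →ₗ[K] LinearMap.ker T :=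
    LinearMap.codRestrict _ (LinearMap.id - T.smulRight u) fun x => by simp [hTu]
  have hπ : ∀ x, (π x).1 = x - T x • u := fun x => rfl
  let Φ := φ ∘ₗ π
  have heval : ∀ x, eval x F = α * T x * ∏ i, (Φ x - a i * T x) := by
    intro x
    have h1 := hfac (π x) (T x)
    rw [hπ, add_sub_cancel] at h1
    exact h1
  have hpoly : F = C α * linearPolynomial T *
      ∏ i, (linearPolynomial Φ - C (a i) * linearPolynomial T) := by
    have hT1 := isHomogeneous_linearPolynomial T
    have hΦ1 := isHomogeneous_linearPolynomial Φ
    have hG : (C α * linearPolynomial T *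
        ∏ i, (linearPolynomial Φ - C (a i) * linearPolynomial T)).IsHomogeneous d := by
      have h1 := (hT1.C_mul α).mul (IsHomogeneous.prod Finset.univ _ (fun _ => 1)
        fun i (_ : i ∈ Finset.univ) => hΦ1.sub (hT1.C_mul (a i)))
      have h2 : 1 + ∑ _i : Fin (d - 1), 1 = d := by
        have := h.two_le
        simp
        omega
      rwa [h2] at h1
    refine h.isHomogeneous.funext_of_le_card hG (fun x => ?_) (natCast_le_mk h.le_card)
    simp only [map_mul, map_prod, map_sub, eval_C, eval_linearPolynomial, heval]
  obtain ⟨v, hv⟩ := exists_apply_eq_one hφ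
  have hTv : T v.1 = 0 := v.2
  have hd := h.two_le
  obtain ⟨m, rfl⟩ : ∃ m, d = m + 1 := ⟨d - 1, by omega⟩
  refine isUnionOfHyperplanes_of_aeval_eq_zero_iff (T := T) (Φ := Φ) (u := u) (v := v.1) hTu hTv
    ?_ ?_ ha fun x => ?_
  · have : π u = 0 := Subtype.ext (by simp [hπ, hTu])
    simp [Φ, this]
  · have : π v.1 = v := Subtype.ext (by simp [hπ, hTv])
    simp [Φ, this, hv]
  · rw [hpoly]
    simp only [map_mul, map_prod, map_sub, aeval_linearPolynomial, aeval_C, mul_eq_zero,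
      Finset.prod_eq_zero_iff, Finset.mem_univ, true_and, sub_eq_zero, map_eq_zero, hα, false_or]
    rfl

/-! ### Alternating matrices -/

/-- The terms (i, j) and (j, i) cancel; the diagonal must be assumed zero because of characteristic
2. -/
theorem dotProduct_mulVec_self {R ι : Type*} [CommRing R] [Fintype ι]
    {A : Matrix ι ι R} (hA : A.transpose = -A) (hA0 : ∀ i, A i i = 0) (x : ι → R) :
    x ⬝ᵥ A.mulVec x = 0 := by
  classical
  have h1 : x ⬝ᵥ A.mulVec x = ∑ p : ι × ι, x p.1 * (A p.1 p.2 * x p.2) := by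
    rw [Fintype.sum_prod_type]
    simp only [dotProduct, Matrix.mulVec, Finset.mul_sum]
  rw [h1]
  refine Finset.sum_involution (fun p _ => p.swap) (fun p _ => ?_) (fun p _ h => ?_)
    (fun _ _ => Finset.mem_univ _) fun _ _ => Prod.swap_swap _
  · have h2 : A p.2 p.1 = -A p.1 p.2 := congrFun (congrFun hA p.1) p.2
    simp only [Prod.fst_swap, Prod.snd_swap, h2]
    ring
  · intro h2
    have h3 : p.2 = p.1 := congrArg Prod.fst h2
    rw [h3, hA0] at h
    simp at h

/-- The identity det A = -det A says nothing in characteristic 2. Instead the Leibniz terms of σ and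
σ⁻¹ cancel, and an involution of a set of odd size has a fixed point, which brings in a diagonal
entry. -/
theorem det_eq_zero_of_odd {R ι : Type*} [CommRing R] [Fintype ι] [DecidableEq ι]
    {A : Matrix ι ι R} (hA : A.transpose = -A) (hA0 : ∀ i, A i i = 0) (hodd : Odd (Fintype.card ι)) :
    A.det = 0 := by
  rw [Matrix.det_apply]
  have hA' : ∀ i j, A j i = -A i j := fun i j => congrFun (congrFun hA i) j
  refine Finset.sum_involution (fun σ _ => σ⁻¹) (fun σ _ => ?_) (fun σ _ h h' => h ?_)
    (fun _ _ => Finset.mem_univ _) fun _ _ => inv_inv _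
  · have h1 : ∏ i, A (σ⁻¹ i) i = -∏ i, A (σ i) i := by
      rw [← Equiv.prod_comp σ fun i => A (σ⁻¹ i) i, Finset.prod_congr rfl fun i _ =>
        show A (σ⁻¹ (σ i)) (σ i) = -A (σ i) i by
          rw [show σ⁻¹ (σ i) = i from σ.symm_apply_apply i, hA'], Finset.prod_neg, Finset.card_univ,
        hodd.neg_one_pow, neg_one_mul]
    rw [Equiv.Perm.sign_inv, h1, smul_neg, add_neg_cancel]
  · have h1 : σ ^ 2 ^ 1 = 1 := by
      rw [pow_one, sq]
      nth_rewrite 1 [← h']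
      exact inv_mul_cancel σ
    have : Fact (Nat.Prime 2) := ⟨Nat.prime_two⟩
    obtain ⟨i, hi⟩ := Equiv.Perm.exists_fixed_point_of_prime
      (by rw [← even_iff_two_dvd, Nat.not_even_iff_odd]; exact hodd) h1
    rw [Finset.prod_eq_zero (Finset.mem_univ i) (by rw [hi, hA0]), smul_zero]

/-! ### The Frobenius on the algebraic closure -/

section Frobenius

variable [Finite K]

theorem pow_natCard (a : K) : a ^ Nat.card K = a := by
  have := Fintype.ofFinite K
  rw [Nat.card_eq_fintype_card, FiniteField.pow_card]

theorem natCast_natCard : (Nat.card K : K) = 0 := by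
  have := Fintype.ofFinite K
  rw [Nat.card_eq_fintype_card, FiniteField.cast_card_eq_zero]

theorem algebraMap_pow_natCard (a : K) :
    algebraMap K (AlgebraicClosure K) a ^ Nat.card K = algebraMap K (AlgebraicClosure K) a := by
  rw [← map_pow, pow_natCard]

theorem sum_pow_natCard {ι : Type*} (s : Finset ι) (f : ι → AlgebraicClosure K) :
    (∑ i ∈ s, f i) ^ Nat.card K = ∑ i ∈ s, f i ^ Nat.card K := by
  have := Fintype.ofFinite K
  rw [Nat.card_eq_fintype_card]
  exact map_sum (FiniteField.frobeniusAlgHom K (AlgebraicClosure K)) f s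

theorem add_pow_natCard (a b : AlgebraicClosure K) :
    (a + b) ^ Nat.card K = a ^ Nat.card K + b ^ Nat.card K := by
  have := Fintype.ofFinite K
  rw [Nat.card_eq_fintype_card]
  exact map_add (FiniteField.frobeniusAlgHom K (AlgebraicClosure K)) a b

theorem exists_eq_algebraMap_of_pow_natCard {τ : AlgebraicClosure K} (h : τ ^ Nat.card K = τ) :
    ∃ a : K, τ = algebraMap K (AlgebraicClosure K) a := by
  classical
  have := Fintype.ofFinite K
  by_contra! hτ
  let S : Finset (AlgebraicClosure K) :=
    insert τ (Finset.univ.image (algebraMap K (AlgebraicClosure K)))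
  have hS : S.card = Nat.card K + 1 := by
    rw [Finset.card_insert_of_notMem, Finset.card_image_of_injective _ (algebraMap K _).injective,
      Finset.card_univ, Nat.card_eq_fintype_card]
    simp only [Finset.mem_image, Finset.mem_univ, true_and, not_exists]
    exact fun a ha => hτ a ha.symm
  have hq := two_le_card (K := K)
  have hP := FiniteField.X_pow_card_sub_X_ne_zero (AlgebraicClosure K) (p := Nat.card K) (by omega)
  have h1 := Polynomial.card_le_degree_of_subset_roots (p := (Polynomial.X ^ Nat.card K -
    Polynomial.X : Polynomial (AlgebraicClosure K))) (Z := S) (by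
      intro x hx
      rw [Finset.mem_val] at hx
      rw [Polynomial.mem_roots hP, Polynomial.IsRoot]
      simp only [Polynomial.eval_sub, Polynomial.eval_pow, Polynomial.eval_X, sub_eq_zero]
      rcases Finset.mem_insert.1 hx with rfl | hx
      · exact h
      · obtain ⟨a, -, rfl⟩ := Finset.mem_image.1 hx
        exact algebraMap_pow_natCard a)
  rw [hS, FiniteField.X_pow_card_sub_X_natDegree_eq _ (by omega)] at h1
  omega

variable (K) in
theorem exists_pow_natCard_ne : ∃ τ : AlgebraicClosure K, τ ^ Nat.card K ≠ τ := by
  by_contra! h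
  have : Function.Surjective (algebraMap K (AlgebraicClosure K)) := fun τ => by
    obtain ⟨a, ha⟩ := exists_eq_algebraMap_of_pow_natCard (h τ)
    exact ⟨a, ha.symm⟩
  have := Finite.of_surjective _ this
  exact not_finite (AlgebraicClosure K)

end Frobenius

end FqHypersurface

end

noncomputable section

namespace FqHypersurface

variable {K : Type*} [Field K]

/-! ### Frobenius forms -/

section FrobeniusForm

variable {N : ℕ}

theorem aeval_frobeniusForm (A : Matrix (Fin N) (Fin N) K) (x : Fin N → AlgebraicClosure K) :
    aeval x (frobeniusForm A) = ∑ i, ∑ j,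
      algebraMap K (AlgebraicClosure K) (A i j) * x i * x j ^ Nat.card K := by
  simp [frobeniusForm]

variable [Finite K]

theorem eval_frobeniusForm (A : Matrix (Fin N) (Fin N) K) (x : Fin N → K) :
    eval x (frobeniusForm A) = x ⬝ᵥ A.mulVec x := by
  simp only [frobeniusForm, map_sum, map_mul, map_pow, eval_C, eval_X, pow_natCard, dotProduct,
    Matrix.mulVec, Finset.mul_sum]
  exact Finset.sum_congr rfl fun i _ => Finset.sum_congr rfl fun j _ => by ring

theorem pderiv_frobeniusForm (A : Matrix (Fin N) (Fin N) K) (i : Fin N) :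
    pderiv i (frobeniusForm A) = ∑ j, C (A i j) * X j ^ Nat.card K := by
  have h0 : ((Nat.card K : ℕ) : MvPolynomial (Fin N) K) = 0 := by
    rw [← map_natCast (C : K →+* MvPolynomial (Fin N) K), natCast_natCard, map_zero]
  have h1 : ∀ l j, pderiv i (C (A l j) * X l * X j ^ Nat.card K : MvPolynomial (Fin N) K) =
      if l = i then C (A l j) * X j ^ Nat.card K else 0 := by
    intro l j
    rw [mul_assoc, pderiv_C_mul, Derivation.leibniz, Derivation.leibniz_pow, nsmul_eq_mul, h0,
      zero_mul, smul_zero, zero_add]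
    split_ifs with h
    · rw [h, pderiv_X_self, smul_eq_mul, mul_one]
    · rw [pderiv_X_of_ne h, smul_zero, mul_zero]
  rw [frobeniusForm]
  simp only [map_sum, h1]
  rw [Finset.sum_comm]
  simp

theorem aeval_pderiv_frobeniusForm (A : Matrix (Fin N) (Fin N) K) (i : Fin N)
    (x : Fin N → AlgebraicClosure K) : aeval x (pderiv i (frobeniusForm A)) =
      (A.map (algebraMap K (AlgebraicClosure K))).mulVec (fun j => x j ^ Nat.card K) i := by
  rw [pderiv_frobeniusForm]
  simp [Matrix.mulVec, dotProduct]

/-- The gradient at x is A applied to the vector of q-th powers. A rational kernel vector is fixed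
by Frobenius and lies on the hypersurface, hence is singular; conversely A stays invertible over the
closure. -/
theorem nonsingular_frobeniusForm_iff {A : Matrix (Fin N) (Fin N) K}
    (hA : A.transpose = -A) (hA0 : ∀ i, A i i = 0) : Nonsingular (frobeniusForm A) ↔ A.det ≠ 0 := by
  have hq := two_le_card (K := K)
  constructor
  · intro h hdet
    obtain ⟨v, hv0, hv⟩ := Matrix.exists_mulVec_eq_zero_iff.2 hdet
    obtain ⟨i, hi⟩ := h (fun i => algebraMap K (AlgebraicClosure K) (v i))
      (fun h0 => hv0 (funext fun i => (map_eq_zero _).1 (congrFun h0 i)))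
      (by rw [aeval_algebraMap, eval_frobeniusForm, dotProduct_mulVec_self hA hA0, map_zero])
    apply hi
    rw [aeval_pderiv_frobeniusForm]
    simp only [algebraMap_pow_natCard]
    have h1 := RingHom.map_mulVec (algebraMap K (AlgebraicClosure K)) A v i
    rw [hv, Pi.zero_apply, map_zero] at h1
    exact h1.symm
  · intro hdet x hx0 _
    by_contra! h
    simp only [aeval_pderiv_frobeniusForm] at h
    have h1 : (A.map (algebraMap K (AlgebraicClosure K))).det ≠ 0 := by
      rw [← RingHom.mapMatrix_apply, ← RingHom.map_det]
      simpa using hdet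
    refine h1 (Matrix.exists_mulVec_eq_zero_iff.1 ⟨fun j => x j ^ Nat.card K, fun h2 => hx0 ?_,
      funext h⟩)
    exact funext fun j => eq_zero_of_pow_eq_zero (congrFun h2 j)

/-- On the line x + w y the end coefficients vanish and w ^ q = w. The resulting polynomial of
degree less than q vanishes everywhere, and its coefficient at w is c 1 + c q, the sum of the two
mixed differentials. -/
theorem differential_eq_neg_of_forall_eval_eq_zero {F : MvPolynomial (Fin N) K}
    (hF : F.IsHomogeneous (Nat.card K + 1)) (h0 : ∀ x, eval x F = 0) (x y : Fin N → K) :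
    differential F x y = -differential F y x := by
  have := Fintype.ofFinite K
  have hq := two_le_card (K := K)
  obtain ⟨c, hc0, hc1, hc, hexp⟩ := exists_binary_expansion hF x y
  obtain ⟨h1, h2⟩ := hc (by omega)
  rw [Nat.add_sub_cancel] at h2
  rw [← h1, ← h2]
  let P : Polynomial K := ∑ j ∈ Finset.range (Nat.card K),
    Polynomial.C (c j) * Polynomial.X ^ j + Polynomial.C (c (Nat.card K)) * Polynomial.X
  have hdeg : P.natDegree < Nat.card K := by
    suffices P.natDegree ≤ Nat.card K - 1 by omega
    refine Polynomial.natDegree_le_iff_degree_le.2 ?_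
    refine (Polynomial.degree_add_le _ _).trans (max_le ?_ ?_)
    · refine (Polynomial.degree_sum_le _ _).trans (Finset.sup_le fun j hj => ?_)
      refine (Polynomial.degree_C_mul_X_pow_le _ _).trans ?_
      have := Finset.mem_range.1 hj
      exact_mod_cast (by omega : j ≤ Nat.card K - 1)
    · refine (Polynomial.degree_C_mul_X_le _).trans ?_
      exact_mod_cast (by omega : 1 ≤ Nat.card K - 1)
  have hP : P = 0 := by
    refine Polynomial.eq_zero_of_natDegree_lt_card_of_eval_eq_zero P
      (f := fun a : K => a) Function.injective_id (fun w => ?_)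
      (by rwa [← Nat.card_eq_fintype_card])
    have h3 := hexp 1 w
    rw [h0, Finset.sum_range_succ, Finset.sum_range_succ, hc1, h0] at h3
    simp only [one_pow, mul_one, zero_mul, add_zero, pow_natCard] at h3
    simp only [P, Polynomial.eval_add, Polynomial.eval_finsetSum, Polynomial.eval_mul,
      Polynomial.eval_C, Polynomial.eval_pow, Polynomial.eval_X]
    exact h3.symm
  have h3 := congrArg (fun p => Polynomial.coeff p 1) hP
  simp only [P, Polynomial.coeff_add, Polynomial.finsetSum_coeff, Polynomial.coeff_C_mul,
    Polynomial.coeff_X_pow, Polynomial.coeff_X_one, Polynomial.coeff_zero, mul_ite, mul_one,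
    mul_zero, Finset.sum_ite_eq, Finset.mem_range] at h3
  rw [if_pos (by omega)] at h3
  exact eq_neg_of_add_eq_zero_left h3

/-- By skewness each partial derivative of F is linear on rational points. Being a form of degree q,
it is determined by its values and equals the corresponding combination of q-th powers. Euler's
identity recovers F, since q + 1 = 1 in `K`. -/
theorem exists_eq_frobeniusForm {F : MvPolynomial (Fin N) K}
    (hF : F.IsHomogeneous (Nat.card K + 1)) (h0 : ∀ x, eval x F = 0) :
    ∃ A : Matrix (Fin N) (Fin N) K, A.transpose = -A ∧ (∀ i, A i i = 0) ∧ F = frobeniusForm A := by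
  have hskew := differential_eq_neg_of_forall_eval_eq_zero hF h0
  let A : Matrix (Fin N) (Fin N) K :=
    Matrix.of fun i j => differential F (Pi.single j 1) (Pi.single i 1)
  have hA : ∀ i j, A i j = differential F (Pi.single j 1) (Pi.single i 1) := fun i j => rfl
  have hsingle : ∀ x i, eval x (pderiv i F) = differential F x (Pi.single i 1) := by
    intro x i
    rw [differential_apply]
    simp [Pi.single_apply]
  have hpd : ∀ i, pderiv i F = ∑ j, C (A i j) * X j ^ Nat.card K := by
    intro i
    have h1 : (∑ j, C (A i j) * X j ^ Nat.card K : MvPolynomial (Fin N) K).IsHomogeneous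
        (Nat.card K) := IsHomogeneous.sum _ _ _ fun j _ => by
      simpa using ((isHomogeneous_X K j).pow (Nat.card K)).C_mul (A i j)
    have h2 : (pderiv i F).IsHomogeneous (Nat.card K) := hF.pderiv
    refine h2.funext_of_le_card h1 (fun x => ?_) (natCast_le_mk le_rfl)
    simp only [map_sum, map_mul, map_pow, eval_C, eval_X, pow_natCard]
    rw [hsingle, hskew, apply_eq_sum_single, ← Finset.sum_neg_distrib]
    refine Finset.sum_congr rfl fun j _ => ?_
    rw [hA, hskew (Pi.single j 1)]
    ring
  refine ⟨A, ?_, fun i => ?_, ?_⟩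
  · ext i j
    exact hskew _ _
  · rw [hA, differential_self hF, h0, mul_zero]
  · have h1 := hF.sum_X_mul_pderiv
    have h2 : (((Nat.card K + 1 : ℕ)) : MvPolynomial (Fin N) K) = 1 := by
      rw [← map_natCast (C : K →+* MvPolynomial (Fin N) K), Nat.cast_add, natCast_natCard]
      simp
    rw [nsmul_eq_mul, h2, one_mul] at h1
    rw [← h1, frobeniusForm]
    refine Finset.sum_congr rfl fun i _ => ?_
    rw [hpd, Finset.mul_sum]
    exact Finset.sum_congr rfl fun j _ => by ring

/-- Rational points carry no information, as the form vanishes at all of them. At w + τ w' with τ ^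
q ≠ τ its value is (τ ^ q - τ) times the pairing of w and w'. -/
theorem dotProduct_mulVec_eq_zero_of_containsSubspace {A : Matrix (Fin N) (Fin N) K}
    (hA : A.transpose = -A) (hA0 : ∀ i, A i i = 0) {W : Submodule K (Fin N → K)}
    (hW : ContainsSubspace (frobeniusForm A) W) {w w' : Fin N → K} (hw : w ∈ W) (hw' : w' ∈ W) :
    w ⬝ᵥ A.mulVec w' = 0 := by
  obtain ⟨τ, hτ⟩ := exists_pow_natCard_ne K
  have hm : (fun i => algebraMap K (AlgebraicClosure K) (w i)) +
      τ • (fun i => algebraMap K (AlgebraicClosure K) (w' i)) ∈ geometricSpan W :=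
    Submodule.add_mem _ (Submodule.subset_span ⟨w, hw, rfl⟩)
      (Submodule.smul_mem _ _ (Submodule.subset_span ⟨w', hw', rfl⟩))
  have h1 := hW _ hm
  have hb : ∀ v v' : Fin N → K, ∑ i, ∑ j, algebraMap K (AlgebraicClosure K) (A i j) *
      algebraMap K (AlgebraicClosure K) (v i) * algebraMap K (AlgebraicClosure K) (v' j) =
        algebraMap K (AlgebraicClosure K) (v ⬝ᵥ A.mulVec v') := by
    intro v v'
    simp only [dotProduct, Matrix.mulVec, Finset.mul_sum, map_sum, map_mul]
    exact Finset.sum_congr rfl fun i _ => Finset.sum_congr rfl fun j _ => by ring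
  have h2 : aeval ((fun i => algebraMap K (AlgebraicClosure K) (w i)) +
      τ • (fun i => algebraMap K (AlgebraicClosure K) (w' i))) (frobeniusForm A) =
      algebraMap K (AlgebraicClosure K) (w ⬝ᵥ A.mulVec w) +
      τ ^ Nat.card K * algebraMap K (AlgebraicClosure K) (w ⬝ᵥ A.mulVec w') +
      τ * algebraMap K (AlgebraicClosure K) (w' ⬝ᵥ A.mulVec w) +
      τ * τ ^ Nat.card K * algebraMap K (AlgebraicClosure K) (w' ⬝ᵥ A.mulVec w') := by
    rw [aeval_frobeniusForm, ← hb, ← hb, ← hb, ← hb]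
    simp only [Finset.mul_sum, ← Finset.sum_add_distrib, Pi.add_apply, Pi.smul_apply, smul_eq_mul,
      add_pow_natCard, mul_pow, algebraMap_pow_natCard]
    exact Finset.sum_congr rfl fun i _ => Finset.sum_congr rfl fun j _ => by ring
  have h3 : w' ⬝ᵥ A.mulVec w = -(w ⬝ᵥ A.mulVec w') := by
    have := dotProduct_mulVec_self hA hA0 (w + w')
    rw [Matrix.mulVec_add, add_dotProduct, dotProduct_add, dotProduct_add,
      dotProduct_mulVec_self hA hA0, dotProduct_mulVec_self hA hA0] at this
    linear_combination this
  rw [h1, h3, dotProduct_mulVec_self hA hA0, dotProduct_mulVec_self hA hA0, map_neg, map_zero] at h2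
  have h4 : (τ ^ Nat.card K - τ) * algebraMap K (AlgebraicClosure K) (w ⬝ᵥ A.mulVec w') = 0 := by
    linear_combination -h2
  rcases mul_eq_zero.1 h4 with h5 | h5
  · exact absurd (sub_eq_zero.1 h5) hτ
  · exact (map_eq_zero _).1 h5

/-- The hyperplane W = ker T is totally isotropic, so the alternating form is T(y) Φ(x) - T(x) Φ(y)
and the Frobenius form is Φ T ^ q - T Φ ^ q. Up to sign this is T times the product of Φ - a T over
all a in `K`. -/
theorem isUnionOfHyperplanes_frobeniusForm {n : ℕ} {A : Matrix (Fin (n + 2)) (Fin (n + 2)) K}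
    (hA : A.transpose = -A) (hA0 : ∀ i, A i i = 0) (hF0 : frobeniusForm A ≠ 0)
    {W : Submodule K (Fin (n + 2) → K)} (hWn : Module.finrank K W = n + 1)
    (hW : ContainsSubspace (frobeniusForm A) W) :
    IsUnionOfHyperplanesThroughCodimTwo (frobeniusForm A) (Nat.card K + 1) := by
  have hq := two_le_card (K := K)
  obtain ⟨T, u, hTu, rfl⟩ := exists_dual_of_finrank_add_one
    (show Module.finrank K W + 1 = n + 2 by rw [hWn])
  let b : LinearMap.BilinForm K (Fin (n + 2) → K) := Matrix.toBilin' A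
  have hb : ∀ x y, b x y = x ⬝ᵥ A.mulVec y := fun x y => Matrix.toBilin'_apply' A x y
  have hbalt : ∀ x, b x x = 0 := fun x => by rw [hb, dotProduct_mulVec_self hA hA0]
  have hbskew : ∀ x y, b x y = -b y x := fun x y => by
    have := hbalt (x + y)
    simp only [map_add, LinearMap.add_apply, hbalt] at this
    linear_combination this
  let Φ : (Fin (n + 2) → K) →ₗ[K] K := b.flip u
  have hΦ : ∀ x, Φ x = b x u := fun x => rfl
  have hbT : ∀ x y, b x y = T y * Φ x - T x * Φ y := by
    intro x y
    have hmem : ∀ z, z - T z • u ∈ LinearMap.ker T := fun z => by simp [hTu]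
    have h1 := dotProduct_mulVec_eq_zero_of_containsSubspace hA hA0 hW (hmem x) (hmem y)
    rw [← hb] at h1
    simp only [map_sub, map_smul, LinearMap.sub_apply, LinearMap.smul_apply, smul_eq_mul,
      hbalt] at h1
    rw [hΦ, hΦ]
    linear_combination h1 + T x * hbskew u y
  have hAij : ∀ i j, A i j = T (Pi.single j 1) * Φ (Pi.single i 1) -
      T (Pi.single i 1) * Φ (Pi.single j 1) := by
    intro i j
    rw [← hbT]
    exact (Matrix.toBilin'_single A i j).symm
  have hval : ∀ x : Fin (n + 2) → AlgebraicClosure K, aeval x (frobeniusForm A) =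
      geometricForm Φ x * geometricForm T x ^ Nat.card K -
        geometricForm T x * geometricForm Φ x ^ Nat.card K := by
    intro x
    simp only [aeval_frobeniusForm, geometricForm_apply, sum_pow_natCard, Finset.sum_mul_sum,
      ← Finset.sum_sub_distrib, mul_pow, algebraMap_pow_natCard, hAij, map_sub, map_mul]
    exact Finset.sum_congr rfl fun i _ => Finset.sum_congr rfl fun j _ => by ring
  obtain ⟨v, hTv, hΦv⟩ : ∃ v, T v = 0 ∧ Φ v = 1 := by
    obtain ⟨v, hTv, hΦv⟩ : ∃ v, T v = 0 ∧ Φ v ≠ 0 := by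
      by_contra! h
      have hΦ0 : Φ = 0 := by
        obtain ⟨c, hc⟩ := exists_eq_smul_of_ker_le h
        have h1 : Φ u = c * T u := by rw [hc]; rfl
        rw [hΦ, hbalt, hTu, mul_one] at h1
        rw [hc, ← h1, zero_smul]
      refine hF0 ?_
      have hA : A = 0 := by
        ext i j
        rw [hAij, hΦ0]
        simp
      simp [hA, frobeniusForm]
    exact ⟨(Φ v)⁻¹ • v, by simp [hTv], by simp [hΦv]⟩
  refine isUnionOfHyperplanes_of_aeval_eq_zero_iff (Φ := Φ) hTu hTv (hbalt u) hΦv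
    (a := (Finite.equivFin K).symm) (Equiv.injective _) fun x => ?_
  rw [hval]
  constructor
  · intro h
    by_cases ht : geometricForm T x = 0
    · exact Or.inl ht
    · right
      obtain ⟨a, ha⟩ := exists_eq_algebraMap_of_pow_natCard
        (τ := geometricForm Φ x / geometricForm T x) (by
          rw [div_pow, div_eq_div_iff (pow_ne_zero _ ht) ht]
          linear_combination -h)
      refine ⟨Finite.equivFin K a, ?_⟩
      rw [Equiv.symm_apply_apply, ← ha, div_mul_cancel₀ _ ht]
  · rintro (ht | ⟨i, hi⟩)
    · rw [ht, zero_pow (by omega), mul_zero, zero_mul, sub_zero]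
    · rw [hi, mul_pow, algebraMap_pow_natCard]
      ring

end FrobeniusForm

end FqHypersurface

end

noncomputable section

namespace FqHypersurface

variable {K : Type*} [Field K] [Finite K]

/-! ### The bound and its equality cases -/

theorem natCard_zeros_le_pow {N : ℕ} (F : MvPolynomial (Fin N) K) :
    Nat.card {x : Fin N → K // eval x F = 0} ≤ Nat.card K ^ N := by
  have := Finite.card_subtype_le fun x : Fin N → K => eval x F = 0
  rwa [Nat.card_fun, Nat.card_fin] at this

theorem natCard_zeros_eq_pow_iff {N : ℕ} {F : MvPolynomial (Fin N) K} :
    Nat.card {x : Fin N → K // eval x F = 0} = Nat.card K ^ N ↔ ∀ x, eval x F = 0 := by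
  have hV : Nat.card (Fin N → K) = Nat.card K ^ N := by rw [Nat.card_fun, Nat.card_fin]
  rw [← hV]
  constructor
  · intro h x
    by_contra hx
    exact (Finite.card_subtype_lt (p := fun x : Fin N → K => eval x F = 0) hx).ne h
  · intro h
    exact Nat.card_congr (Equiv.subtypeUnivEquiv h)

/-- Here b = q ^ (n + 1) - q ^ k; its positivity singles out d = q + 1 as the only degree above q in
which the bound can be attained. -/
theorem exists_bound_eq_add {n d k : ℕ} (hkn : k ≤ n) (hd : Nat.card K + 1 ≤ d) :
    ∃ b, 0 < b ∧ (d - 1) * Nat.card K ^ (n + 1) + Nat.card K ^ (k + 1) =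
      Nat.card K ^ (n + 2) + (d - 1) * Nat.card K ^ k + (d - (Nat.card K + 1)) * b := by
  have hq := two_le_card (K := K)
  obtain ⟨c, rfl⟩ := Nat.exists_eq_add_of_le hd
  have h1 : Nat.card K ^ k < Nat.card K ^ (n + 1) := Nat.pow_lt_pow_right (by omega) (by omega)
  obtain ⟨b, hb⟩ := Nat.exists_eq_add_of_le h1.le
  refine ⟨b, by omega, ?_⟩
  rw [Nat.add_sub_cancel_left, show Nat.card K + 1 + c - 1 = Nat.card K + c by omega,
    show n + 2 = n + 1 + 1 from rfl, pow_succ _ (n + 1), hb, pow_succ]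
  ring

section

variable {n d k : ℕ} {F : MvPolynomial (Fin (n + 2)) K}

theorem natCard_zeros_add_le (hF : F.IsHomogeneous d) (hd : 2 ≤ d)
    (hk : IsGreatest (linearDims F) k) (hkn : k ≤ n) :
    Nat.card {x : Fin (n + 2) → K // eval x F = 0} + (d - 1) * Nat.card K ^ k ≤
      (d - 1) * Nat.card K ^ (n + 1) + Nat.card K ^ (k + 1) := by
  rcases Nat.lt_or_ge (Nat.card K) d with hdq | hdq
  · obtain ⟨b, -, hb⟩ := exists_bound_eq_add (K := K) hkn hdq
    have := natCard_zeros_le_pow F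
    omega
  · obtain ⟨L, hLk, hL⟩ := hk.1
    have h1 := (card_zeros_add_le hF (by omega) hdq hk.2
      ⟨hLk, fun x hx => eval_eq_zero_of_containsSubspace hL hx⟩).1
    rw [Module.natCard_eq_pow_finrank (K := K) (V := L), hLk, Nat.card_fun, Nat.card_fin] at h1
    refine Nat.le_of_mul_le_mul_left ?_ (show 0 < Nat.card K from Nat.card_pos)
    calc _ = _ := by ring
      _ ≤ _ := h1
      _ = _ := by ring

theorem cases_of_natCard_zeros_add_eq (hd : 2 ≤ d) (hF0 : F ≠ 0) (hF : F.IsHomogeneous d)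
    (hk : IsGreatest (linearDims F) k) (hk0 : 0 < k) (hkn : k ≤ n)
    (h : Nat.card {x : Fin (n + 2) → K // eval x F = 0} + (d - 1) * Nat.card K ^ k =
      (d - 1) * Nat.card K ^ (n + 1) + Nat.card K ^ (k + 1)) :
    (k = n ∧ IsUnionOfHyperplanesThroughCodimTwo F d) ∨
      (k ≤ n - 1 ∧ (SpaceFillingCase F d ∨ HermitianCase F d k ∨ QuadricCase F d k)) := by
  obtain ⟨L, hLk, hL⟩ := hk.1
  -- Above q, equality leaves only space-filling forms, and k = n among them falls under unions of
  -- hyperplanes. Up to q, the form is extremal along L.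
  rcases Nat.lt_or_ge (Nat.card K) d with hdq | hdq
  · obtain ⟨b, hb0, hb⟩ := exists_bound_eq_add (K := K) hkn hdq
    have h1 := natCard_zeros_le_pow F
    have h2 : (d - (Nat.card K + 1)) * b = 0 := by omega
    have h3 : d = Nat.card K + 1 := by
      rcases Nat.mul_eq_zero.1 h2 with h3 | h3 <;> omega
    subst h3
    have h4 := natCard_zeros_eq_pow_iff.1 (show Nat.card {x // eval x F = 0} = _ by omega)
    obtain ⟨A, hA, hA0, rfl⟩ := exists_eq_frobeniusForm hF h4
    rcases Nat.lt_or_ge k n with hlt | hge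
    · exact Or.inr ⟨by omega, Or.inl ⟨rfl, A, hA, hA0, rfl⟩⟩
    · obtain rfl : k = n := by omega
      exact Or.inl ⟨rfl, isUnionOfHyperplanes_frobeniusForm hA hA0 hF0 hLk hL⟩
  · have hL' : IsZeroSpace F k L := ⟨hLk, fun x hx => eval_eq_zero_of_containsSubspace hL hx⟩
    have hext : IsExtremal F d k := ⟨hF, hd, hdq, hk.2, by
      linear_combination Nat.card K * h⟩
    rcases Nat.lt_or_ge k n with hlt | hge
    · refine Or.inr ⟨by omega, Or.inr ?_⟩
      rcases Nat.lt_or_ge 2 d with hd3 | hd2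
      · exact Or.inl (hext.hermitianCase hL' hk0 (by omega) hd3)
      · obtain rfl : d = 2 := by omega
        refine Or.inr (quadricCase_of_natCard hF hkn ?_)
        obtain ⟨c, hc⟩ : ∃ c, Nat.card K = c + 1 := ⟨Nat.card K - 1, by omega⟩
        rw [show Nat.card K - 1 = c by omega]
        have hc' : (Nat.card K : ℤ) = c + 1 := by exact_mod_cast hc
        zify at h ⊢
        linear_combination (Nat.card K : ℤ) * h + (Nat.card K : ℤ) ^ (k + 1) * hc'
    · obtain rfl : k = n := by omega
      exact Or.inl ⟨rfl, hext.isUnionOfHyperplanes hL'⟩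

theorem natCard_zeros_add_eq_of_cases (hd : 2 ≤ d) (hkn : k ≤ n)
    (h : (k = n ∧ IsUnionOfHyperplanesThroughCodimTwo F d) ∨
      (k ≤ n - 1 ∧ (SpaceFillingCase F d ∨ HermitianCase F d k ∨ QuadricCase F d k))) :
    Nat.card {x : Fin (n + 2) → K // eval x F = 0} + (d - 1) * Nat.card K ^ k =
      (d - 1) * Nat.card K ^ (n + 1) + Nat.card K ^ (k + 1) := by
  rcases h with ⟨rfl, h⟩ | ⟨-, ⟨rfl, A, hA, hA0, rfl⟩ | h | h⟩
  · exact h.natCard_zeros (by omega)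
  · have h1 := (natCard_zeros_eq_pow_iff (F := frobeniusForm A)).2 fun x => by
      rw [eval_frobeniusForm, dotProduct_mulVec_self hA hA0]
    obtain ⟨b, -, hb⟩ := exists_bound_eq_add (K := K) hkn le_rfl
    rw [hb, h1, Nat.sub_self, zero_mul, add_zero]
  · exact h.natCard_zeros
  · have h1 := h.natCard_zeros
    obtain rfl : d = 2 := h.1
    have hq := two_le_card (K := K)
    obtain ⟨c, hc⟩ : ∃ c, Nat.card K = c + 1 := ⟨Nat.card K - 1, by omega⟩
    rw [show Nat.card K - 1 = c by omega] at h1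
    have hc' : (Nat.card K : ℤ) = c + 1 := by exact_mod_cast hc
    refine Nat.eq_of_mul_eq_mul_left (show 0 < Nat.card K by omega) ?_
    zify at h1 ⊢
    push_cast
    linear_combination h1 - (Nat.card K : ℤ) ^ (k + 1) * hc'

end

end FqHypersurface

end

open FqHypersurface
theorem theorem1 {K : Type*} [Field K] [Finite K] (n d k : ℕ) (hn : 1 ≤ n) (hd : 2 ≤ d)
    (F : MvPolynomial (Fin (n + 2)) K) (hF0 : F ≠ 0) (hF : F.IsHomogeneous d)
    (hk : IsGreatest (linearDims F) k) (hk0 : 0 < k) (hkn : k ≤ n) :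
    numPoints F ≤
        (d - 1) * Nat.card K ^ k * numPointsProj K (n - k) + numPointsProj K k ∧
      (numPoints F =
          (d - 1) * Nat.card K ^ k * numPointsProj K (n - k) + numPointsProj K k ↔
        (k = n ∧ IsUnionOfHyperplanesThroughCodimTwo F d) ∨
          (k ≤ n - 1 ∧ (SpaceFillingCase F d ∨ HermitianCase F d k ∨ QuadricCase F d k))) ∧
      (∀ A : Matrix (Fin (n + 2)) (Fin (n + 2)) K,
        A.transpose = -A → (∀ i, A i i = 0) → F = frobeniusForm A →
          rationalPoints F = Set.univ ∧ (Nonsingular F ↔ A.det ≠ 0) ∧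
            (Odd n → ¬ Nonsingular F)) := by
  refine ⟨(numPoints_le_iff hkn (by omega) hF).2 (natCard_zeros_add_le hF hd hk hkn),
    (numPoints_eq_iff hkn (by omega) hF).trans
      ⟨cases_of_natCard_zeros_add_eq hd hF0 hF hk hk0 hkn, natCard_zeros_add_eq_of_cases hd hkn⟩,
    ?_⟩
  rintro A hA hA0 rfl
  have hns := nonsingular_frobeniusForm_iff hA hA0
  refine ⟨Set.eq_univ_of_forall fun P => ?_, hns, fun hodd h => hns.1 h ?_⟩
  · change eval P.rep (frobeniusForm A) = 0
    rw [eval_frobeniusForm, dotProduct_mulVec_self hA hA0]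
  · refine det_eq_zero_of_odd hA hA0 ?_
    rw [Fintype.card_fin]
    exact hodd.add_even even_two
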